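/- Let $(Y,g_Y)$ be a Riemannian 3-manifold and let $\pi:\mathbb M\to Y$ be a hyperkähler bundle, that is, a smooth fibre bundle whose fibres $\mathbb M_y$ carry Riemannian metrics depending smoothly on $y$, together with a smooth bundle isometry $\gamma:S(T^*Y)\to\mathfrak b(\mathbb M)$ from the unit cotangent sphere bundle to the bundle of 2-spheres $\{aI+bJ+cK: a^2+b^2+c^2=1\}$ of complex structures of the fibres, where $I,J,K$ are integrable almost complex structures on $\mathbb M_y$, Kähler for its metric, with $I^2=J^2=K^2=IJK=-1$. Denote by $\mathcal V\mathbb M=\ker d\pi$ the vertical bundle, and by $\gamma:\pi^*T^*Y\to\mathrm{End}(\mathcal V\mathbb M)$ also the linear extension of $\gamma$. Fix an Ehresmann connection on $\mathbb M$, with vertical projection $\pi^v:T\mathbb M\to\mathcal V\mathbb M$. For a smooth section $s$ put $\nabla s=\pi^v\circ ds\in\Omega^1(Y,s^*\mathcal V\mathbb M)$, and define the Fueter operator by $$\mathfrak F s=s^*\gamma\circ\nabla s=\sum_i\gamma(e^i)\,\nabla_{e_i}s\in\Gamma(Y,s^*\mathcal V\mathbb M),$$ where $(e_i)$ is a basis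 of $T_yY$ with dual basis $(e^i)$. Let $\phi$ be a smooth section of $\mathbb M$. The linearization $L_\phi\mathcal O$ of $\mathcal O=\nabla$ or $\mathcal O=\mathfrak F$ at $\phi$ sends $\psi\in\Gamma(Y,\phi^*\mathcal V\mathbb M)$ to $$(L_\phi\mathcal O)\psi=\frac{d}{dt}\Big|_{t=0}P_{\phi_t}\,\mathcal O(\phi_t),$$ where $(\phi_t)$ is a smooth curve of sections with $\phi_0=\phi$ and $\frac{d}{dt}|_{t=0}\phi_t=\psi$ (for the value at a point $y$, it is enough that the latter holds near $y$), and where $P_{\phi_t}:\phi_t^*\mathcal V\mathbb M\to\phi^*\mathcal V\mathbb M$ is given at each $y$ by parallel transport along $s\mapsto\phi_s(y)$ for the Levi-Civita connection of the fibre $\mathbb M_y$. Then: 1. $\phi^*\mathcal V\mathbb M\to Y$ with the action $\phi^*\gamma$ is a Clifford module: $\gamma(\alpha)^2=-|\alpha|^2$ for every covector $\alpha$ of $Y$. 2. The linearization $\nabla^\phi:=L_\phi\nabla$ is well defined (for every $\psi$ and $y$ there are curves of sections as above, and the derivative exists and does not depend on the choice of the curve), and it is a linear connection on the vector bundle $\phi^*\mathcal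 V\mathbb M\to Y$. 3. The linearization of the Fueter operator at $\phi$ is well defined in the same sense, and it is the Dirac operator built from $\nabla^\phi$: $$L_\phi\mathfrak F=D^\phi:=\phi^*\gamma\circ\nabla^\phi.$$ 4. In particular $L_\phi\mathfrak F$ is an elliptic linear differential operator of first order on $\phi^*\mathcal V\mathbb M$. -/

import Mathlib

open Bundle
open scoped Manifold ContDiff Topology

noncomputable section

/-! ## Fibre bundles over a 3-manifold and their vertical bundle

`Y` is the base (modelled on `ℝ³`), `N` is the total space (modelled on `E`),
`pr : N → Y` is the projection and `M` (modelled on `F`) is the typical fibre. -/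

section VerticalBundle

variable {E : Type*} [NormedAddCommGroup E] [NormedSpace ℝ E]
  {Y : Type*} [TopologicalSpace Y] [ChartedSpace (EuclideanSpace ℝ (Fin 3)) Y]
  {N : Type*} [TopologicalSpace N] [ChartedSpace E N] [IsManifold 𝓘(ℝ, E) ∞ N]

/-- `pr : N → Y` is a smooth fibre bundle with typical fibre `M`: it is smooth, and every point of
`Y` has an open neighbourhood `U` with a diffeomorphism `pr⁻¹(U) ≃ U × M` over `U`. -/
structure IsSmoothFiberBundle (F : Type*) [NormedAddCommGroup F] [NormedSpace ℝ F]
    (M : Type*) [TopologicalSpace M] [ChartedSpace F M] (pr : N → Y) : Prop where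
  contMDiff : ContMDiff 𝓘(ℝ, E) (𝓡 3) ∞ pr
  locallyTrivial : ∀ y₀ : Y, ∃ (U : Set Y) (Φ : OpenPartialHomeomorph N (Y × M)),
    IsOpen U ∧ y₀ ∈ U ∧ Φ.source = pr ⁻¹' U ∧ Φ.target = U ×ˢ Set.univ ∧
    ContMDiffOn 𝓘(ℝ, E) ((𝓡 3).prod 𝓘(ℝ, F)) ∞ Φ Φ.source ∧
    ContMDiffOn ((𝓡 3).prod 𝓘(ℝ, F)) 𝓘(ℝ, E) ∞ Φ.symm Φ.target ∧
    ∀ p ∈ Φ.source, (Φ p).1 = pr p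

/-- The fibre of `pr` over `y`. -/
abbrev Fib (pr : N → Y) (y : Y) : Type _ := {p : N // pr p = y}

/-- The vertical tangent space at `p`: the kernel of `dpr`, i.e. the tangent space at `p` of the
fibre through `p`. -/
def VerticalSpace (pr : N → Y) (p : N) : Submodule ℝ (TangentSpace 𝓘(ℝ, E) p) :=
  LinearMap.ker (mfderiv 𝓘(ℝ, E) (𝓡 3) pr p).toLinearMap

/-- A vertical vector regarded as an element of the model space `E` of the total space, through the
identification of `T_p N` with `E` (given by the preferred chart at `p`). -/
def toModel {pr : N → Y} {p : N} (u : VerticalSpace (E := E) pr p) : E :=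
  (u : TangentSpace 𝓘(ℝ, E) p)

open Classical in
/-- The vertical vector given by a tangent vector that is vertical (zero if it is not). -/
def toVertical (pr : N → Y) (p : N) (v : TangentSpace 𝓘(ℝ, E) p) : VerticalSpace (E := E) pr p :=
  if h : v ∈ VerticalSpace (E := E) pr p then ⟨v, h⟩ else 0

/-- Smoothness at `p` of a vertical vector field on the total space. -/
def VSmoothAt {pr : N → Y} (X : Π q : N, VerticalSpace (E := E) pr q) (p : N) : Prop :=
  ContMDiffAt 𝓘(ℝ, E) 𝓘(ℝ, E).tangent ∞
    (fun q ↦ (⟨q, (X q : TangentSpace 𝓘(ℝ, E) q)⟩ : TangentBundle 𝓘(ℝ, E) N)) p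

/-- The Lie bracket of vertical vector fields, which is again vertical. Its restriction to a fibre
depends only on the restrictions of the fields to that fibre, and is the Lie bracket there. -/
def vBracket {pr : N → Y} (X Z : Π q : N, VerticalSpace (E := E) pr q) (p : N) :
    VerticalSpace (E := E) pr p :=
  toVertical pr p (VectorField.mlieBracket 𝓘(ℝ, E)
    (fun q ↦ (X q : TangentSpace 𝓘(ℝ, E) q)) (fun q ↦ (Z q : TangentSpace 𝓘(ℝ, E) q)) p)

/-- The derivative of a function along a vertical vector. -/
def vDeriv {pr : N → Y} {p : N} (u : VerticalSpace (E := E) pr p) (f : N → ℝ) : ℝ :=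
  mvfderiv 𝓘(ℝ, E) f p (u : TangentSpace 𝓘(ℝ, E) p)

/-- A smooth Riemannian metric on the vertical bundle, i.e. a smooth family of Riemannian metrics on
the fibres of `pr`. -/
structure VerticalMetric (E : Type*) [NormedAddCommGroup E] [NormedSpace ℝ E]
    {N : Type*} [TopologicalSpace N] [ChartedSpace E N] [IsManifold 𝓘(ℝ, E) ∞ N] (pr : N → Y) where
  inner : Π p : N, VerticalSpace (E := E) pr p →ₗ[ℝ] VerticalSpace (E := E) pr p →ₗ[ℝ] ℝ
  symm : ∀ p u w, inner p u w = inner p w u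
  pos : ∀ p u, u ≠ 0 → 0 < inner p u u
  smooth : ∀ p (X Z : Π q : N, VerticalSpace (E := E) pr q), VSmoothAt X p → VSmoothAt Z p →
    ContMDiffAt 𝓘(ℝ, E) 𝓘(ℝ, ℝ) ∞ (fun q ↦ inner q (X q) (Z q)) p

/-! ### The Levi-Civita connection of the fibres and its parallel transport -/

/-- The value `⟨∇_X Z, W⟩` at `p` for the Levi-Civita connection `∇` of the fibre through `p`, given
by the Koszul formula, for vertical vector fields `X`, `Z`, `W`. -/
def leviCivita {pr : N → Y} (g : VerticalMetric E pr) (X Z W : Π q : N, VerticalSpace (E := E) pr q)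
    (p : N) : ℝ :=
  (1 / 2) *
    (vDeriv (X p) (fun q ↦ g.inner q (Z q) (W q)) + vDeriv (Z p) (fun q ↦ g.inner q (X q) (W q))
      - vDeriv (W p) (fun q ↦ g.inner q (X q) (Z q))
      + g.inner p (vBracket X Z p) (W p) - g.inner p (vBracket X W p) (Z p)
      - g.inner p (vBracket Z W p) (X p))

/-- A field `W` of vertical vectors along a curve `c` in a fibre is parallel at time `s`, i.e. its
covariant derivative along `c` for the Levi-Civita connection `∇` of the fibre vanishes at `s`:
for every vector field `Z` on the fibre, `d/ds ⟨W, Z⟩ = ⟨W, ∇_{c'} Z⟩`. The right-hand side is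
computed with arbitrary extensions `C` of the vector `c'(s)` and `U` of the vector `W(s)`. -/
def IsParallelAt {pr : N → Y} (g : VerticalMetric E pr) (c : ℝ → N)
    (W : Π s : ℝ, VerticalSpace (E := E) pr (c s)) (s : ℝ) : Prop :=
  ∀ Z C U : Π q : N, VerticalSpace (E := E) pr q,
    VSmoothAt Z (c s) → VSmoothAt C (c s) → VSmoothAt U (c s) →
    toModel (C (c s)) = (mfderiv 𝓘(ℝ, ℝ) 𝓘(ℝ, E) c s (1 : ℝ) : E) → U (c s) = W s →
    HasDerivAt (fun r ↦ g.inner (c r) (W r) (Z (c r))) (leviCivita g C Z U (c s)) s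

open Classical in
/-- Parallel transport, for the Levi-Civita connection of the fibre, along the curve `c` from `c t`
back to `c 0`: it sends `W(t)` to `W(0)` for every parallel field `W` along `c` between `0` and
`t`. -/
def parallelTransport {pr : N → Y} (g : VerticalMetric E pr) (c : ℝ → N) (t : ℝ)
    (u : VerticalSpace (E := E) pr (c t)) : VerticalSpace (E := E) pr (c 0) :=
  if h : ∃ W : Π s : ℝ, VerticalSpace (E := E) pr (c s),
      (∀ s ∈ Set.uIcc 0 t, IsParallelAt g c W s) ∧ W t = u
  then h.choose 0 else 0

/-! ### Hyperkähler fibres -/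

/-- A vertical vector field `X'` which on the fibre over `y` equals `J X`. -/
def IsImageOnFib {pr : N → Y} {y : Y} (J : Π p : Fib pr y, Module.End ℝ (VerticalSpace (E := E) pr p.1))
    (X X' : Π q : N, VerticalSpace (E := E) pr q) : Prop :=
  ∀ p : Fib pr y, X' p.1 = J p (X p.1)

/-- `J` is an integrable almost complex structure on the fibre over `y`, for which the metric of the
fibre is Kähler: `J² = -1`, `J` is orthogonal, its Nijenhuis tensor vanishes, and the Kähler form
`ω(u, w) = g(J u, w)` is closed. -/
structure IsKahlerOnFib {pr : N → Y} (g : VerticalMetric E pr) (y : Y)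
    (J : Π p : Fib pr y, Module.End ℝ (VerticalSpace (E := E) pr p.1)) : Prop where
  sq : ∀ p u, J p (J p u) = -u
  orthogonal : ∀ p u w, g.inner p.1 (J p u) (J p w) = g.inner p.1 u w
  integrable : ∀ (p : Fib pr y) (X X' Z Z' : Π q : N, VerticalSpace (E := E) pr q),
    VSmoothAt X p.1 → VSmoothAt X' p.1 → VSmoothAt Z p.1 → VSmoothAt Z' p.1 →
    IsImageOnFib J X X' → IsImageOnFib J Z Z' →
    vBracket X' Z' p.1 - J p (vBracket X' Z p.1) - J p (vBracket X Z' p.1) - vBracket X Z p.1 = 0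
  closed : ∀ (p : Fib pr y) (X X' Z Z' W : Π q : N, VerticalSpace (E := E) pr q),
    VSmoothAt X p.1 → VSmoothAt X' p.1 → VSmoothAt Z p.1 → VSmoothAt Z' p.1 →
    VSmoothAt W p.1 → IsImageOnFib J X X' → IsImageOnFib J Z Z' →
    vDeriv (X p.1) (fun q ↦ g.inner q (Z' q) (W q))
      - vDeriv (Z p.1) (fun q ↦ g.inner q (X' q) (W q))
      + vDeriv (W p.1) (fun q ↦ g.inner q (X' q) (Z q))
      - g.inner p.1 (J p (vBracket X Z p.1)) (W p.1)
      + g.inner p.1 (J p (vBracket X W p.1)) (Z p.1)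
      - g.inner p.1 (J p (vBracket Z W p.1)) (X p.1) = 0

/-- `(g, I, J, K)` is a hyperkähler structure on the fibre over `y`: three integrable almost complex
structures that are Kähler for `g`, with `I² = J² = K² = IJK = -1`. -/
structure IsHyperkahlerOnFib {pr : N → Y} (g : VerticalMetric E pr) (y : Y)
    (I J K : Π p : Fib pr y, Module.End ℝ (VerticalSpace (E := E) pr p.1)) : Prop where
  kahler_I : IsKahlerOnFib g y I
  kahler_J : IsKahlerOnFib g y J
  kahler_K : IsKahlerOnFib g y K
  mul : ∀ p u, I p (J p (K p u)) = -u

end VerticalBundle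

/-! ## Hyperkähler bundles, connections and the Fueter operator -/

section Bundles

variable {Y : Type*} [TopologicalSpace Y] [ChartedSpace (EuclideanSpace ℝ (Fin 3)) Y]
  [IsManifold (𝓡 3) ∞ Y] [RiemannianBundle (fun y : Y ↦ TangentSpace (𝓡 3) y)]
  {E : Type*} [NormedAddCommGroup E] [NormedSpace ℝ E]
  {N : Type*} [TopologicalSpace N] [ChartedSpace E N] [IsManifold 𝓘(ℝ, E) ∞ N]

/-- A hyperkähler bundle over the Riemannian 3-manifold `Y`, with total space `N` and fibre `M`.
Besides the fibre bundle and the metrics of the fibres, it consists of a bundle isometry from the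
unit cotangent sphere bundle of `Y` to the bundle of spheres `{aI + bJ + cK : a² + b² + c² = 1}` of
complex structures of the fibres, recorded through its linear extension `cliff`. For a fibre, to be
such an isometry means that the images of some orthonormal coframe form a triple `(I, J, K)` which
makes the fibre a hyperkähler manifold. -/
structure HyperkahlerBundle (F : Type*) [NormedAddCommGroup F] [NormedSpace ℝ F]
    (M : Type*) [TopologicalSpace M] [ChartedSpace F M] (E : Type*) [NormedAddCommGroup E]
    [NormedSpace ℝ E] {N : Type*} [TopologicalSpace N] [ChartedSpace E N] [IsManifold 𝓘(ℝ, E) ∞ N] (pr : N → Y) where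
  isFiberBundle : IsSmoothFiberBundle F M pr (E := E)
  metric : VerticalMetric E pr
  /-- the Clifford action `γ` of covectors of `Y` on vertical vectors -/
  cliff : Π y : Y, (TangentSpace (𝓡 3) y →L[ℝ] ℝ) →ₗ[ℝ]
    (Π p : Fib pr y, Module.End ℝ (VerticalSpace (E := E) pr p.1))
  cliff_smooth : ∀ (p : N) (f : Y → ℝ) (X : Π q : N, VerticalSpace (E := E) pr q),
    ContMDiffAt (𝓡 3) 𝓘(ℝ, ℝ) ∞ f (pr p) → VSmoothAt X p →
    VSmoothAt (fun q ↦ cliff (pr q) (mvfderiv (𝓡 3) f (pr q)) ⟨q, rfl⟩ (X q)) p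
  hyperkahler : ∀ y : Y, ∃ b : OrthonormalBasis (Fin 3) ℝ (TangentSpace (𝓡 3) y),
    IsHyperkahlerOnFib metric y
      (cliff y (innerSL ℝ (b 0))) (cliff y (innerSL ℝ (b 1))) (cliff y (innerSL ℝ (b 2)))

/-- An Ehresmann connection on `pr : N → Y`, given by the smooth projection `T N → V N` onto the
vertical bundle; the horizontal bundle is the kernel of this projection. -/
structure EhresmannConnection (E : Type*) [NormedAddCommGroup E]
    [NormedSpace ℝ E] {N : Type*} [TopologicalSpace N] [ChartedSpace E N] [IsManifold 𝓘(ℝ, E) ∞ N] (pr : N → Y) where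
  proj : Π p : N, TangentSpace 𝓘(ℝ, E) p →ₗ[ℝ] VerticalSpace (E := E) pr p
  proj_vertical : ∀ p (u : VerticalSpace (E := E) pr p), proj p u = u
  smooth : ∀ (p : N) (X : Π q : N, TangentSpace 𝓘(ℝ, E) q),
    ContMDiffAt 𝓘(ℝ, E) 𝓘(ℝ, E).tangent ∞ (fun q ↦ (⟨q, X q⟩ : TangentBundle 𝓘(ℝ, E) N)) p →
    VSmoothAt (fun q ↦ proj q (X q)) p

/-- The covariant derivative `∇s` at `y` of a map `s : Y → N`: the vertical part of `ds`. -/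
def EhresmannConnection.covDeriv {pr : N → Y} (A : EhresmannConnection E pr) (s : Y → N) (y : Y) :
    TangentSpace (𝓡 3) y →ₗ[ℝ] VerticalSpace (E := E) pr (s y) :=
  A.proj (s y) ∘ₗ (mfderiv (𝓡 3) 𝓘(ℝ, E) s y).toLinearMap

variable {F : Type*} [NormedAddCommGroup F] [NormedSpace ℝ F]
  {M : Type*} [TopologicalSpace M] [ChartedSpace F M]

/-- The contraction `∑ᵢ γ(eⁱ) a(eᵢ)` of the Clifford action at `p` with a vector valued covector
`a`. It does not depend on the basis `(eᵢ)` of `T_y Y` with dual basis `(eⁱ)`; here the coordinate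
basis of the preferred chart at `y` is used. -/
def HyperkahlerBundle.contract {pr : N → Y} (B : HyperkahlerBundle F M E pr) (y : Y) (p : Fib pr y)
    (a : TangentSpace (𝓡 3) y →ₗ[ℝ] VerticalSpace (E := E) pr p.1) :
    VerticalSpace (E := E) pr p.1 :=
  ∑ i : Fin 3, B.cliff y (EuclideanSpace.proj i : EuclideanSpace ℝ (Fin 3) →L[ℝ] ℝ) p
    (a (EuclideanSpace.single i 1 : EuclideanSpace ℝ (Fin 3)))

/-- The Fueter operator `𝔉 s = s^*γ ∘ ∇s` on sections of a hyperkähler bundle with connection. -/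
def fueter {pr : N → Y} (B : HyperkahlerBundle F M E pr) (A : EhresmannConnection E pr) (s : Y → N)
    (hs : ∀ y, pr (s y) = y) (y : Y) : VerticalSpace (E := E) pr (s y) :=
  B.contract y ⟨s y, hs y⟩ (A.covDeriv s y)

/-- A smooth section of `pr : N → Y`. -/
structure FibSection (E : Type*) [NormedAddCommGroup E]
    [NormedSpace ℝ E] {N : Type*} [TopologicalSpace N] [ChartedSpace E N] [IsManifold 𝓘(ℝ, E) ∞ N] (pr : N → Y) where
  toFun : Y → N
  isSection : ∀ y, pr (toFun y) = y
  smooth : ContMDiff (𝓡 3) 𝓘(ℝ, E) ∞ toFun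

/-! ### Sections of the pulled back vertical bundle, and linearization -/

/-- A section of the vector bundle `φ^*V N → Y`, not necessarily smooth. -/
abbrev FibSection.Along {pr : N → Y} (φ : FibSection E pr) : Type _ :=
  Π y : Y, VerticalSpace (E := E) pr (φ.toFun y)

/-- Smoothness of a section of `φ^*V N`. -/
def FibSection.SmoothAlong {pr : N → Y} (φ : FibSection E pr) (ψ : φ.Along) : Prop :=
  ContMDiff (𝓡 3) 𝓘(ℝ, E).tangent ∞
    (fun y ↦ (⟨φ.toFun y, (ψ y : TangentSpace 𝓘(ℝ, E) (φ.toFun y))⟩ : TangentBundle 𝓘(ℝ, E) N))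

/-- A curve `(φ_t)` of sections with `φ_0 = φ`, depending smoothly on `(t, y)` for `|t| < ε`. -/
structure Variation {pr : N → Y} (φ : FibSection E pr) where
  curve : ℝ → Y → N
  isSection : ∀ t y, pr (curve t y) = y
  curve_zero : curve 0 = φ.toFun
  ε : ℝ
  ε_pos : 0 < ε
  smooth : ContMDiffOn (𝓘(ℝ, ℝ).prod (𝓡 3)) 𝓘(ℝ, E) ∞ (fun z : ℝ × Y ↦ curve z.1 z.2)
    (Set.Ioo (-ε) ε ×ˢ Set.univ)

/-- Near `y`, the section `ψ` of `φ^*V N` is the velocity `d/dt φ_t` at `t = 0`. -/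
def Variation.HasVelocityNear {pr : N → Y} {φ : FibSection E pr} (Φ : Variation φ) (ψ : φ.Along)
    (y : Y) : Prop :=
  ∀ᶠ x in 𝓝 y,
    (mfderiv 𝓘(ℝ, ℝ) 𝓘(ℝ, E) (fun t ↦ Φ.curve t x) 0 (1 : ℝ) : E) = toModel (ψ x)

/-- Let `𝒪` assign to each section `s` a vertical vector at `s y`, depending only on the germ of `s`
at `y`. This predicate says that the linearization of `𝒪` at `φ` in the direction `ψ` is defined,
with value `w`: there are curves of sections `φ_t` through `φ` with velocity `ψ` near `y`, and for
each of them, `d/dt|_{t = 0} P_{φ_t} 𝒪(φ_t) = w`, where `P_{φ_t}` is the parallel transport along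
`t ↦ φ_t(y)` for the Levi-Civita connection of the fibre over `y`. -/
def HasLinearizationAt {pr : N → Y} (g : VerticalMetric E pr) (φ : FibSection E pr)
    (𝒪 : Π s : Y → N, (∀ x, pr (s x) = x) → Π y : Y, VerticalSpace (E := E) pr (s y))
    (ψ : φ.Along) (y : Y) (w : VerticalSpace (E := E) pr (φ.toFun y)) : Prop :=
  (∃ Φ : Variation φ, Φ.HasVelocityNear ψ y) ∧
  ∀ Φ : Variation φ, Φ.HasVelocityNear ψ y →
    HasDerivAt (fun t ↦ toModel (parallelTransport g (fun s ↦ Φ.curve s y) t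
      (𝒪 (Φ.curve t) (Φ.isSection t) y))) (toModel w) 0

/-- `L_φ ∇ = D`: on smooth sections of `φ^*V N`, the operator `D` is the linearization at `φ` of the
connection `A`. -/
def IsLinearizationOfConnection {pr : N → Y} (g : VerticalMetric E pr) (A : EhresmannConnection E pr)
    (φ : FibSection E pr)
    (D : φ.Along → Π y : Y, TangentSpace (𝓡 3) y →ₗ[ℝ] VerticalSpace (E := E) pr (φ.toFun y)) :
    Prop :=
  ∀ ψ : φ.Along, φ.SmoothAlong ψ → ∀ v : Π y : Y, TangentSpace (𝓡 3) y, ∀ y : Y,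
    HasLinearizationAt g φ (fun s _ x ↦ A.covDeriv s x (v x)) ψ y (D ψ y (v y))

/-- `L_φ 𝔉 = L`: on smooth sections of `φ^*V N`, the operator `L` is the linearization at `φ` of the
Fueter operator. -/
def IsLinearizationOfFueter {pr : N → Y} (B : HyperkahlerBundle F M E pr)
    (A : EhresmannConnection E pr) (φ : FibSection E pr) (L : φ.Along → φ.Along) : Prop :=
  ∀ ψ : φ.Along, φ.SmoothAlong ψ → ∀ y : Y,
    HasLinearizationAt B.metric φ (fueter B A) ψ y (L ψ y)

/-- `D` is a (smooth) linear connection on the vector bundle `φ^*V N → Y`. -/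
structure IsLinearConnection {pr : N → Y} (φ : FibSection E pr)
    (D : φ.Along → Π y : Y, TangentSpace (𝓡 3) y →ₗ[ℝ] VerticalSpace (E := E) pr (φ.toFun y)) :
    Prop where
  add : ∀ ψ ψ' : φ.Along, φ.SmoothAlong ψ → φ.SmoothAlong ψ' → D (ψ + ψ') = D ψ + D ψ'
  leibniz : ∀ (f : Y → ℝ) (ψ : φ.Along), ContMDiff (𝓡 3) 𝓘(ℝ, ℝ) ∞ f → φ.SmoothAlong ψ → ∀ y v,
    D (fun x ↦ f x • ψ x) y v = f y • D ψ y v + mvfderiv (𝓡 3) f y v • ψ y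
  smooth : ∀ (ψ : φ.Along) (v : Π y : Y, TangentSpace (𝓡 3) y), φ.SmoothAlong ψ →
    ContMDiff (𝓡 3) (𝓡 3).tangent ∞ (fun y ↦ (⟨y, v y⟩ : TangentBundle (𝓡 3) Y)) →
    φ.SmoothAlong (fun y ↦ D ψ y (v y))

/-- The Dirac operator `φ^*γ ∘ D` on `φ^*V N` built from a connection `D` on that bundle. -/
def dirac {pr : N → Y} (B : HyperkahlerBundle F M E pr) (φ : FibSection E pr)
    (D : φ.Along → Π y : Y, TangentSpace (𝓡 3) y →ₗ[ℝ] VerticalSpace (E := E) pr (φ.toFun y)) :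
    φ.Along → φ.Along :=
  fun ψ y ↦ B.contract y ⟨φ.toFun y, φ.isSection y⟩ (D ψ y)

/-- `φ^*V N`, with the Clifford action `φ^*γ` of the covectors of `Y`, is a Clifford module:
`γ(α)² = -|α|²`. -/
def IsCliffordModule {pr : N → Y} (B : HyperkahlerBundle F M E pr) (φ : FibSection E pr) : Prop :=
  ∀ (y : Y) (α : TangentSpace (𝓡 3) y →L[ℝ] ℝ) (w : VerticalSpace (E := E) pr (φ.toFun y)),
    B.cliff y α ⟨φ.toFun y, φ.isSection y⟩ (B.cliff y α ⟨φ.toFun y, φ.isSection y⟩ w)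
      = -(‖α‖ ^ 2) • w

/-- `L` is an elliptic linear differential operator of first order on `φ^*V N`. Order at most one
means that the double commutators of `L` with multiplications by smooth functions vanish; the
principal symbol `σ` at a covector `α` is given by `σ (ψ y) = [L, f] ψ (y)` when `df_y = α`. -/
structure IsEllipticFirstOrder {pr : N → Y} (φ : FibSection E pr) (L : φ.Along → φ.Along) : Prop where
  smooth : ∀ ψ, φ.SmoothAlong ψ → φ.SmoothAlong (L ψ)
  add : ∀ ψ ψ', φ.SmoothAlong ψ → φ.SmoothAlong ψ' → L (ψ + ψ') = L ψ + L ψ'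
  smul : ∀ (a : ℝ) (ψ), φ.SmoothAlong ψ → L (a • ψ) = a • L ψ
  order : ∀ (f h : Y → ℝ) (ψ : φ.Along), ContMDiff (𝓡 3) 𝓘(ℝ, ℝ) ∞ f →
    ContMDiff (𝓡 3) 𝓘(ℝ, ℝ) ∞ h → φ.SmoothAlong ψ → ∀ y,
    L (fun x ↦ f x • h x • ψ x) y - f y • L (fun x ↦ h x • ψ x) y
      - h y • L (fun x ↦ f x • ψ x) y + f y • h y • L ψ y = 0
  elliptic : ∀ (y : Y) (α : TangentSpace (𝓡 3) y →L[ℝ] ℝ),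
    ∃ σ : Module.End ℝ (VerticalSpace (E := E) pr (φ.toFun y)),
      (∀ (f : Y → ℝ) (ψ : φ.Along), ContMDiff (𝓡 3) 𝓘(ℝ, ℝ) ∞ f → mvfderiv (𝓡 3) f y = α →
        φ.SmoothAlong ψ → L (fun x ↦ f x • ψ x) y - f y • L ψ y = σ (ψ y)) ∧
      (α ≠ 0 → Function.Bijective σ)

end Bundles

end

/-! The statement is local, so everything is computed in an adapted chart, where the total space is
an open part of `ℝ³ × F` and `pr` is the first projection. There a section is a map `S`, a section
`ψ` of the pulled back vertical bundle is an `F`-valued function, the Ehresmann connection is an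
operator-valued function `P` on `ℝ³ × F` (`projRep`), the fibre metrics are a family of inner
products with Christoffel symbols `Γ`, and the Clifford action of a covector with constant
components is an operator-valued function `J` (`cliffRep`).

Parallel transport back along a vertical curve with initial velocity `ψ` adds the term `Γ(ψ, ·)` to
the derivative at `t = 0` (`hasDerivAt_parallelTransport`). The derivative of `P(φ_t) ∂φ_t` is `(D_ψ
P) ∂S + ∂ψ`, because second derivatives commute and `P` is the identity on vertical vectors. Hence
the linearization of `∇` is `∂ψ + (D_ψ P) ∂S + Γ(ψ, P ∂S)` (`linRep`). This involves only `ψ` and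
its first derivative, not the curve of sections, and it visibly is a connection. Curves with a
prescribed velocity near a point exist by moving `φ` in the chart with a cutoff
(`exists_variation`), so the linearization is unique; uniqueness also shows that the formulas in
different charts agree, with no transformation rule to check.

For the Fueter operator the product rule produces in addition `D_ψ J` and the commutator of `Γ(ψ,
·)` with `J`, that is, the covariant derivative of the Clifford action along the fibre. It vanishes:
an integrable orthogonal complex structure with closed Kähler form is parallel
(`christoffel_comp_kahler`), and every covector is a combination of three which act by such
structures (`cliffRep_parallel`). What remains is `γ` applied to the linearization of `∇`.

The Clifford relation is quaternion algebra in an orthonormal coframe. By the Leibniz rule the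
commutator of the Dirac operator with a function `f` is `γ(df)`, so the symbol is `γ`, and `γ(α)² =
-|α|²` makes it invertible for `α ≠ 0`. -/

noncomputable section

set_option maxSynthPendingDepth 3
set_option linter.unusedSectionVars false

/-! ### Tangent vectors, smooth fields and Lie brackets in coordinates -/

section CoordinateMaps

variable {E : Type*} [NormedAddCommGroup E] [NormedSpace ℝ E]
  {N : Type*} [TopologicalSpace N] [ChartedSpace E N]
  {V : Type*} [NormedAddCommGroup V] [NormedSpace ℝ V]

/-- A diffeomorphism from an open subset of `N` onto an open subset of a normed space. -/
structure IsSmoothCoord (κ : OpenPartialHomeomorph N V) : Prop where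
  smooth : ContMDiffOn 𝓘(ℝ, E) 𝓘(ℝ, V) ∞ κ κ.source
  smooth_symm : ContMDiffOn 𝓘(ℝ, V) 𝓘(ℝ, E) ∞ κ.symm κ.target

/-- The derivative of a coordinate map. -/
def coordDeriv (E : Type*) [NormedAddCommGroup E] [NormedSpace ℝ E] [ChartedSpace E N]
    (κ : OpenPartialHomeomorph N V) (p : N) : E →L[ℝ] V :=
  mfderiv 𝓘(ℝ, E) 𝓘(ℝ, V) κ p

/-- The derivative of the inverse of a coordinate map. -/
def coordDerivSymm (E : Type*) [NormedAddCommGroup E] [NormedSpace ℝ E] [ChartedSpace E N]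
    (κ : OpenPartialHomeomorph N V) (x : V) : V →L[ℝ] E :=
  mfderiv 𝓘(ℝ, V) 𝓘(ℝ, E) κ.symm x

namespace IsSmoothCoord

variable {κ : OpenPartialHomeomorph N V}

theorem contMDiffAt (h : IsSmoothCoord (E := E) κ) {p : N} (hp : p ∈ κ.source) :
    ContMDiffAt 𝓘(ℝ, E) 𝓘(ℝ, V) ∞ κ p :=
  (h.smooth p hp).contMDiffAt (κ.open_source.mem_nhds hp)

theorem contMDiffAt_symm (h : IsSmoothCoord (E := E) κ) {x : V} (hx : x ∈ κ.target) :
    ContMDiffAt 𝓘(ℝ, V) 𝓘(ℝ, E) ∞ κ.symm x :=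
  (h.smooth_symm x hx).contMDiffAt (κ.open_target.mem_nhds hx)

theorem mdifferentiableAt (h : IsSmoothCoord (E := E) κ) {p : N} (hp : p ∈ κ.source) :
    MDifferentiableAt 𝓘(ℝ, E) 𝓘(ℝ, V) κ p :=
  (h.contMDiffAt hp).mdifferentiableAt (by simp)

theorem mdifferentiableAt_symm (h : IsSmoothCoord (E := E) κ) {x : V} (hx : x ∈ κ.target) :
    MDifferentiableAt 𝓘(ℝ, V) 𝓘(ℝ, E) κ.symm x :=
  (h.contMDiffAt_symm hx).mdifferentiableAt (by simp)

theorem symm_deriv_deriv (h : IsSmoothCoord (E := E) κ) {p : N} (hp : p ∈ κ.source) (e : E) :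
    coordDerivSymm E κ (κ p) (coordDeriv E κ p e) = e := by
  have h1 := mfderiv_comp p (h.mdifferentiableAt_symm (κ.map_source hp)) (h.mdifferentiableAt hp)
  have h2 : (κ.symm ∘ κ) =ᶠ[𝓝 p] id := by
    filter_upwards [κ.open_source.mem_nhds hp] with q hq using κ.left_inv hq
  rw [h2.mfderiv_eq, mfderiv_id] at h1
  exact (congrArg (fun T : E →L[ℝ] E => T e) h1).symm

theorem deriv_symm_deriv (h : IsSmoothCoord (E := E) κ) {p : N} (hp : p ∈ κ.source) (v : V) :
    coordDeriv E κ p (coordDerivSymm E κ (κ p) v) = v := by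
  have hx := κ.map_source hp
  have hs : κ.symm (κ p) = p := κ.left_inv hp
  have h1 := mfderiv_comp (κ p) (g := κ) (f := κ.symm) (by rw [hs]; exact h.mdifferentiableAt hp)
    (h.mdifferentiableAt_symm hx)
  have h2 : (κ ∘ κ.symm) =ᶠ[𝓝 (κ p)] id := by
    filter_upwards [κ.open_target.mem_nhds hx] with q hq using κ.right_inv hq
  rw [h2.mfderiv_eq, mfderiv_id] at h1
  have h3 : coordDeriv E κ (κ.symm (κ p)) (coordDerivSymm E κ (κ p) v) = v :=
    (congrArg (fun T : V →L[ℝ] V => T v) h1).symm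
  rwa [hs] at h3

variable {E' : Type*} [NormedAddCommGroup E'] [NormedSpace ℝ E'] {H' : Type*} [TopologicalSpace H']
  {I' : ModelWithCorners ℝ E' H'} {S : Type*} [TopologicalSpace S] [ChartedSpace H' S]

theorem contMDiffAt_tangentBundle_mk_vector {f : S → V} {w : S → V} {s : S} :
    ContMDiffAt I' 𝓘(ℝ, V).tangent ∞ (fun s ↦ (⟨f s, w s⟩ : TangentBundle 𝓘(ℝ, V) V)) s ↔
      ContMDiffAt I' 𝓘(ℝ, V) ∞ f s ∧ ContMDiffAt I' 𝓘(ℝ, V) ∞ w s := by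
  rw [Bundle.contMDiffAt_totalSpace]
  simp

theorem mvfderiv_eq (h : IsSmoothCoord (E := E) κ) {p : N} (hp : p ∈ κ.source) {f : N → ℝ}
    (hf : DifferentiableAt ℝ (f ∘ κ.symm) (κ p)) (e : E) :
    mvfderiv 𝓘(ℝ, E) f p e = fderiv ℝ (f ∘ κ.symm) (κ p) (coordDeriv E κ p e) := by
  have h2 : f =ᶠ[𝓝 p] (f ∘ κ.symm) ∘ κ := by
    filter_upwards [κ.open_source.mem_nhds hp] with q hq
    simp [κ.left_inv hq]
  have h1 := mfderiv_comp p (g := f ∘ κ.symm) (f := κ) (I'' := 𝓘(ℝ, ℝ))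
    hf.mdifferentiableAt (h.mdifferentiableAt hp)
  rw [← h2.mfderiv_eq, mfderiv_eq_fderiv] at h1
  exact congrArg (fun T : E →L[ℝ] ℝ => T e) h1

theorem hasDerivAt_comp_curve (h : IsSmoothCoord (E := E) κ) {c : ℝ → N} {s : ℝ}
    (hs : c s ∈ κ.source) (hc : MDifferentiableAt 𝓘(ℝ, ℝ) 𝓘(ℝ, E) c s) :
    HasDerivAt (κ ∘ c) (coordDeriv E κ (c s) (mfderiv 𝓘(ℝ, ℝ) 𝓘(ℝ, E) c s (1 : ℝ) : E)) s := by
  have h1 := mfderiv_comp s (h.mdifferentiableAt hs) hc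
  have h2 : DifferentiableAt ℝ (κ ∘ c) s :=
    ((h.mdifferentiableAt hs).comp s hc).differentiableAt
  rw [mfderiv_eq_fderiv] at h1
  have h3 := h2.hasFDerivAt.hasDerivAt
  have h4 := congrArg (fun T : ℝ →L[ℝ] V => T 1) h1
  exact h3.congr_deriv h4

variable [IsManifold 𝓘(ℝ, E) ∞ N]

/-- Smoothness of a field of tangent vectors along a map, in coordinates. -/
theorem contMDiffAt_tangent_iff (h : IsSmoothCoord (E := E) κ) {f : S → N} {w : S → E} {s : S}
    (hs : f s ∈ κ.source) :
    ContMDiffAt I' 𝓘(ℝ, E).tangent ∞ (fun s ↦ (⟨f s, w s⟩ : TangentBundle 𝓘(ℝ, E) N)) s ↔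
      ContMDiffAt I' 𝓘(ℝ, E) ∞ f s ∧
        ContMDiffAt I' 𝓘(ℝ, V) ∞ (fun s ↦ coordDeriv E κ (f s) (w s)) s := by
  have : IsManifold 𝓘(ℝ, E) 1 N := IsManifold.of_le (n := ∞) (by simp)
  -- Since `κ` is smooth only on its source, smoothness of its tangent map comes from the tangent
  -- map within this open set, which agrees with the full one there.
  have key1 : ∀ q : TangentBundle 𝓘(ℝ, E) N, q.1 ∈ κ.source →
      ContMDiffAt 𝓘(ℝ, E).tangent 𝓘(ℝ, V).tangent ∞ (tangentMap 𝓘(ℝ, E) 𝓘(ℝ, V) κ) q := by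
    intro q hq
    have h1 := h.smooth.contMDiffOn_tangentMapWithin (m := ∞) (by simp)
      κ.open_source.uniqueMDiffOn
    have hop : IsOpen (π E (TangentSpace 𝓘(ℝ, E) : N → Type _) ⁻¹' κ.source) :=
      κ.open_source.preimage (FiberBundle.continuous_proj E _)
    refine ((h1 q hq).contMDiffAt (hop.mem_nhds hq)).congr_of_eventuallyEq ?_
    filter_upwards [hop.mem_nhds hq] with q' hq'
    exact (tangentMapWithin_eq_tangentMap (κ.open_source.uniqueMDiffOn _ hq')
      (h.mdifferentiableAt hq')).symm
  have key2 : ∀ q : TangentBundle 𝓘(ℝ, V) V, q.1 ∈ κ.target →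
      ContMDiffAt 𝓘(ℝ, V).tangent 𝓘(ℝ, E).tangent ∞ (tangentMap 𝓘(ℝ, V) 𝓘(ℝ, E) κ.symm) q := by
    intro q hq
    have h1 := h.smooth_symm.contMDiffOn_tangentMapWithin (m := ∞) (by simp)
      κ.open_target.uniqueMDiffOn
    have hop : IsOpen (π V (TangentSpace 𝓘(ℝ, V) : V → Type _) ⁻¹' κ.target) :=
      κ.open_target.preimage (FiberBundle.continuous_proj V _)
    refine ((h1 q hq).contMDiffAt (hop.mem_nhds hq)).congr_of_eventuallyEq ?_
    filter_upwards [hop.mem_nhds hq] with q' hq'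
    exact (tangentMapWithin_eq_tangentMap (κ.open_target.uniqueMDiffOn _ hq')
      (h.mdifferentiableAt_symm hq')).symm
  constructor
  · intro hw
    have hf : ContMDiffAt I' 𝓘(ℝ, E) ∞ f s :=
      (Bundle.contMDiffAt_proj (TangentSpace 𝓘(ℝ, E))).comp s hw
    refine ⟨hf, ?_⟩
    have := (key1 ⟨f s, w s⟩ hs).comp s hw
    exact (contMDiffAt_tangentBundle_mk_vector (f := κ ∘ f)
      (w := fun s ↦ coordDeriv E κ (f s) (w s))).1 this |>.2
  · rintro ⟨hf, hw⟩
    have h1 := (contMDiffAt_tangentBundle_mk_vector (f := κ ∘ f)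
      (w := fun s ↦ coordDeriv E κ (f s) (w s))).2 ⟨(h.contMDiffAt hs).comp s hf, hw⟩
    refine ((key2 ⟨κ (f s), coordDeriv E κ (f s) (w s)⟩ (κ.map_source hs)).comp s
      h1).congr_of_eventuallyEq ?_
    filter_upwards [hf.continuousAt.preimage_mem_nhds (κ.open_source.mem_nhds hs)] with t ht
    have e1 : κ.symm (κ (f t)) = f t := κ.left_inv ht
    have e2 := h.symm_deriv_deriv ht (w t)
    simp only [Function.comp, tangentMap]
    change _ = (⟨κ.symm (κ (f t)), coordDerivSymm E κ (κ (f t)) (coordDeriv E κ (f t) (w t))⟩ :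
      TangentBundle 𝓘(ℝ, E) N)
    rw [e1, e2]

/-- Lie brackets are natural under pullback by `κ.symm`. As the inverse of the derivative of
`κ.symm` is the derivative of `κ`, the pullback of a field is its coordinate expression. -/
theorem deriv_mlieBracket (h : IsSmoothCoord (E := E) κ) [CompleteSpace E] [CompleteSpace V]
    {p : N} (hp : p ∈ κ.source) (X Z : Π q : N, TangentSpace 𝓘(ℝ, E) q)
    (hX : ContMDiffAt 𝓘(ℝ, E) 𝓘(ℝ, E).tangent ∞
      (fun q ↦ (⟨q, X q⟩ : TangentBundle 𝓘(ℝ, E) N)) p)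
    (hZ : ContMDiffAt 𝓘(ℝ, E) 𝓘(ℝ, E).tangent ∞
      (fun q ↦ (⟨q, Z q⟩ : TangentBundle 𝓘(ℝ, E) N)) p) :
    coordDeriv E κ p (VectorField.mlieBracket 𝓘(ℝ, E) X Z p) =
      VectorField.lieBracket ℝ (fun x ↦ coordDeriv E κ (κ.symm x) (X (κ.symm x)))
        (fun x ↦ coordDeriv E κ (κ.symm x) (Z (κ.symm x))) (κ p) := by
  have : IsManifold 𝓘(ℝ, E) (minSmoothness ℝ 3) N := IsManifold.of_le (n := ∞)
    (by simp only [minSmoothness_of_isRCLikeNormedField]; exact ENat.LEInfty.out)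
  have hs : κ.symm (κ p) = p := κ.left_inv hp
  have hx := κ.map_source hp
  have inv : ∀ x ∈ κ.target, ∀ e : E,
      (mfderiv 𝓘(ℝ, V) 𝓘(ℝ, E) κ.symm x).inverse e = coordDeriv E κ (κ.symm x) e := by
    intro x hx e
    have hq := κ.map_target hx
    have hr : κ (κ.symm x) = x := κ.right_inv hx
    let L : V ≃L[ℝ] E := ContinuousLinearEquiv.equivOfInverse (coordDerivSymm E κ x)
      (coordDeriv E κ (κ.symm x))
      (fun v ↦ by have := h.deriv_symm_deriv hq v; rwa [hr] at this)
      (fun v ↦ by have := h.symm_deriv_deriv hq v; rwa [hr] at this)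
    have hL : (L : V →L[ℝ] E) = mfderiv 𝓘(ℝ, V) 𝓘(ℝ, E) κ.symm x := by ext; rfl
    have := ContinuousLinearMap.inverse_equiv L
    rw [hL] at this
    exact congrArg (fun T : E →L[ℝ] V ↦ T e) this
  have h1 := VectorField.mpullback_mlieBracket (𝕜 := ℝ) (I := 𝓘(ℝ, V)) (I' := 𝓘(ℝ, E))
    (f := κ.symm) (V := X) (W := Z) (x₀ := κ p) (n := ∞)
    (by rw [hs]; exact hX.mdifferentiableAt (by simp))
    (by rw [hs]; exact hZ.mdifferentiableAt (by simp))
    (h.contMDiffAt_symm hx) (by simp only [minSmoothness_of_isRCLikeNormedField]; exact ENat.LEInfty.out)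
  have pe : ∀ W : Π q : N, TangentSpace 𝓘(ℝ, E) q,
      VectorField.mpullback 𝓘(ℝ, V) 𝓘(ℝ, E) κ.symm W =ᶠ[𝓝 (κ p)]
        (fun x ↦ coordDeriv E κ (κ.symm x) (W (κ.symm x)) : V → V) := by
    intro W
    filter_upwards [κ.open_target.mem_nhds hx] with x hx
    exact inv x hx _
  rw [(pe X).mlieBracket_vectorField_eq (pe Z)] at h1
  have lie : ∀ (A B : Π x : V, TangentSpace 𝓘(ℝ, V) x) (x : V),
      VectorField.mlieBracket 𝓘(ℝ, V) A B x = VectorField.lieBracket ℝ A B x := by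
    intro A B x
    rw [← VectorField.mlieBracketWithin_univ, VectorField.mlieBracketWithin_eq_lieBracketWithin]
    exact congrFun (VectorField.lieBracketWithin_univ (𝕜 := ℝ) (V := (A : V → V)) (W := B)) x
  refine Eq.trans ?_ (h1.trans (lie _ _ _))
  have h2 := inv _ hx (VectorField.mlieBracket 𝓘(ℝ, E) X Z (κ.symm (κ p)))
  refine Eq.trans ?_ h2.symm
  rw [hs]

end IsSmoothCoord
end CoordinateMaps
-- Linear differential equations with operator coefficients
section LinearODE

/-- Unordered intervals are used because parallel transport is needed for times of both signs. -/
theorem constant_of_hasDerivAt_zero_uIcc {V : Type*} [NormedAddCommGroup V] [NormedSpace ℝ V]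
    {u : ℝ → V} {a b : ℝ} (h : ∀ s ∈ Set.uIcc a b, HasDerivAt u 0 s) : u a = u b := by
  rcases eq_or_ne a b with rfl | hab
  · rfl
  refine (convex_uIcc a b).is_const_of_fderivWithin_eq_zero (𝕜 := ℝ)
    (fun s hs ↦ (h s hs).differentiableAt.differentiableWithinAt) (fun s hs ↦ ?_)
    Set.left_mem_uIcc Set.right_mem_uIcc
  have hu : UniqueDiffOn ℝ (Set.uIcc a b) := uniqueDiffOn_Icc (by simpa using hab.symm)
  rw [((h s hs).hasFDerivAt.hasFDerivWithinAt).fderivWithin (hu s hs)]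
  ext
  simp

/-- The fundamental solution of `X' = X A` together with its inverse. -/
theorem exists_fundamental_solution {R : Type*} [NormedRing R] [NormedAlgebra ℝ R] [CompleteSpace R]
    {A : ℝ → R} (hA : ContDiffAt ℝ 1 A 0) :
    ∃ δ > 0, ∃ X Y : ℝ → R, X 0 = 1 ∧ Y 0 = 1 ∧
      (∀ s ∈ Set.Ioo (-δ) δ, HasDerivAt X (X s * A s) s) ∧
      (∀ s ∈ Set.Ioo (-δ) δ, HasDerivAt Y (-(A s * Y s)) s) ∧
      ∀ s ∈ Set.Ioo (-δ) δ, X s * Y s = 1 := by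
  -- Time is adjoined as a third coordinate to make the system autonomous. The equation of the
  -- inverse is solved along with that of `X`, which gives a common interval of existence.
  let f : R × R × ℝ → R × R × ℝ := fun z ↦ (z.1 * A z.2.2, -(A z.2.2 * z.2.1), 1)
  have hA' : ContDiffAt ℝ 1 (fun z : R × R × ℝ ↦ A z.2.2) ((1 : R), (1 : R), (0 : ℝ)) :=
    ContDiffAt.comp (g := A) (f := fun z : R × R × ℝ ↦ z.2.2) _ hA
      (contDiff_snd.comp contDiff_snd).contDiffAt
  have hf : ContDiffAt ℝ 1 f ((1 : R), (1 : R), (0 : ℝ)) :=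
    (contDiffAt_fst.mul hA').prodMk
      (((hA'.mul (contDiff_fst.comp contDiff_snd).contDiffAt).neg).prodMk contDiffAt_const)
  obtain ⟨α, h0, δ, hδ, hα⟩ :=
    hf.exists_forall_mem_closedBall_exists_eq_forall_mem_Ioo_hasDerivAt₀ 0
  simp only [zero_sub, zero_add] at hα
  have h3 : ∀ s ∈ Set.Ioo (-δ) δ, HasDerivAt (fun s ↦ (α s).2.2) 1 s := fun s hs ↦
    (hα s hs).hasFDerivAt.snd.snd.hasDerivAt.congr_deriv (by simp [f])
  have sub : ∀ s ∈ Set.Ioo (-δ) δ, Set.uIcc 0 s ⊆ Set.Ioo (-δ) δ := fun s hs ↦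
    (Set.ordConnected_Ioo).uIcc_subset (by simpa using hδ) hs
  have h4 : ∀ s ∈ Set.Ioo (-δ) δ, (α s).2.2 = s := by
    intro s hs
    have := constant_of_hasDerivAt_zero_uIcc (u := fun s ↦ (α s).2.2 - s) (a := 0) (b := s)
      (fun r hr ↦ ((h3 r (sub s hs hr)).sub (hasDerivAt_id r)).congr_deriv (sub_self _))
    simp only [h0, sub_zero] at this
    linarith
  have hX : ∀ s ∈ Set.Ioo (-δ) δ, HasDerivAt (fun s ↦ (α s).1) ((α s).1 * A s) s := fun s hs ↦
    (hα s hs).hasFDerivAt.fst.hasDerivAt.congr_deriv (by simp [f, h4 s hs])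
  have hY : ∀ s ∈ Set.Ioo (-δ) δ, HasDerivAt (fun s ↦ (α s).2.1) (-(A s * (α s).2.1)) s :=
    fun s hs ↦ (hα s hs).hasFDerivAt.snd.fst.hasDerivAt.congr_deriv (by simp [f, h4 s hs])
  refine ⟨δ, hδ, fun s ↦ (α s).1, fun s ↦ (α s).2.1, by simp [h0], by simp [h0], hX, hY, ?_⟩
  intro s hs
  -- The two equations are chosen so that `(X Y)' = X A Y - X A Y = 0`.
  have := constant_of_hasDerivAt_zero_uIcc (u := fun s ↦ (α s).1 * (α s).2.1) (a := 0) (b := s)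
      (fun r hr ↦ ((hX r (sub s hs hr)).mul (hY r (sub s hs hr))).congr_deriv (by
        simp [mul_assoc]))
  simpa [h0] using this.symm

end LinearODE

/-! ### Smoothness of operator-valued maps -/

section FiniteDimensionalCalculus

variable {W : Type*} [NormedAddCommGroup W] [NormedSpace ℝ W]
  {F : Type*} [NormedAddCommGroup F] [NormedSpace ℝ F] [FiniteDimensional ℝ F]
  {F' : Type*} [NormedAddCommGroup F'] [NormedSpace ℝ F']

/-- In finite dimension an operator is the tuple of its values on a basis. This reduces smoothness
of the metric, the Christoffel symbols, the Clifford action and the vertical projection to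
smoothness of their values on constant vectors. -/
theorem contDiffAt_clm_of_apply {n : WithTop ℕ∞} {f : W → F →L[ℝ] F'} {x : W}
    (h : ∀ a, ContDiffAt ℝ n (fun y ↦ f y a) x) : ContDiffAt ℝ n f x := by
  let d := Module.finrank ℝ F
  have hd : d = Module.finrank ℝ (Fin d → ℝ) := (Module.finrank_fin_fun ℝ).symm
  let e₁ := ContinuousLinearEquiv.ofFinrankEq hd
  let e₂ := (e₁.arrowCongr (1 : F' ≃L[ℝ] F')).trans (ContinuousLinearEquiv.piRing (Fin d))
  rw [← Function.id_comp f, ← e₂.symm_comp_self]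
  exact e₂.symm.contDiff.contDiffAt.comp x (contDiffAt_pi.mpr fun i => h _)

end FiniteDimensionalCalculus

/-! ### Christoffel symbols of a family of metrics, and parallel complex structures -/

section FibreCoordinates

variable {H : Type*} [NormedAddCommGroup H] [NormedSpace ℝ H]
  {F : Type*} [NormedAddCommGroup F] [NormedSpace ℝ F]

/-- The derivative along the second factor. -/
def fibreDeriv {V : Type*} [NormedAddCommGroup V] [NormedSpace ℝ V] (f : H × F → V) (x : H × F) :
    F →L[ℝ] V :=
  fderiv ℝ f x ∘L ContinuousLinearMap.inr ℝ H F

theorem fibreDeriv_apply {V : Type*} [NormedAddCommGroup V] [NormedSpace ℝ V] (f : H × F → V)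
    (x : H × F) (a : F) : fibreDeriv f x a = fderiv ℝ f x (0, a) := rfl

theorem ContDiffAt.fibreDeriv {V : Type*} [NormedAddCommGroup V] [NormedSpace ℝ V] {f : H × F → V}
    {x : H × F} (hf : ContDiffAt ℝ ∞ f x) : ContDiffAt ℝ ∞ (_root_.fibreDeriv f) x :=
  (hf.fderiv_right (m := ∞) (by simp)).clm_comp contDiffAt_const

theorem hasDerivAt_comp_of_fibreDeriv {V : Type*} [NormedAddCommGroup V] [NormedSpace ℝ V]
    {f : H × F → V} {x : ℝ → H × F} {s : ℝ} {v : F} (hf : DifferentiableAt ℝ f (x s))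
    (hx : HasDerivAt x (0, v) s) : HasDerivAt (fun r ↦ f (x r)) (fibreDeriv f (x s) v) s :=
  hf.hasFDerivAt.comp_hasDerivAt s hx

/-- The Christoffel symbols of the first kind of a family of metrics. -/
def christoffelLower (G : H × F → F →L[ℝ] F →L[ℝ] ℝ) (x : H × F) : F →L[ℝ] F →L[ℝ] F →L[ℝ] ℝ :=
  let D : F →L[ℝ] F →L[ℝ] F →L[ℝ] ℝ := fibreDeriv G x
  let L : (F →L[ℝ] F →L[ℝ] ℝ) →L[ℝ] (F →L[ℝ] F →L[ℝ] ℝ) :=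
    (ContinuousLinearMap.flipₗᵢ ℝ F F ℝ).toContinuousLinearEquiv.toContinuousLinearMap
  let D' : F →L[ℝ] F →L[ℝ] F →L[ℝ] ℝ := L.comp D.flip
  (1 / 2 : ℝ) • (D + D.flip - D')

theorem christoffelLower_apply (G : H × F → F →L[ℝ] F →L[ℝ] ℝ) (x : H × F) (a b c : F) :
    christoffelLower G x a b c =
      (1 / 2) * (fibreDeriv G x a b c + fibreDeriv G x b a c - fibreDeriv G x c a b) := by
  simp [christoffelLower]

/-- The Christoffel symbols of a family of metrics. -/
def christoffel (G : H × F → F →L[ℝ] F →L[ℝ] ℝ) (x : H × F) : F →L[ℝ] F →L[ℝ] F :=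
  (ContinuousLinearMap.compL ℝ F (F →L[ℝ] ℝ) F (G x).inverse) ∘L christoffelLower G x

/-- `G` is near `x` a smooth family of inner products. -/
structure IsMetricAt (G : H × F → F →L[ℝ] F →L[ℝ] ℝ) (x : H × F) : Prop where
  smooth : ContDiffAt ℝ ∞ G x
  symm : ∀ᶠ y in 𝓝 x, ∀ a b, G y a b = G y b a
  pos : ∀ a, a ≠ 0 → 0 < G x a a

namespace IsMetricAt

variable {G : H × F → F →L[ℝ] F →L[ℝ] ℝ} {x : H × F}

theorem fibreDeriv_symm (h : IsMetricAt G x) (a b c : F) :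
    fibreDeriv G x a b c = fibreDeriv G x a c b := by
  have h1 : (fun y ↦ G y b c) =ᶠ[𝓝 x] (fun y ↦ G y c b) := by
    filter_upwards [h.symm] with y hy using hy b c
  have hd : DifferentiableAt ℝ G x := h.smooth.differentiableAt (by simp)
  have h2 : ∀ b c, fderiv ℝ (fun y ↦ G y b c) x (0, a) = fibreDeriv G x a b c := by
    intro b c
    have := ((hd.hasFDerivAt.clm_apply (hasFDerivAt_const b x)).clm_apply
      (hasFDerivAt_const c x)).fderiv
    rw [this]
    simp [fibreDeriv_apply]
  rw [← h2 b c, ← h2 c b, h1.fderiv_eq]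

/-- The Koszul formula in coordinates. -/
theorem koszul (h : IsMetricAt G x) {γ ζ υ : H × F → F} (hγ : DifferentiableAt ℝ γ x)
    (hζ : DifferentiableAt ℝ ζ x) (hυ : DifferentiableAt ℝ υ x) :
    (1 / 2) * (fibreDeriv (fun y ↦ G y (ζ y) (υ y)) x (γ x)
      + fibreDeriv (fun y ↦ G y (γ y) (υ y)) x (ζ x)
      - fibreDeriv (fun y ↦ G y (γ y) (ζ y)) x (υ x)
      + G x (fibreDeriv ζ x (γ x) - fibreDeriv γ x (ζ x)) (υ x)
      - G x (fibreDeriv υ x (γ x) - fibreDeriv γ x (υ x)) (ζ x)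
      - G x (fibreDeriv υ x (ζ x) - fibreDeriv ζ x (υ x)) (γ x)) =
    christoffelLower G x (γ x) (ζ x) (υ x) + G x (fibreDeriv ζ x (γ x)) (υ x) := by
  have hd : DifferentiableAt ℝ G x := h.smooth.differentiableAt (by simp)
  have key : ∀ {u w : H × F → F}, DifferentiableAt ℝ u x → DifferentiableAt ℝ w x → ∀ a : F,
      fibreDeriv (fun y ↦ G y (u y) (w y)) x a =
        fibreDeriv G x a (u x) (w x) + G x (fibreDeriv u x a) (w x)
          + G x (u x) (fibreDeriv w x a) := by
    intro u w hu hw a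
    have := ((hd.hasFDerivAt.clm_apply hu.hasFDerivAt).clm_apply hw.hasFDerivAt).fderiv
    rw [fibreDeriv_apply, this]
    simp [fibreDeriv_apply]
    ring
  have sy := h.symm.self_of_nhds
  rw [key hζ hυ, key hγ hυ, key hγ hζ, christoffelLower_apply]
  simp only [map_sub, sub_apply]
  rw [sy (fibreDeriv υ x (γ x)), sy (fibreDeriv γ x (υ x)), sy (fibreDeriv υ x (ζ x)),
    sy (fibreDeriv ζ x (υ x)) (γ x)]
  ring

theorem eq_of_apply_eq (h : IsMetricAt G x) {u v : F} (huv : ∀ c, G x u c = G x v c) : u = v := by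
  by_contra hne
  have := h.pos (u - v) (sub_ne_zero.2 hne)
  simp [huv] at this

variable [FiniteDimensional ℝ F]

theorem isInvertible (h : IsMetricAt G x) : (G x).IsInvertible := by
  have inj : Function.Injective (G x) := by
    rw [injective_iff_map_eq_zero]
    intro a ha
    by_contra h0
    have := h.pos a h0
    simp [ha] at this
  let e : F ≃ₗ[ℝ] (F →L[ℝ] ℝ) := LinearEquiv.ofInjectiveOfFinrankEq (G x : F →ₗ[ℝ] F →L[ℝ] ℝ) inj
    (by rw [← (LinearMap.toContinuousLinearMap (𝕜 := ℝ) (E := F) (F' := ℝ)).finrank_eq]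
        exact (Subspace.dual_finrank_eq (K := ℝ) (V := F)).symm)
  exact ⟨e.toContinuousLinearEquiv, by ext; rfl⟩

theorem smooth_christoffelLower (h : IsMetricAt G x) : ContDiffAt ℝ ∞ (christoffelLower G) x := by
  have := h.smooth.fibreDeriv
  refine contDiffAt_clm_of_apply fun a ↦ contDiffAt_clm_of_apply fun b ↦
    contDiffAt_clm_of_apply fun c ↦ ?_
  simp only [christoffelLower_apply]
  fun_prop

theorem smooth_christoffel (h : IsMetricAt G x) : ContDiffAt ℝ ∞ (christoffel G) x := by
  have h1 := h.smooth_christoffelLower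
  have h2 : ContDiffAt ℝ ∞ (fun y ↦ (G y).inverse) x :=
    (h.isInvertible.contDiffAt_map_inverse).comp x h.smooth
  refine contDiffAt_clm_of_apply fun a ↦ contDiffAt_clm_of_apply fun b ↦ ?_
  simp only [christoffel, ContinuousLinearMap.comp_apply, ContinuousLinearMap.compL_apply]
  exact h2.clm_apply ((h1.clm_apply contDiffAt_const).clm_apply contDiffAt_const)

theorem apply_christoffel (h : IsMetricAt G x) (a b c : F) :
    G x (christoffel G x a b) c = christoffelLower G x a b c := by
  simp [christoffel, h.isInvertible.self_apply_inverse]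

/-- In the sum of the two symbols of the first kind the terms antisymmetric in the last two
arguments cancel. This is what turns the derivative of the metric into a Christoffel term when
parallel transport is differentiated. -/
theorem metric_compat (h : IsMetricAt G x) (a b c : F) :
    fibreDeriv G x a b c = G x (christoffel G x a b) c + G x (christoffel G x a c) b := by
  rw [h.apply_christoffel, h.apply_christoffel, christoffelLower_apply, christoffelLower_apply,
    h.fibreDeriv_symm a c b]
  ring

/-- An integrable orthogonal complex structure with closed Kähler form is parallel, in
coordinates. -/
theorem christoffel_comp_kahler (h : IsMetricAt G x) {J : H × F → F →L[ℝ] F}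
    (sq : ∀ a, J x (J x a) = -a)
    (deriv_sq : ∀ c a, fibreDeriv J x c (J x a) + J x (fibreDeriv J x c a) = 0)
    (orth : ∀ a b, G x (J x a) (J x b) = G x a b)
    (deriv_orth : ∀ c a b, fibreDeriv G x c (J x a) (J x b) + G x (fibreDeriv J x c a) (J x b) +
      G x (J x a) (fibreDeriv J x c b) = fibreDeriv G x c a b)
    (nijenhuis : ∀ a b, fibreDeriv J x (J x a) b - fibreDeriv J x (J x b) a
      + J x (fibreDeriv J x b a) - J x (fibreDeriv J x a b) = 0)
    (closed : ∀ a b c, fibreDeriv G x a (J x b) c + G x (fibreDeriv J x a b) c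
      - (fibreDeriv G x b (J x a) c + G x (fibreDeriv J x b a) c)
      + (fibreDeriv G x c (J x a) b + G x (fibreDeriv J x c a) b) = 0) (a b : F) :
    fibreDeriv J x a b + christoffel G x a (J x b) = J x (christoffel G x a b) := by
  refine h.eq_of_apply_eq fun c ↦ ?_
  have sy := h.symm.self_of_nhds
  have skew : ∀ u v, G x (J x u) v = -G x u (J x v) := by
    intro u v
    have := orth u (J x v)
    rw [sq] at this
    simp only [map_neg] at this
    linarith
  have dsq : ∀ c a, fibreDeriv J x c (J x a) = -J x (fibreDeriv J x c a) :=
    fun c a ↦ eq_neg_of_add_eq_zero_left (deriv_sq c a)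
  rw [skew, map_add, add_apply, h.apply_christoffel, h.apply_christoffel, christoffelLower_apply,
    christoffelLower_apply]
  -- These are the ingredients of the classical identity expressing `⟨(∇_a J) b, c⟩` by `dω(a, b,
  -- c)`, `dω(a, J b, J c)` and `⟨N(b, c), J a⟩`. The differentiated orthogonality relations `e4` to
  -- `e7` account for moving `J` across the derivatives of the metric; the claim is then a linear
  -- combination.
  have e1 := closed a b c
  have e2 := closed a (J x b) (J x c)
  have e3 := congrArg (G x (J x a)) (nijenhuis c b)
  have e4 := deriv_orth (J x b) a c
  have e5 := deriv_orth (J x c) a b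
  have e6 := deriv_orth b a (J x c)
  have e7 := deriv_orth c a (J x b)
  simp only [sq, dsq, map_neg, map_add, map_sub, map_zero, skew, neg_apply, neg_neg] at e1 e2 e3 e4 e5 e6 e7 ⊢
  have s1 := h.fibreDeriv_symm a b (J x c)
  linarith

end IsMetricAt

end FibreCoordinates

/-! ### Smooth functions in coordinates -/

section SmoothFunctions

variable {E : Type*} [NormedAddCommGroup E] [NormedSpace ℝ E]
  {N : Type*} [TopologicalSpace N] [ChartedSpace E N]
  {V : Type*} [NormedAddCommGroup V] [NormedSpace ℝ V]
  {V' : Type*} [NormedAddCommGroup V'] [NormedSpace ℝ V']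

theorem IsSmoothCoord.contMDiffAt_iff_contDiffAt {κ : OpenPartialHomeomorph N V}
    (h : IsSmoothCoord (E := E) κ) {p : N} (hp : p ∈ κ.source) {f : N → V'} :
    ContMDiffAt 𝓘(ℝ, E) 𝓘(ℝ, V') ∞ f p ↔ ContDiffAt ℝ ∞ (fun x ↦ f (κ.symm x)) (κ p) := by
  rw [← _root_.contMDiffAt_iff_contDiffAt]
  constructor
  · intro hf
    exact ContMDiffAt.comp (g := f) (f := κ.symm) (κ p) (by rwa [κ.left_inv hp])
      (h.contMDiffAt_symm (κ.map_source hp))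
  · intro hf
    refine (hf.comp p (h.contMDiffAt hp)).congr_of_eventuallyEq ?_
    filter_upwards [κ.open_source.mem_nhds hp] with q hq
    simp [κ.left_inv hq]

end SmoothFunctions

/-! ### Adapted charts and vertical vectors -/

section AdaptedCharts

/-- Coordinates on the total space of a fibre bundle over a 3-manifold in which the projection is
the projection of a product onto its first factor. -/
structure AdaptedChart (F : Type*) [NormedAddCommGroup F] [NormedSpace ℝ F]
    (E : Type*) [NormedAddCommGroup E] [NormedSpace ℝ E]
    {Y : Type*} [TopologicalSpace Y] [ChartedSpace (EuclideanSpace ℝ (Fin 3)) Y]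
    {N : Type*} [TopologicalSpace N] [ChartedSpace E N] (pr : N → Y) where
  base : OpenPartialHomeomorph Y (EuclideanSpace ℝ (Fin 3))
  total : OpenPartialHomeomorph N (EuclideanSpace ℝ (Fin 3) × F)
  base_smooth : IsSmoothCoord (E := EuclideanSpace ℝ (Fin 3)) base
  total_smooth : IsSmoothCoord (E := E) total
  pr_mem : ∀ p ∈ total.source, pr p ∈ base.source
  fst_total : ∀ p ∈ total.source, (total p).1 = base (pr p)

variable {E : Type*} [NormedAddCommGroup E] [NormedSpace ℝ E]
  {Y : Type*} [TopologicalSpace Y] [ChartedSpace (EuclideanSpace ℝ (Fin 3)) Y]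
  {N : Type*} [TopologicalSpace N] [ChartedSpace E N] [IsManifold 𝓘(ℝ, E) ∞ N]
  {F : Type*} [NormedAddCommGroup F] [NormedSpace ℝ F]
  {pr : N → Y}

/-- A local trivialization is followed by the product of a chart of `Y` and a chart of `M`. The
first component of the trivialization is `pr`, so the projection becomes the first projection. -/
theorem IsSmoothFiberBundle.exists_adaptedChart [IsManifold (𝓡 3) ∞ Y] {M : Type*}
    [TopologicalSpace M] [ChartedSpace F M] [IsManifold 𝓘(ℝ, F) ∞ M]
    (h : IsSmoothFiberBundle F M pr (E := E)) (p : N) :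
    ∃ κ : AdaptedChart F E pr, p ∈ κ.total.source := by
  obtain ⟨U, Φ, hU, hpU, hs, ht, hΦ, hΦ', hfst⟩ := h.locallyTrivial (pr p)
  have hp : p ∈ Φ.source := by rw [hs]; exact hpU
  let η := chartAt (EuclideanSpace ℝ (Fin 3)) (pr p)
  let χ := chartAt F (Φ p).2
  let total : OpenPartialHomeomorph N (EuclideanSpace ℝ (Fin 3) × F) := Φ.trans (η.prod χ)
  have hsrc : ∀ q ∈ total.source, q ∈ Φ.source ∧ (Φ q).1 ∈ η.source ∧ (Φ q).2 ∈ χ.source := by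
    intro q hq
    simpa [total, OpenPartialHomeomorph.trans_source] using hq
  have hη : IsSmoothCoord (E := EuclideanSpace ℝ (Fin 3)) η :=
    ⟨contMDiffOn_chart, contMDiffOn_chart_symm⟩
  refine ⟨⟨η, total, hη, ⟨?_, ?_⟩, ?_, ?_⟩, ?_⟩
  · intro q hq
    obtain ⟨h1, h2, h3⟩ := hsrc q hq
    have hq' := (hΦ q h1).contMDiffAt (Φ.open_source.mem_nhds h1)
    have c1 : ContMDiffAt 𝓘(ℝ, E) 𝓘(ℝ, EuclideanSpace ℝ (Fin 3)) ∞ (fun q ↦ η (Φ q).1) q :=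
      ContMDiffAt.comp (g := η) (f := fun q ↦ (Φ q).1) q (hη.contMDiffAt h2) hq'.fst
    have c2 : ContMDiffAt 𝓘(ℝ, E) 𝓘(ℝ, F) ∞ (fun q ↦ χ (Φ q).2) q :=
      ContMDiffAt.comp (g := χ) (f := fun q ↦ (Φ q).2) q
        ((contMDiffOn_chart (I := 𝓘(ℝ, F)) _ h3).contMDiffAt (χ.open_source.mem_nhds h3)) hq'.snd
    exact (c1.prodMk_space c2).contMDiffWithinAt
  · intro x hx
    have hx' := total.map_target hx
    obtain ⟨h1, h2, h3⟩ := hsrc _ hx'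
    have hx2 : x.1 ∈ η.target ∧ x.2 ∈ χ.target ∧ (η.symm x.1, χ.symm x.2) ∈ Φ.target := by
      simpa [total, OpenPartialHomeomorph.trans_target, and_assoc] using hx
    have c1 : ContMDiffAt 𝓘(ℝ, EuclideanSpace ℝ (Fin 3) × F) (𝓡 3) ∞
        (fun x : EuclideanSpace ℝ (Fin 3) × F ↦ η.symm x.1) x :=
      ContMDiffAt.comp (g := η.symm) (f := Prod.fst) x (hη.contMDiffAt_symm hx2.1)
        contDiffAt_fst.contMDiffAt
    have c2 : ContMDiffAt 𝓘(ℝ, EuclideanSpace ℝ (Fin 3) × F) 𝓘(ℝ, F) ∞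
        (fun x : EuclideanSpace ℝ (Fin 3) × F ↦ χ.symm x.2) x :=
      ContMDiffAt.comp (g := χ.symm) (f := Prod.snd) x
        ((contMDiffOn_chart_symm (I := 𝓘(ℝ, F)) _ hx2.2.1).contMDiffAt
          (χ.open_target.mem_nhds hx2.2.1)) contDiffAt_snd.contMDiffAt
    exact (ContMDiffAt.comp (g := Φ.symm) x
      ((hΦ' _ hx2.2.2).contMDiffAt (Φ.open_target.mem_nhds hx2.2.2))
      (c1.prodMk c2)).contMDiffWithinAt
  · intro q hq
    obtain ⟨h1, h2, h3⟩ := hsrc q hq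
    rwa [hfst q h1] at h2
  · intro q hq
    obtain ⟨h1, h2, h3⟩ := hsrc q hq
    change η (Φ q).1 = η (pr q)
    rw [hfst q h1]
  · simp [total, hp, hfst p hp, η, χ]

section toModel

variable {p : N} (u w : VerticalSpace (E := E) pr p)

theorem toModel_add : toModel (u + w) = toModel u + toModel w := rfl
theorem toModel_smul (r : ℝ) : toModel (r • u) = r • toModel u := rfl
theorem toModel_neg : toModel (-u) = -toModel u := rfl
theorem toModel_sub : toModel (u - w) = toModel u - toModel w := rfl
theorem toModel_zero : toModel (0 : VerticalSpace (E := E) pr p) = 0 := rfl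
theorem toModel_injective : Function.Injective (toModel (E := E) (pr := pr) (p := p)) :=
  fun _ _ h ↦ Subtype.ext h

end toModel

namespace AdaptedChart

variable (κ : AdaptedChart F E pr)

theorem contMDiffAt_pr {p : N} (hp : p ∈ κ.total.source) : ContMDiffAt 𝓘(ℝ, E) (𝓡 3) ∞ pr p := by
  have h1 : ContMDiffAt 𝓘(ℝ, E) 𝓘(ℝ, EuclideanSpace ℝ (Fin 3)) ∞ (fun q ↦ (κ.total q).1) p :=
    ContMDiffAt.comp (g := Prod.fst) (f := κ.total) p contDiffAt_fst.contMDiffAt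
      (κ.total_smooth.contMDiffAt hp)
  have h2 := κ.base_smooth.contMDiffAt_symm (κ.base.map_source (κ.pr_mem p hp))
  rw [← κ.fst_total p hp] at h2
  refine (ContMDiffAt.comp (g := κ.base.symm) p h2 h1).congr_of_eventuallyEq ?_
  filter_upwards [κ.total.open_source.mem_nhds hp] with q hq
  simp [κ.fst_total q hq, κ.base.left_inv (κ.pr_mem q hq)]

theorem coordDeriv_base_mfderiv_pr {p : N} (hp : p ∈ κ.total.source) (e : E) :
    coordDeriv (EuclideanSpace ℝ (Fin 3)) κ.base (pr p) (mfderiv 𝓘(ℝ, E) (𝓡 3) pr p e) =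
      (coordDeriv E κ.total p e).1 := by
  have h1 := mfderiv_comp p (κ.base_smooth.mdifferentiableAt (κ.pr_mem p hp))
    ((κ.contMDiffAt_pr hp).mdifferentiableAt (by simp))
  have h2 := mfderiv_comp p (g := (Prod.fst : EuclideanSpace ℝ (Fin 3) × F → _))
    (I'' := 𝓘(ℝ, EuclideanSpace ℝ (Fin 3))) differentiableAt_fst.mdifferentiableAt
    (κ.total_smooth.mdifferentiableAt hp)
  have h3 : κ.base ∘ pr =ᶠ[𝓝 p] Prod.fst ∘ κ.total := by
    filter_upwards [κ.total.open_source.mem_nhds hp] with q hq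
    simp [κ.fst_total q hq]
  rw [h3.mfderiv_eq, h2, mfderiv_eq_fderiv, fderiv_fst] at h1
  exact (congrArg (fun T : E →L[ℝ] EuclideanSpace ℝ (Fin 3) ↦ T e) h1).symm

/-- The derivative of `κ.base` is injective and carries `dpr` to the first component of the
derivative of `κ.total`. -/
theorem mem_verticalSpace_iff {p : N} (hp : p ∈ κ.total.source) (e : E) :
    (e : TangentSpace 𝓘(ℝ, E) p) ∈ VerticalSpace (E := E) pr p ↔
      (coordDeriv E κ.total p e).1 = 0 := by
  rw [← κ.coordDeriv_base_mfderiv_pr hp e]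
  constructor
  · intro h
    have : mfderiv 𝓘(ℝ, E) (𝓡 3) pr p e = 0 := h
    rw [this]
    exact map_zero _
  · intro h
    have := κ.base_smooth.symm_deriv_deriv (κ.pr_mem p hp) (mfderiv 𝓘(ℝ, E) (𝓡 3) pr p e)
    rw [h, map_zero] at this
    exact this.symm

/-- The fibre component of a tangent vector of the total space. -/
def fib (p : N) : E →L[ℝ] F :=
  ContinuousLinearMap.snd ℝ (EuclideanSpace ℝ (Fin 3)) F ∘L coordDeriv E κ.total p

theorem coordDeriv_toModel {p : N} (hp : p ∈ κ.total.source) (u : VerticalSpace (E := E) pr p) :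
    coordDeriv E κ.total p (toModel u) = (0, κ.fib p (toModel u)) :=
  Prod.ext ((κ.mem_verticalSpace_iff hp (toModel u)).1 u.2) rfl

theorem ext_fib {p : N} (hp : p ∈ κ.total.source) {u w : VerticalSpace (E := E) pr p}
    (h : κ.fib p (toModel u) = κ.fib p (toModel w)) : u = w := by
  apply toModel_injective
  rw [← κ.total_smooth.symm_deriv_deriv hp (toModel u), κ.coordDeriv_toModel hp, h,
    ← κ.coordDeriv_toModel hp, κ.total_smooth.symm_deriv_deriv hp]

theorem coordDerivSymm_mem {p : N} (hp : p ∈ κ.total.source) (a : F) :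
    (coordDerivSymm E κ.total (κ.total p) (0, a) : TangentSpace 𝓘(ℝ, E) p) ∈
      VerticalSpace (E := E) pr p := by
  rw [κ.mem_verticalSpace_iff hp, κ.total_smooth.deriv_symm_deriv hp]

open Classical in
/-- The vertical vector with a given fibre component. -/
def vlift (p : N) : F →ₗ[ℝ] VerticalSpace (E := E) pr p :=
  -- The zero map outside the chart domain lets `field` define a vertical field on all of `N`, as
  -- required by `VSmoothAt` and `vBracket`.
  if hp : p ∈ κ.total.source then
    { toFun := fun a ↦ ⟨coordDerivSymm E κ.total (κ.total p) (0, a), κ.coordDerivSymm_mem hp a⟩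
      map_add' := fun a b ↦ Subtype.ext
        ((congrArg (coordDerivSymm E κ.total (κ.total p))
          (show ((0 : EuclideanSpace ℝ (Fin 3)), a + b) = (0, a) + (0, b) by simp)).trans
            (map_add (coordDerivSymm E κ.total (κ.total p)) _ _))
      map_smul' := fun r a ↦ Subtype.ext
        ((congrArg (coordDerivSymm E κ.total (κ.total p))
          (show ((0 : EuclideanSpace ℝ (Fin 3)), r • a) = r • (0, a) by simp)).trans
            (map_smul (coordDerivSymm E κ.total (κ.total p)) _ _)) }
  else 0

theorem toModel_vlift {p : N} (hp : p ∈ κ.total.source) (a : F) :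
    toModel (κ.vlift p a) = coordDerivSymm E κ.total (κ.total p) (0, a) := by
  simp [vlift, hp, toModel]

theorem fib_vlift {p : N} (hp : p ∈ κ.total.source) (a : F) :
    κ.fib p (toModel (κ.vlift p a)) = a := by
  rw [κ.toModel_vlift hp, fib, ContinuousLinearMap.comp_apply, κ.total_smooth.deriv_symm_deriv hp]
  rfl

theorem vlift_fib {p : N} (hp : p ∈ κ.total.source) (u : VerticalSpace (E := E) pr p) :
    κ.vlift p (κ.fib p (toModel u)) = u :=
  κ.ext_fib hp (κ.fib_vlift hp _)

/-- The vertical vector field with given fibre component. -/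
def field (ξ : EuclideanSpace ℝ (Fin 3) × F → F) (q : N) : VerticalSpace (E := E) pr q :=
  κ.vlift q (ξ (κ.total q))

/-- The fibre component of a vertical vector field. -/
def rep (X : Π q : N, VerticalSpace (E := E) pr q) (x : EuclideanSpace ℝ (Fin 3) × F) : F :=
  κ.fib (κ.total.symm x) (toModel (X (κ.total.symm x)))

theorem rep_total {p : N} (hp : p ∈ κ.total.source) (X : Π q : N, VerticalSpace (E := E) pr q) :
    κ.rep X (κ.total p) = κ.fib p (toModel (X p)) := by
  rw [rep, κ.total.left_inv hp]

theorem rep_field {x : EuclideanSpace ℝ (Fin 3) × F} (hx : x ∈ κ.total.target)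
    (ξ : EuclideanSpace ℝ (Fin 3) × F → F) : κ.rep (κ.field ξ) x = ξ x := by
  rw [rep, field, κ.fib_vlift (κ.total.map_target hx), κ.total.right_inv hx]

theorem rep_field_eventuallyEq {p : N} (hp : p ∈ κ.total.source)
    (ξ : EuclideanSpace ℝ (Fin 3) × F → F) : κ.rep (κ.field ξ) =ᶠ[𝓝 (κ.total p)] ξ := by
  filter_upwards [κ.total.open_target.mem_nhds (κ.total.map_source hp)] with x hx
    using κ.rep_field hx ξ

theorem contMDiffAt_vertical_iff {E' : Type*} [NormedAddCommGroup E'] [NormedSpace ℝ E']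
    {H' : Type*} [TopologicalSpace H'] {I' : ModelWithCorners ℝ E' H'} {S : Type*}
    [TopologicalSpace S] [ChartedSpace H' S] {f : S → N}
    {w : Π s : S, VerticalSpace (E := E) pr (f s)} {s : S} (hf : ContMDiffAt I' 𝓘(ℝ, E) ∞ f s)
    (hs : f s ∈ κ.total.source) :
    ContMDiffAt I' 𝓘(ℝ, E).tangent ∞
      (fun s ↦ (⟨f s, (w s : TangentSpace 𝓘(ℝ, E) (f s))⟩ : TangentBundle 𝓘(ℝ, E) N)) s ↔
    ContMDiffAt I' 𝓘(ℝ, F) ∞ (fun s ↦ κ.fib (f s) (toModel (w s))) s := by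
  have h1 := κ.total_smooth.contMDiffAt_tangent_iff (I' := I') (f := f)
    (w := fun s ↦ toModel (w s)) hs
  refine h1.trans ?_
  have h2 : (fun s ↦ coordDeriv E κ.total (f s) (toModel (w s))) =ᶠ[𝓝 s]
      fun s ↦ ((0 : EuclideanSpace ℝ (Fin 3)), κ.fib (f s) (toModel (w s))) := by
    filter_upwards [hf.continuousAt.preimage_mem_nhds (κ.total.open_source.mem_nhds hs)] with t ht
      using κ.coordDeriv_toModel ht (w t)
  rw [and_iff_right hf, h2.contMDiffAt_iff]
  constructor
  · intro h
    exact ContMDiffAt.comp (g := Prod.snd)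
      (f := fun s ↦ ((0 : EuclideanSpace ℝ (Fin 3)), κ.fib (f s) (toModel (w s)))) s
      contDiffAt_snd.contMDiffAt h
  · intro h
    exact contMDiffAt_const.prodMk_space h

theorem vsmoothAt_iff {p : N} (hp : p ∈ κ.total.source)
    {X : Π q : N, VerticalSpace (E := E) pr q} :
    VSmoothAt X p ↔ ContDiffAt ℝ ∞ (κ.rep X) (κ.total p) :=
  (κ.contMDiffAt_vertical_iff (f := id) contMDiffAt_id hp).trans
    (κ.total_smooth.contMDiffAt_iff_contDiffAt hp)

theorem vsmoothAt_field {p : N} (hp : p ∈ κ.total.source) {ξ : EuclideanSpace ℝ (Fin 3) × F → F}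
    (hξ : ContDiffAt ℝ ∞ ξ (κ.total p)) : VSmoothAt (κ.field ξ : Π q : N, VerticalSpace pr q) p :=
  (κ.vsmoothAt_iff hp).2 (hξ.congr_of_eventuallyEq (κ.rep_field_eventuallyEq hp ξ))

theorem vDeriv_eq {p : N} (hp : p ∈ κ.total.source) (u : VerticalSpace (E := E) pr p) {f : N → ℝ}
    (hf : DifferentiableAt ℝ (f ∘ κ.total.symm) (κ.total p)) :
    vDeriv u f = fibreDeriv (f ∘ κ.total.symm) (κ.total p) (κ.fib p (toModel u)) := by
  have := κ.total_smooth.mvfderiv_eq hp hf (toModel u)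
  rw [κ.coordDeriv_toModel hp] at this
  exact this

/-- The first components of both fields vanish near the point, hence so does that of their bracket.
The bracket is therefore vertical, so `toVertical` does not take its default value, and only
derivatives along the fibre occur. -/
theorem fib_vBracket [FiniteDimensional ℝ E] [FiniteDimensional ℝ F] {p : N}
    (hp : p ∈ κ.total.source) {X Z : Π q : N, VerticalSpace (E := E) pr q} (hX : VSmoothAt X p)
    (hZ : VSmoothAt Z p) :
    κ.fib p (toModel (vBracket X Z p)) =
      fibreDeriv (κ.rep Z) (κ.total p) (κ.rep X (κ.total p)) -
        fibreDeriv (κ.rep X) (κ.total p) (κ.rep Z (κ.total p)) := by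
  have : CompleteSpace E := FiniteDimensional.complete ℝ E
  have : CompleteSpace F := FiniteDimensional.complete ℝ F
  have h1 := κ.total_smooth.deriv_mlieBracket hp _ _ hX hZ
  have hx := κ.total.map_source hp
  have pe : ∀ W : Π q : N, VerticalSpace (E := E) pr q,
      (fun x ↦ coordDeriv E κ.total (κ.total.symm x) (toModel (W (κ.total.symm x))))
        =ᶠ[𝓝 (κ.total p)] fun x ↦ ((0 : EuclideanSpace ℝ (Fin 3)), κ.rep W x) := by
    intro W
    filter_upwards [κ.total.open_target.mem_nhds hx] with x hx
      using κ.coordDeriv_toModel (κ.total.map_target hx) _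
  have dd : ∀ W : Π q : N, VerticalSpace (E := E) pr q, VSmoothAt W p → ∀ v,
      fderiv ℝ (fun x ↦ ((0 : EuclideanSpace ℝ (Fin 3)), κ.rep W x)) (κ.total p) v =
        (0, fderiv ℝ (κ.rep W) (κ.total p) v) := by
    intro W hW v
    have hd : DifferentiableAt ℝ (κ.rep W) (κ.total p) :=
      ((κ.vsmoothAt_iff hp).1 hW).differentiableAt (by simp)
    rw [((hasFDerivAt_const (0 : EuclideanSpace ℝ (Fin 3)) _).prodMk hd.hasFDerivAt).fderiv]
    rfl
  have h2 := h1.trans ((pe X).lieBracket_vectorField_eq (pe Z))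
  rw [VectorField.lieBracket, dd X hX, dd Z hZ] at h2
  have hmem : VectorField.mlieBracket 𝓘(ℝ, E) (fun q ↦ (X q : TangentSpace 𝓘(ℝ, E) q))
      (fun q ↦ (Z q : TangentSpace 𝓘(ℝ, E) q)) p ∈ VerticalSpace (E := E) pr p := by
    refine (κ.mem_verticalSpace_iff hp _).2 ?_
    rw [h2]
    simp
  have h3 : toModel (vBracket X Z p) = VectorField.mlieBracket 𝓘(ℝ, E)
      (fun q ↦ (X q : TangentSpace 𝓘(ℝ, E) q)) (fun q ↦ (Z q : TangentSpace 𝓘(ℝ, E) q)) p := by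
    rw [vBracket, toVertical, dif_pos hmem]
    rfl
  rw [h3]
  exact congrArg Prod.snd h2

end AdaptedChart

end AdaptedCharts

/-! ### Operator-valued curves and one-sided inverses in finite dimension -/

section

theorem hasDerivAt_clm_of_apply {F : Type*} [NormedAddCommGroup F] [NormedSpace ℝ F]
    [FiniteDimensional ℝ F] {V : Type*} [NormedAddCommGroup V] [NormedSpace ℝ V]
    {w : ℝ → F →L[ℝ] V} {w' : F →L[ℝ] V} {s : ℝ}
    (h : ∀ a, HasDerivAt (fun r ↦ w r a) (w' a) s) : HasDerivAt w w' s := by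
  let d := Module.finrank ℝ F
  have hd : d = Module.finrank ℝ (Fin d → ℝ) := (Module.finrank_fin_fun ℝ).symm
  let e₁ := ContinuousLinearEquiv.ofFinrankEq hd
  let e₂ := (e₁.arrowCongr (1 : V ≃L[ℝ] V)).trans (ContinuousLinearEquiv.piRing (Fin d))
  have h1 : HasDerivAt (fun r ↦ e₂ (w r)) (e₂ w') s := hasDerivAt_pi.2 fun i => h _
  have h2 := e₂.symm.toContinuousLinearMap.hasFDerivAt.comp_hasDerivAt s h1
  exact (h2.congr_deriv (e₂.symm_apply_apply w')).congr_of_eventuallyEq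
    (.of_forall fun r ↦ (e₂.symm_apply_apply (w r)).symm)

theorem ContinuousLinearMap.mul_eq_one_comm_of_finiteDimensional {F : Type*} [NormedAddCommGroup F]
    [NormedSpace ℝ F] [FiniteDimensional ℝ F] {X Y : F →L[ℝ] F} (h : X * Y = 1) : Y * X = 1 := by
  have h1 : (X : F →ₗ[ℝ] F) * (Y : F →ₗ[ℝ] F) = 1 := by
    ext a
    exact congrArg (fun T : F →L[ℝ] F ↦ T a) h
  have h2 := mul_eq_one_comm.1 h1
  ext a
  exact congrArg (fun T : F →ₗ[ℝ] F ↦ T a) h2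

end

/-! ### The Levi-Civita connection of the fibres and its parallel transport -/

section LeviCivita

variable {E : Type*} [NormedAddCommGroup E] [NormedSpace ℝ E]
  {Y : Type*} [TopologicalSpace Y] [ChartedSpace (EuclideanSpace ℝ (Fin 3)) Y]
  {N : Type*} [TopologicalSpace N] [ChartedSpace E N] [IsManifold 𝓘(ℝ, E) ∞ N]
  {F : Type*} [NormedAddCommGroup F] [NormedSpace ℝ F] [FiniteDimensional ℝ F]
  {pr : N → Y} (κ : AdaptedChart F E pr) (g : VerticalMetric E pr)

namespace AdaptedChart

/-- The metric of the fibres in coordinates. -/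
def metric (x : EuclideanSpace ℝ (Fin 3) × F) : F →L[ℝ] F →L[ℝ] ℝ :=
  LinearMap.toContinuousLinearMap
    ((LinearMap.toContinuousLinearMap : (F →ₗ[ℝ] ℝ) ≃ₗ[ℝ] (F →L[ℝ] ℝ)).toLinearMap ∘ₗ
      ((g.inner (κ.total.symm x)).compl₁₂ (κ.vlift _) (κ.vlift _)))

theorem metric_apply (x : EuclideanSpace ℝ (Fin 3) × F) (a b : F) :
    κ.metric g x a b = g.inner (κ.total.symm x) (κ.vlift _ a) (κ.vlift _ b) := rfl

variable {κ g} {p : N}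

theorem inner_eq (hp : p ∈ κ.total.source) (u w : VerticalSpace (E := E) pr p) :
    g.inner p u w = κ.metric g (κ.total p) (κ.fib p (toModel u)) (κ.fib p (toModel w)) := by
  rw [metric_apply, κ.total.left_inv hp, κ.vlift_fib hp, κ.vlift_fib hp]

theorem inner_comp_eventuallyEq (hp : p ∈ κ.total.source)
    (X Z : Π q : N, VerticalSpace (E := E) pr q) :
    (fun q ↦ g.inner q (X q) (Z q)) ∘ κ.total.symm =ᶠ[𝓝 (κ.total p)]
      fun x ↦ κ.metric g x (κ.rep X x) (κ.rep Z x) := by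
  filter_upwards [κ.total.open_target.mem_nhds (κ.total.map_source hp)] with x hx
  simp [inner_eq (κ.total.map_target hx), κ.total.right_inv hx, rep]

theorem isMetricAt (hp : p ∈ κ.total.source) : IsMetricAt (κ.metric g) (κ.total p) where
  smooth := by
    refine contDiffAt_clm_of_apply fun a ↦ contDiffAt_clm_of_apply fun b ↦ ?_
    have := g.smooth p (κ.field fun _ ↦ a) (κ.field fun _ ↦ b)
      (κ.vsmoothAt_field hp contDiffAt_const) (κ.vsmoothAt_field hp contDiffAt_const)
    exact (κ.total_smooth.contMDiffAt_iff_contDiffAt hp).1 this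
  symm := .of_forall fun x a b ↦ g.symm _ _ _
  pos a ha := by
    rw [metric_apply, κ.total.left_inv hp]
    refine g.pos _ _ fun h0 ↦ ha ?_
    rw [← κ.fib_vlift hp a, h0]
    exact map_zero _

theorem vDeriv_inner (hp : p ∈ κ.total.source) (u : VerticalSpace (E := E) pr p)
    {X Z : Π q : N, VerticalSpace (E := E) pr q} (hX : VSmoothAt X p) (hZ : VSmoothAt Z p) :
    vDeriv u (fun q ↦ g.inner q (X q) (Z q)) =
      fibreDeriv (fun x ↦ κ.metric g x (κ.rep X x) (κ.rep Z x)) (κ.total p)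
        (κ.fib p (toModel u)) := by
  have e := inner_comp_eventuallyEq (g := g) hp X Z
  have hs : ContDiffAt ℝ ∞ ((fun q ↦ g.inner q (X q) (Z q)) ∘ κ.total.symm) (κ.total p) :=
    (κ.total_smooth.contMDiffAt_iff_contDiffAt hp).1 (g.smooth p X Z hX hZ)
  rw [κ.vDeriv_eq hp u (hs.differentiableAt (by simp)), fibreDeriv, fibreDeriv, e.fderiv_eq]

/-- The Levi-Civita connection of the fibres in coordinates. -/
theorem leviCivita_eq [FiniteDimensional ℝ E] (hp : p ∈ κ.total.source)
    {X Z W : Π q : N, VerticalSpace (E := E) pr q}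
    (hX : VSmoothAt X p) (hZ : VSmoothAt Z p) (hW : VSmoothAt W p) :
    leviCivita g X Z W p =
      κ.metric g (κ.total p) (κ.rep W (κ.total p))
        (christoffel (κ.metric g) (κ.total p) (κ.rep X (κ.total p)) (κ.rep Z (κ.total p)) +
          fibreDeriv (κ.rep Z) (κ.total p) (κ.rep X (κ.total p))) := by
  have hm := isMetricAt (g := g) hp
  have dX := ((κ.vsmoothAt_iff hp).1 hX).differentiableAt (by simp)
  have dZ := ((κ.vsmoothAt_iff hp).1 hZ).differentiableAt (by simp)
  have dW := ((κ.vsmoothAt_iff hp).1 hW).differentiableAt (by simp)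
  have h1 := hm.koszul dX dZ dW
  rw [leviCivita, vDeriv_inner hp _ hZ hW, vDeriv_inner hp _ hX hW, vDeriv_inner hp _ hX hZ,
    inner_eq hp (vBracket X Z p), inner_eq hp (vBracket X W p), inner_eq hp (vBracket Z W p),
    κ.fib_vBracket hp hX hZ, κ.fib_vBracket hp hX hW, κ.fib_vBracket hp hZ hW]
  simp only [← κ.rep_total hp]
  rw [h1, ← hm.apply_christoffel, map_add, hm.symm.self_of_nhds (κ.rep W (κ.total p)),
    hm.symm.self_of_nhds (κ.rep W (κ.total p))]

variable {c : ℝ → N} {s : ℝ}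

/-- Lowering the index turns parallelism into the linear equation `β' = β ∘ Γ(v)` for the covector
`β = ⟨W, ·⟩`. The covector is the natural unknown: the definition differentiates only pairings of
`W` with fields and assumes no regularity of `W`. -/
theorem isParallelAt_iff [FiniteDimensional ℝ E] {W : Π r : ℝ, VerticalSpace (E := E) pr (c r)}
    {v : F} (hs : c s ∈ κ.total.source) (hc : MDifferentiableAt 𝓘(ℝ, ℝ) 𝓘(ℝ, E) c s)
    (hv : HasDerivAt (κ.total ∘ c) (0, v) s) :
    IsParallelAt g c W s ↔
      HasDerivAt (fun r ↦ κ.metric g (κ.total (c r)) (κ.fib (c r) (toModel (W r))))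
        (κ.metric g (κ.total (c s)) (κ.fib (c s) (toModel (W s))) ∘L
          christoffel (κ.metric g) (κ.total (c s)) v) s := by
  have hvel : coordDeriv E κ.total (c s) (mfderiv 𝓘(ℝ, ℝ) 𝓘(ℝ, E) c s (1 : ℝ) : E) = (0, v) :=
    (κ.total_smooth.hasDerivAt_comp_curve hs hc).unique hv
  obtain ⟨e, he⟩ : ∃ e : E, e = (mfderiv 𝓘(ℝ, ℝ) 𝓘(ℝ, E) c s (1 : ℝ) : E) := ⟨_, rfl⟩
  replace hvel : coordDeriv E κ.total (c s) e = (0, v) := by rw [he]; exact hvel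
  have hev : ∀ Z : Π q : N, VerticalSpace (E := E) pr q,
      (fun r ↦ g.inner (c r) (W r) (Z (c r))) =ᶠ[𝓝 s]
        fun r ↦ κ.metric g (κ.total (c r)) (κ.fib (c r) (toModel (W r)))
          (κ.rep Z (κ.total (c r))) := by
    intro Z
    filter_upwards [hc.continuousAt.preimage_mem_nhds (κ.total.open_source.mem_nhds hs)] with r hr
    rw [inner_eq hr, κ.rep_total hr]
  constructor
  · intro h
    refine hasDerivAt_clm_of_apply fun b ↦ ?_
    -- Fields with constant components suffice as test fields; for them the derivative of `Z` drops
    -- out and only the Christoffel term is left.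
    have hC := κ.vsmoothAt_field hs (ξ := fun _ ↦ v) contDiffAt_const
    have hZ := κ.vsmoothAt_field hs (ξ := fun _ ↦ b) contDiffAt_const
    have hU := κ.vsmoothAt_field hs (ξ := fun _ ↦ κ.fib (c s) (toModel (W s))) contDiffAt_const
    have h1 := h _ _ _ hZ hC hU
      (Eq.trans (by
        rw [field, κ.toModel_vlift hs, ← hvel, κ.total_smooth.symm_deriv_deriv hs]) he)
      (κ.vlift_fib hs (W s))
    rw [leviCivita_eq hs hC hZ hU] at h1
    have ht := κ.total.map_source hs
    have h0 : fibreDeriv (κ.rep (κ.field fun _ ↦ b)) (κ.total (c s)) v = 0 := by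
      rw [fibreDeriv, (κ.rep_field_eventuallyEq hs _).fderiv_eq, fderiv_fun_const]
      rfl
    simp only [κ.rep_field ht] at h1
    rw [h0, add_zero] at h1
    refine h1.congr_of_eventuallyEq ?_
    filter_upwards [hev (κ.field fun _ ↦ b),
      hc.continuousAt.preimage_mem_nhds (κ.total.open_source.mem_nhds hs)] with r hr hr'
    rw [hr, κ.rep_field (κ.total.map_source hr')]
  · intro h Z C U hZ hC hU hCv hUW
    -- In `leviCivita_eq` the fields `C` and `U` enter only through their values at `c s`, so the
    -- choice of the extensions is immaterial.
    have eC : κ.rep C (κ.total (c s)) = v := by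
      rw [κ.rep_total hs, hCv.trans he.symm, fib, ContinuousLinearMap.comp_apply, hvel]
      rfl
    have eU : κ.rep U (κ.total (c s)) = κ.fib (c s) (toModel (W s)) := by
      rw [κ.rep_total hs, hUW]
    rw [leviCivita_eq hs hC hZ hU, eC, eU]
    have dZ := ((κ.vsmoothAt_iff hs).1 hZ).differentiableAt (by simp)
    have h2 := dZ.hasFDerivAt.comp_hasDerivAt s hv
    refine ((h.clm_apply h2).congr_deriv ?_).congr_of_eventuallyEq (hev Z)
    rw [map_add]
    rfl

/-- Parallel transport along a curve in a fibre, in terms of a fundamental solution `X` of the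
equation of parallel covectors and its inverse `Z`. -/
theorem parallelTransport_eq [FiniteDimensional ℝ E] {δ : ℝ} {v : ℝ → F} {X Yi : ℝ → F →L[ℝ] F}
    (good : ∀ s ∈ Set.Ioo (-δ) δ,
      c s ∈ κ.total.source ∧ MDifferentiableAt 𝓘(ℝ, ℝ) 𝓘(ℝ, E) c s)
    (hvel : ∀ s ∈ Set.Ioo (-δ) δ, HasDerivAt (κ.total ∘ c) (0, v s) s)
    (hX : ∀ s ∈ Set.Ioo (-δ) δ,
      HasDerivAt X (X s * christoffel (κ.metric g) (κ.total (c s)) (v s)) s)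
    (hY : ∀ s ∈ Set.Ioo (-δ) δ,
      HasDerivAt Yi (-(christoffel (κ.metric g) (κ.total (c s)) (v s) * Yi s)) s)
    (hXY : ∀ s ∈ Set.Ioo (-δ) δ, X s * Yi s = 1) (hY0 : Yi 0 = 1) {t : ℝ}
    (ht : t ∈ Set.Ioo (-δ) δ) (e : VerticalSpace (E := E) pr (c t)) :
    parallelTransport g c t e = κ.vlift (c 0) ((κ.metric g (κ.total (c 0))).inverse
      (κ.metric g (κ.total (c t)) (κ.fib (c t) (toModel e)) ∘L Yi t)) := by
  have z0 : (0 : ℝ) ∈ Set.Ioo (-δ) δ := by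
    have := ht.1.trans ht.2
    constructor <;> linarith
  have sub : Set.uIcc 0 t ⊆ Set.Ioo (-δ) δ := (Set.ordConnected_Ioo).uIcc_subset z0 ht
  have h0 := (good 0 z0).1
  -- A parallel field with the given end value must be produced first, since otherwise
  -- `parallelTransport` takes its default value. As it uses an arbitrary such field, uniqueness of
  -- the value at `0` is shown afterwards.
  have hex : ∃ W : Π s : ℝ, VerticalSpace (E := E) pr (c s),
      (∀ s ∈ Set.uIcc 0 t, IsParallelAt g c W s) ∧ W t = e := by
    set β := κ.metric g (κ.total (c t)) (κ.fib (c t) (toModel e)) with hβ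
    -- The covector `β ∘ (Yi t * X s)` solves the equation in `s` and equals `β` at `s = t`, because
    -- the right inverse `Yi t` of `X t` is also a left inverse.
    let W : Π s : ℝ, VerticalSpace (E := E) pr (c s) := fun s ↦
      κ.vlift (c s) ((κ.metric g (κ.total (c s))).inverse (β ∘L (Yi t * X s)))
    have hW : ∀ s ∈ Set.Ioo (-δ) δ,
        κ.metric g (κ.total (c s)) (κ.fib (c s) (toModel (W s))) = β ∘L (Yi t * X s) := by
      intro s hs
      rw [κ.fib_vlift (good s hs).1, (isMetricAt (good s hs).1).isInvertible.self_apply_inverse]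
    refine ⟨W, fun s hs ↦ ?_, ?_⟩
    · have hs' := sub hs
      refine (isParallelAt_iff (good s hs').1 (good s hs').2 (hvel s hs')).2 ?_
      rw [hW s hs']
      have d : HasDerivAt (fun r ↦ β ∘L (Yi t * X r))
          (β ∘L (Yi t * (X s * christoffel (κ.metric g) (κ.total (c s)) (v s)))) s :=
        (hasDerivAt_const s β).clm_comp ((hX s hs').const_mul (Yi t)) |>.congr_deriv
          (by simp)
      refine (d.congr_deriv (by rfl)).congr_of_eventuallyEq ?_
      filter_upwards [Ioo_mem_nhds hs'.1 hs'.2] with r hr using hW r hr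
    · apply κ.ext_fib (good t ht).1
      rw [κ.fib_vlift (good t ht).1,
        ContinuousLinearMap.mul_eq_one_comm_of_finiteDimensional (hXY t ht)]
      change (κ.metric g (κ.total (c t))).inverse β = _
      rw [hβ, (isMetricAt (good t ht).1).isInvertible.inverse_apply_self]
  have huniq : ∀ W : Π s : ℝ, VerticalSpace (E := E) pr (c s),
      (∀ s ∈ Set.uIcc 0 t, IsParallelAt g c W s) → W t = e →
      W 0 = κ.vlift (c 0) ((κ.metric g (κ.total (c 0))).inverse
        (κ.metric g (κ.total (c t)) (κ.fib (c t) (toModel e)) ∘L Yi t)) := by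
    intro W hW hWt
    -- For a parallel field, composing its covector with `Yi` gives a conserved quantity: the two
    -- Christoffel terms cancel. Its values at `0` and `t` determine `W 0`.
    have d : ∀ s ∈ Set.uIcc 0 t, HasDerivAt (fun r ↦
        κ.metric g (κ.total (c r)) (κ.fib (c r) (toModel (W r))) ∘L Yi r) 0 s := by
      intro s hs
      have hs' := sub hs
      have h1 := (isParallelAt_iff (good s hs').1 (good s hs').2 (hvel s hs')).1 (hW s hs)
      refine (h1.clm_comp (hY s hs')).congr_deriv ?_
      ext a
      simp
    have := constant_of_hasDerivAt_zero_uIcc d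
    rw [hY0, hWt] at this
    rw [← this]
    apply κ.ext_fib h0
    rw [κ.fib_vlift h0]
    exact ((isMetricAt h0).isInvertible.inverse_apply_self _).symm
  rw [parallelTransport, dif_pos hex]
  exact huniq _ hex.choose_spec.1 hex.choose_spec.2

/-- The derivative of the parallel transport of vectors along a curve in a fibre. -/
theorem hasDerivAt_parallelTransport [FiniteDimensional ℝ E] {y : Y} (hsec : ∀ r, pr (c r) = y)
    (hc : ContMDiffAt 𝓘(ℝ, ℝ) 𝓘(ℝ, E) ∞ c 0) (h0 : c 0 ∈ κ.total.source)
    {O : Π t : ℝ, VerticalSpace (E := E) pr (c t)} {o' : F}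
    (hO : HasDerivAt (fun t ↦ κ.fib (c t) (toModel (O t))) o' 0) :
    HasDerivAt (fun t ↦ toModel (parallelTransport g c t (O t)))
      (toModel (κ.vlift (c 0) (o' + christoffel (κ.metric g) (κ.total (c 0))
        (deriv (fun r ↦ (κ.total (c r)).2) 0) (κ.fib (c 0) (toModel (O 0)))))) 0 := by
  have : CompleteSpace F := FiniteDimensional.complete ℝ F
  let u : ℝ → F := fun r ↦ (κ.total (c r)).2
  have hsm : ContDiffAt ℝ ∞ (κ.total ∘ c) 0 :=
    ((κ.total_smooth.contMDiffAt h0).comp 0 hc).contDiffAt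
  have hus : ContDiffAt ℝ ∞ u 0 := contDiffAt_snd.comp 0 hsm
  have hdu : ContDiffAt ℝ ∞ (deriv u) 0 := by
    have := (hus.fderiv_right (m := ∞) (by simp)).clm_apply (contDiffAt_const (c := (1 : ℝ)))
    exact this
  have hm0 := isMetricAt (g := g) h0
  have hA : ContDiffAt ℝ 1
      (fun s ↦ christoffel (κ.metric g) (κ.total (c s)) (deriv u s)) 0 :=
    ((ContDiffAt.comp (g := christoffel (κ.metric g)) (0 : ℝ) hm0.smooth_christoffel
      hsm).clm_apply hdu).of_le ENat.LEInfty.out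
  obtain ⟨δ₁, hδ₁, X, Yi, hX0, hY0, hX, hY, hXY⟩ := exists_fundamental_solution hA
  have ev : ∀ᶠ s in 𝓝 (0 : ℝ), c s ∈ κ.total.source ∧ MDifferentiableAt 𝓘(ℝ, ℝ) 𝓘(ℝ, E) c s := by
    have e1 := hc.continuousAt.preimage_mem_nhds (κ.total.open_source.mem_nhds h0)
    have e2 := (contMDiffAt_iff_contMDiffAt_nhds (n := 1) (by simp)).1
      (hc.of_le ENat.LEInfty.out)
    filter_upwards [e1, e2] with s h1 h2 using ⟨h1, h2.mdifferentiableAt (by simp)⟩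
  obtain ⟨δ₂, hδ₂, hball⟩ := Metric.eventually_nhds_iff.1 ev
  let δ := min δ₁ δ₂
  have hδ : 0 < δ := lt_min hδ₁ hδ₂
  have mem1 : ∀ s ∈ Set.Ioo (-δ) δ, s ∈ Set.Ioo (-δ₁) δ₁ := fun s hs ↦
    ⟨lt_of_le_of_lt (neg_le_neg (min_le_left _ _)) hs.1, lt_of_lt_of_le hs.2 (min_le_left _ _)⟩
  have good : ∀ s ∈ Set.Ioo (-δ) δ,
      c s ∈ κ.total.source ∧ MDifferentiableAt 𝓘(ℝ, ℝ) 𝓘(ℝ, E) c s := fun s hs ↦ by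
    apply hball
    rw [Real.dist_eq, sub_zero, abs_lt]
    exact ⟨lt_of_le_of_lt (neg_le_neg (min_le_right _ _)) hs.1,
      lt_of_lt_of_le hs.2 (min_le_right _ _)⟩
  -- The curve stays in one fibre, so its base component is constant and its velocity has the form
  -- `(0, u')`.
  have hvel : ∀ s ∈ Set.Ioo (-δ) δ, HasDerivAt (κ.total ∘ c) (0, deriv u s) s := by
    intro s hs
    obtain ⟨g1, g2⟩ := good s hs
    have d := κ.total_smooth.hasDerivAt_comp_curve g1 g2
    have d1 : HasDerivAt (fun r ↦ ((κ.total ∘ c) r).1) _ s := d.hasFDerivAt.fst.hasDerivAt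
    have d2 : HasDerivAt u _ s := d.hasFDerivAt.snd.hasDerivAt
    have e1 : (fun r ↦ ((κ.total ∘ c) r).1) =ᶠ[𝓝 s] fun _ ↦ κ.base y := by
      filter_upwards [g2.continuousAt.preimage_mem_nhds (κ.total.open_source.mem_nhds g1)]
        with r hr
      rw [Function.comp, κ.fst_total _ hr, hsec]
    refine d.congr_deriv (Prod.ext ?_ ?_)
    · have := (d1.congr_of_eventuallyEq e1.symm).unique (hasDerivAt_const s (κ.base y))
      simpa using this
    · rw [d2.deriv]
      simp
  have z0 : (0 : ℝ) ∈ Set.Ioo (-δ) δ := by simpa using hδ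
  have evT : (fun t ↦ toModel (parallelTransport g c t (O t))) =ᶠ[𝓝 0] fun t ↦
      coordDerivSymm E κ.total (κ.total (c 0)) (0, (κ.metric g (κ.total (c 0))).inverse
        (κ.metric g (κ.total (c t)) (κ.fib (c t) (toModel (O t))) ∘L Yi t)) := by
    filter_upwards [Ioo_mem_nhds z0.1 z0.2] with t ht
    rw [parallelTransport_eq good hvel (fun s hs ↦ hX s (mem1 s hs)) (fun s hs ↦ hY s (mem1 s hs))
      (fun s hs ↦ hXY s (mem1 s hs)) hY0 ht, κ.toModel_vlift h0]
  have dG : HasDerivAt (fun t ↦ κ.metric g (κ.total (c t)))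
      (fibreDeriv (κ.metric g) (κ.total (c 0)) (deriv u 0)) 0 :=
    hasDerivAt_comp_of_fibreDeriv (x := κ.total ∘ c) (hm0.smooth.differentiableAt (by simp))
      (hvel 0 z0)
  have d1 := ((dG.clm_apply hO).clm_comp (hY 0 (mem1 0 z0)))
  have d2 := (κ.metric g (κ.total (c 0))).inverse.hasFDerivAt.comp_hasDerivAt (0 : ℝ) d1
  have d3 := (coordDerivSymm E κ.total (κ.total (c 0)) ∘L
    ContinuousLinearMap.inr ℝ (EuclideanSpace ℝ (Fin 3)) F).hasFDerivAt.comp_hasDerivAt (0 : ℝ) d2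
  refine (d3.congr_deriv ?_).congr_of_eventuallyEq evT
  -- This is the product rule at `t = 0`, with `Yi 0 = 1` and `Yi' 0 = -Γ(u')`. By metric
  -- compatibility the derivative of the metric contributes two Christoffel terms; one cancels
  -- against `Yi' 0`, the other is the term claimed.
  have key : (κ.metric g (κ.total (c 0))).inverse
      ((fibreDeriv (κ.metric g) (κ.total (c 0)) (deriv u 0) (κ.fib (c 0) (toModel (O 0))) +
          κ.metric g (κ.total (c 0)) o') ∘L Yi 0 +
        κ.metric g (κ.total (c 0)) (κ.fib (c 0) (toModel (O 0))) ∘L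
          (-(christoffel (κ.metric g) (κ.total (c 0)) (deriv u 0) * Yi 0))) =
      o' + christoffel (κ.metric g) (κ.total (c 0)) (deriv u 0) (κ.fib (c 0) (toModel (O 0))) := by
    refine hm0.eq_of_apply_eq fun b ↦ ?_
    rw [hm0.isInvertible.self_apply_inverse, hY0]
    have := hm0.metric_compat (deriv u 0) (κ.fib (c 0) (toModel (O 0))) b
    have sy := hm0.symm.self_of_nhds
    simp [this, sy (κ.fib (c 0) (toModel (O 0)))]
    ring
  rw [κ.toModel_vlift h0, ← key]
  rfl

end AdaptedChart

end LeviCivita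

/-! ### Quaternion relations -/

section QuaternionAlgebra

variable {V : Type*} [AddCommGroup V] [Module ℝ V]

/-- The square of a real combination of anticommuting complex structures `I`, `J`, `K`. -/
theorem quaternion_sq {I J K : Module.End ℝ V} (hI : ∀ u, I (I u) = -u) (hJ : ∀ u, J (J u) = -u)
    (hK : ∀ u, K (K u) = -u) (hIJK : ∀ u, I (J (K u)) = -u) (a b c : ℝ) (u : V) :
    (a • I + b • J + c • K) ((a • I + b • J + c • K) u) = -(a ^ 2 + b ^ 2 + c ^ 2) • u := by
  -- All products of two of the structures follow from `IJK = -1` and the squares; by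
  -- anticommutation the mixed terms of the square then cancel.
  have hIJ : ∀ u, I (J u) = K u := fun u ↦ by
    have := hIJK (K u)
    rw [hK, map_neg, map_neg] at this
    exact neg_injective this
  have hJK : ∀ u, J (K u) = I u := fun u ↦ by
    have := congrArg I (hIJK u)
    rw [hI, map_neg] at this
    exact neg_injective this
  have hJI : ∀ u, J (I u) = -K u := fun u ↦ by rw [← hJK, hJ]
  have hIK : ∀ u, I (K u) = -J u := fun u ↦ by rw [← hIJ, hI]
  have hKI : ∀ u, K (I u) = J u := fun u ↦ by rw [← hIJ (I u), hJI, map_neg, hIK, neg_neg]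
  have hKJ : ∀ u, K (J u) = -I u := fun u ↦ by rw [← hIJ (J u), hJ, map_neg]
  simp only [LinearMap.add_apply, LinearMap.smul_apply, map_add, map_smul, hI, hJ, hK, hIJ, hJK,
    hJI, hIK, hKI, hKJ]
  module

end QuaternionAlgebra

/-! ### The Clifford relation -/

section Clifford

variable {Y : Type*} [TopologicalSpace Y] [ChartedSpace (EuclideanSpace ℝ (Fin 3)) Y]
  [IsManifold (𝓡 3) ∞ Y] [RiemannianBundle (fun y : Y ↦ TangentSpace (𝓡 3) y)]
  {E : Type*} [NormedAddCommGroup E] [NormedSpace ℝ E]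
  {N : Type*} [TopologicalSpace N] [ChartedSpace E N] [IsManifold 𝓘(ℝ, E) ∞ N]
  {F : Type*} [NormedAddCommGroup F] [NormedSpace ℝ F]
  {M : Type*} [TopologicalSpace M] [ChartedSpace F M]
  {pr : N → Y}

theorem covector_eq_sum_innerSL {T : Type*} [NormedAddCommGroup T] [InnerProductSpace ℝ T]
    (b : OrthonormalBasis (Fin 3) ℝ T) (α : T →L[ℝ] ℝ) :
    α = α (b 0) • innerSL ℝ (b 0) + α (b 1) • innerSL ℝ (b 1) + α (b 2) • innerSL ℝ (b 2) := by
  ext v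
  have h1 := congrArg α (b.sum_repr' v)
  rw [← h1, map_sum, Fin.sum_univ_three]
  simp [mul_comm]

theorem norm_covector_sq {T : Type*} [NormedAddCommGroup T] [InnerProductSpace ℝ T]
    (b : OrthonormalBasis (Fin 3) ℝ T) (α : T →L[ℝ] ℝ) :
    ‖α‖ ^ 2 = α (b 0) ^ 2 + α (b 1) ^ 2 + α (b 2) ^ 2 := by
  have : FiniteDimensional ℝ T := Module.Basis.finiteDimensional_of_finite b.toBasis
  have : CompleteSpace T := FiniteDimensional.complete ℝ T
  obtain ⟨w, rfl⟩ := (InnerProductSpace.toDual ℝ T).surjective α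
  have h1 := b.sum_sq_norm_inner_right w
  rw [Fin.sum_univ_three] at h1
  rw [LinearIsometryEquiv.norm_map, ← h1]
  simp [real_inner_comm]

/-- In the orthonormal coframe acting by a hyperkähler triple, `α` acts by `aI + bJ + cK` with `a² +
b² + c² = |α|²`. -/
theorem HyperkahlerBundle.cliff_sq (B : HyperkahlerBundle F M E pr) (y : Y)
    (α : TangentSpace (𝓡 3) y →L[ℝ] ℝ) (p : Fib pr y) (w : VerticalSpace (E := E) pr p.1) :
    B.cliff y α p (B.cliff y α p w) = -(‖α‖ ^ 2) • w := by
  obtain ⟨b, hb⟩ := B.hyperkahler y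
  have h1 := covector_eq_sum_innerSL b α
  have h2 : B.cliff y α p = α (b 0) • B.cliff y (innerSL ℝ (b 0)) p +
      α (b 1) • B.cliff y (innerSL ℝ (b 1)) p + α (b 2) • B.cliff y (innerSL ℝ (b 2)) p := by
    conv_lhs => rw [h1]
    simp
  rw [h2, quaternion_sq (hb.kahler_I.sq p) (hb.kahler_J.sq p) (hb.kahler_K.sq p) (hb.mul p),
    norm_covector_sq b α]

theorem isCliffordModule (B : HyperkahlerBundle F M E pr) (φ : FibSection E pr) :
    IsCliffordModule B φ :=
  fun y α w ↦ B.cliff_sq y α ⟨φ.toFun y, φ.isSection y⟩ w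

end Clifford

/-! ### Derivatives along a single fibre -/

section FibreCoordinates

/-- A fibre derivative sees only the slice through the point. This is needed because the relations
of a complex structure given by a covector at one point of `Y` hold only over that point, not on an
open set of the total space. -/
theorem fibreDeriv_congr {H : Type*} [NormedAddCommGroup H] [NormedSpace ℝ H]
    {F : Type*} [NormedAddCommGroup F] [NormedSpace ℝ F]
    {V : Type*} [NormedAddCommGroup V] [NormedSpace ℝ V] {f f' : H × F → V} {x : H × F}
    (hf : DifferentiableAt ℝ f x) (hf' : DifferentiableAt ℝ f' x)
    (h : ∀ᶠ y in 𝓝 x, y.1 = x.1 → f y = f' y) (a : F) : fibreDeriv f x a = fibreDeriv f' x a := by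
  have hc : HasDerivAt (fun t : ℝ ↦ (x.1, x.2 + t • a)) (0, a) 0 := by
    have := (hasDerivAt_const (0 : ℝ) x.1).prodMk
      (((hasDerivAt_id (0 : ℝ)).smul_const a).const_add x.2)
    simpa using this
  have hx : (x.1, x.2 + (0 : ℝ) • a) = x := by simp
  have d1 := hasDerivAt_comp_of_fibreDeriv (f := f) (by rwa [hx]) hc
  have d2 := hasDerivAt_comp_of_fibreDeriv (f := f') (by rwa [hx]) hc
  rw [hx] at d1 d2
  refine d1.unique (d2.congr_of_eventuallyEq ?_)
  have hcont : Filter.Tendsto (fun t : ℝ ↦ (x.1, x.2 + t • a)) (𝓝 0) (𝓝 x) := by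
    simpa [ContinuousAt] using hc.continuousAt
  filter_upwards [hcont.eventually h] with t ht using ht rfl

end FibreCoordinates

/-! ### The Clifford action in coordinates -/

section CliffordCoordinates

variable {Y : Type*} [TopologicalSpace Y] [ChartedSpace (EuclideanSpace ℝ (Fin 3)) Y]
  [IsManifold (𝓡 3) ∞ Y] [RiemannianBundle (fun y : Y ↦ TangentSpace (𝓡 3) y)]
  {E : Type*} [NormedAddCommGroup E] [NormedSpace ℝ E]
  {N : Type*} [TopologicalSpace N] [ChartedSpace E N] [IsManifold 𝓘(ℝ, E) ∞ N]
  {F : Type*} [NormedAddCommGroup F] [NormedSpace ℝ F]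
  {M : Type*} [TopologicalSpace M] [ChartedSpace F M]
  {pr : N → Y}

/-- The action on covectors by endomorphisms depends only on the underlying points. -/
theorem HyperkahlerBundle.cliff_mvfderiv_congr (B : HyperkahlerBundle F M E pr) (f : Y → ℝ) {y : Y}
    (q : Fib pr y) :
    B.cliff (pr q.1) (mvfderiv (𝓡 3) f (pr q.1)) ⟨q.1, rfl⟩ = B.cliff y (mvfderiv (𝓡 3) f y) q := by
  obtain ⟨q, rfl⟩ := q
  rfl

namespace AdaptedChart

variable (κ : AdaptedChart F E pr) (B : HyperkahlerBundle F M E pr)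

/-- The covector field with constant components `ℓ`. -/
def cov (ℓ : EuclideanSpace ℝ (Fin 3) →L[ℝ] ℝ) (y : Y) : TangentSpace (𝓡 3) y →L[ℝ] ℝ :=
  (ℓ ∘L coordDeriv (EuclideanSpace ℝ (Fin 3)) κ.base y : EuclideanSpace ℝ (Fin 3) →L[ℝ] ℝ)

/-- The components of a covector. -/
def covRep (y : Y) (α : TangentSpace (𝓡 3) y →L[ℝ] ℝ) : EuclideanSpace ℝ (Fin 3) →L[ℝ] ℝ :=
  (α : EuclideanSpace ℝ (Fin 3) →L[ℝ] ℝ) ∘L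
    coordDerivSymm (EuclideanSpace ℝ (Fin 3)) κ.base (κ.base y)

variable {κ B} {y : Y} {p : N}

theorem cov_covRep (hy : y ∈ κ.base.source) (α : TangentSpace (𝓡 3) y →L[ℝ] ℝ) :
    κ.cov (κ.covRep y α) y = α := by
  refine ContinuousLinearMap.ext fun v ↦ ?_
  exact congrArg α (κ.base_smooth.symm_deriv_deriv hy v)

theorem mvfderiv_comp_base (hy : y ∈ κ.base.source) (ℓ : EuclideanSpace ℝ (Fin 3) →L[ℝ] ℝ) :
    mvfderiv (𝓡 3) (fun y ↦ ℓ (κ.base y)) y = κ.cov ℓ y := by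
  have e : (fun y ↦ ℓ (κ.base y)) ∘ κ.base.symm =ᶠ[𝓝 (κ.base y)] ℓ := by
    filter_upwards [κ.base.open_target.mem_nhds (κ.base.map_source hy)] with x hx
    simp [κ.base.right_inv hx]
  refine ContinuousLinearMap.ext fun v ↦ ?_
  have h1 := κ.base_smooth.mvfderiv_eq hy (f := fun y ↦ ℓ (κ.base y))
    (e.differentiableAt_iff.2 ℓ.differentiableAt) v
  rw [e.fderiv_eq, ℓ.fderiv] at h1
  exact h1

theorem contMDiffAt_comp_base (hy : y ∈ κ.base.source) (ℓ : EuclideanSpace ℝ (Fin 3) →L[ℝ] ℝ) :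
    ContMDiffAt (𝓡 3) 𝓘(ℝ, ℝ) ∞ (fun y ↦ ℓ (κ.base y)) y :=
  ContMDiffAt.comp (g := ℓ) (f := κ.base) y ℓ.contDiff.contDiffAt.contMDiffAt
    (κ.base_smooth.contMDiffAt hy)

variable [FiniteDimensional ℝ F]

variable (κ B) in
/-- The Clifford action of the covector field with constant components `ℓ`, in coordinates. -/
def cliffRep (ℓ : EuclideanSpace ℝ (Fin 3) →L[ℝ] ℝ) (x : EuclideanSpace ℝ (Fin 3) × F) :
    F →L[ℝ] F :=
  LinearMap.toContinuousLinearMap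
    { toFun := fun a ↦ κ.fib (κ.total.symm x) (toModel
        (B.cliff (pr (κ.total.symm x)) (κ.cov ℓ _) ⟨κ.total.symm x, rfl⟩ (κ.vlift _ a)))
      map_add' := fun a b ↦ by rw [map_add, map_add, toModel_add, map_add]
      map_smul' := fun r a ↦ by rw [map_smul, map_smul, toModel_smul, map_smul]; rfl }

variable (κ B) in
theorem cliffRep_apply (ℓ : EuclideanSpace ℝ (Fin 3) →L[ℝ] ℝ) (x : EuclideanSpace ℝ (Fin 3) × F)
    (a : F) : κ.cliffRep B ℓ x a = κ.fib (κ.total.symm x) (toModel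
      (B.cliff (pr (κ.total.symm x)) (κ.cov ℓ _) ⟨κ.total.symm x, rfl⟩ (κ.vlift _ a))) := rfl

theorem cliffRep_add (ℓ ℓ' : EuclideanSpace ℝ (Fin 3) →L[ℝ] ℝ)
    (x : EuclideanSpace ℝ (Fin 3) × F) :
    κ.cliffRep B (ℓ + ℓ') x = κ.cliffRep B ℓ x + κ.cliffRep B ℓ' x := by
  ext a
  have : κ.cov (ℓ + ℓ') (pr (κ.total.symm x)) = κ.cov ℓ _ + κ.cov ℓ' _ :=
    ContinuousLinearMap.ext fun v ↦ rfl
  rw [add_apply, cliffRep_apply, this, (B.cliff _).map_add]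
  exact map_add (κ.fib _) _ _

theorem cliffRep_smul (r : ℝ) (ℓ : EuclideanSpace ℝ (Fin 3) →L[ℝ] ℝ)
    (x : EuclideanSpace ℝ (Fin 3) × F) :
    κ.cliffRep B (r • ℓ) x = r • κ.cliffRep B ℓ x := by
  ext a
  have : κ.cov (r • ℓ) (pr (κ.total.symm x)) = r • κ.cov ℓ _ :=
    ContinuousLinearMap.ext fun v ↦ rfl
  rw [smul_apply, cliffRep_apply, this, (B.cliff _).map_smul]
  exact map_smul (κ.fib _) _ _

/-- A covector at `y` is the value at `y` of the covector field with the same components, whose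
action is `cliffRep`. The same components serve for all points of the fibre over `y`. -/
theorem fib_cliff (q : Fib pr y) (hq : q.1 ∈ κ.total.source) (α : TangentSpace (𝓡 3) y →L[ℝ] ℝ)
    (u : VerticalSpace (E := E) pr q.1) :
    κ.fib q.1 (toModel (B.cliff y α q u)) =
      κ.cliffRep B (κ.covRep y α) (κ.total q.1) (κ.fib q.1 (toModel u)) := by
  obtain ⟨q, rfl⟩ := q
  rw [cliffRep_apply, κ.total.left_inv hq, κ.vlift_fib hq, cov_covRep (κ.pr_mem q hq)]

/-- The vertical field obtained from `X` by the action of the covector field with constant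
components `ℓ`. -/
def cliffField (κ : AdaptedChart F E pr) (B : HyperkahlerBundle F M E pr)
    (ℓ : EuclideanSpace ℝ (Fin 3) →L[ℝ] ℝ) (X : Π q : N, VerticalSpace (E := E) pr q) (q : N) :
    VerticalSpace (E := E) pr q :=
  B.cliff (pr q) (mvfderiv (𝓡 3) (fun y ↦ ℓ (κ.base y)) (pr q)) ⟨q, rfl⟩ (X q)

/-- Smoothness of the action is postulated for differentials of functions, and covector fields with
constant components are the differentials of `ℓ ∘ κ.base`. -/
theorem vsmoothAt_cliffField (hp : p ∈ κ.total.source) (ℓ : EuclideanSpace ℝ (Fin 3) →L[ℝ] ℝ)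
    {X : Π q : N, VerticalSpace (E := E) pr q} (hX : VSmoothAt X p) :
    VSmoothAt (κ.cliffField B ℓ X) p :=
  B.cliff_smooth p _ X (contMDiffAt_comp_base (κ.pr_mem p hp) ℓ) hX

theorem rep_cliffField {x : EuclideanSpace ℝ (Fin 3) × F} (hx : x ∈ κ.total.target)
    (ℓ : EuclideanSpace ℝ (Fin 3) →L[ℝ] ℝ) (X : Π q : N, VerticalSpace (E := E) pr q) :
    κ.rep (κ.cliffField B ℓ X) x = κ.cliffRep B ℓ x (κ.rep X x) := by
  have hq := κ.total.map_target hx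
  rw [rep, cliffField, mvfderiv_comp_base (κ.pr_mem _ hq), cliffRep_apply, rep, κ.vlift_fib hq]

theorem isImageOnFib_cliffField {y : Y} (hy : y ∈ κ.base.source)
    (ℓ : EuclideanSpace ℝ (Fin 3) →L[ℝ] ℝ) (X : Π q : N, VerticalSpace (E := E) pr q) :
    IsImageOnFib (B.cliff y (κ.cov ℓ y)) X (κ.cliffField B ℓ X) := by
  intro q
  rw [cliffField, B.cliff_mvfderiv_congr _ q, mvfderiv_comp_base hy]

theorem smooth_cliffRep (hp : p ∈ κ.total.source) (ℓ : EuclideanSpace ℝ (Fin 3) →L[ℝ] ℝ) :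
    ContDiffAt ℝ ∞ (κ.cliffRep B ℓ) (κ.total p) := by
  refine contDiffAt_clm_of_apply fun a ↦ ?_
  have h1 := (κ.vsmoothAt_iff hp).1 (vsmoothAt_cliffField (B := B) hp ℓ
    (κ.vsmoothAt_field hp (contDiffAt_const (c := a))))
  refine h1.congr_of_eventuallyEq ?_
  filter_upwards [κ.total.open_target.mem_nhds (κ.total.map_source hp)] with x hx
  rw [rep_cliffField hx, κ.rep_field hx]

end AdaptedChart

end CliffordCoordinates

/-! ### Product rules for the derivative along the fibre -/

section FibreCoordinates

variable {H : Type*} [NormedAddCommGroup H] [NormedSpace ℝ H]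
  {F : Type*} [NormedAddCommGroup F] [NormedSpace ℝ F]
  {V V' : Type*} [NormedAddCommGroup V] [NormedSpace ℝ V] [NormedAddCommGroup V'] [NormedSpace ℝ V']

theorem fibreDeriv_clm_apply {T : H × F → V →L[ℝ] V'} {u : H × F → V} {x : H × F}
    (hT : DifferentiableAt ℝ T x) (hu : DifferentiableAt ℝ u x) (a : F) :
    fibreDeriv (fun y ↦ T y (u y)) x a = fibreDeriv T x a (u x) + T x (fibreDeriv u x a) := by
  rw [fibreDeriv_apply, (hT.hasFDerivAt.clm_apply hu.hasFDerivAt).fderiv]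
  simp [fibreDeriv_apply, add_comm]

theorem fibreDeriv_const (v : V) (x : H × F) (a : F) : fibreDeriv (fun _ ↦ v) x a = 0 := by
  rw [fibreDeriv_apply, fderiv_fun_const]
  rfl

theorem Filter.EventuallyEq.fibreDeriv_eq {f f' : H × F → V} {x : H × F} (h : f =ᶠ[𝓝 x] f') :
    fibreDeriv f x = fibreDeriv f' x := by
  rw [fibreDeriv, fibreDeriv, h.fderiv_eq]

end FibreCoordinates

/-! ### The Clifford action is parallel along the fibres -/

section CliffordCoordinates

variable {Y : Type*} [TopologicalSpace Y] [ChartedSpace (EuclideanSpace ℝ (Fin 3)) Y]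
  [IsManifold (𝓡 3) ∞ Y] [RiemannianBundle (fun y : Y ↦ TangentSpace (𝓡 3) y)]
  {E : Type*} [NormedAddCommGroup E] [NormedSpace ℝ E] [FiniteDimensional ℝ E]
  {N : Type*} [TopologicalSpace N] [ChartedSpace E N] [IsManifold 𝓘(ℝ, E) ∞ N]
  {F : Type*} [NormedAddCommGroup F] [NormedSpace ℝ F] [FiniteDimensional ℝ F]
  {M : Type*} [TopologicalSpace M] [ChartedSpace F M]
  {pr : N → Y}

namespace AdaptedChart

variable {κ : AdaptedChart F E pr} {B : HyperkahlerBundle F M E pr} {p : N}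

/-- Near a chart point, the slice with fixed first component consists of points of one fibre. This
is how identities on the fibre become hypotheses of `fibreDeriv_congr`. -/
theorem eventually_pr_eq (hp : p ∈ κ.total.source) :
    ∀ᶠ x in 𝓝 (κ.total p), x.1 = (κ.total p).1 →
      ∃ q : Fib pr (pr p), q.1 ∈ κ.total.source ∧ κ.total q.1 = x := by
  filter_upwards [κ.total.open_target.mem_nhds (κ.total.map_source hp)] with x hx h1
  have hq := κ.total.map_target hx
  have hr := κ.total.right_inv hx
  refine ⟨⟨κ.total.symm x, κ.base.injOn (κ.pr_mem _ hq) (κ.pr_mem _ hp) ?_⟩, hq, hr⟩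
  rw [← κ.fst_total _ hq, ← κ.fst_total _ hp, hr, h1]

/-- A Kähler complex structure of the Clifford action is parallel along the fibre. -/
theorem cliffRep_parallel_of_kahler (hp : p ∈ κ.total.source)
    (α : TangentSpace (𝓡 3) (pr p) →L[ℝ] ℝ)
    (hα : IsKahlerOnFib B.metric (pr p) (B.cliff (pr p) α)) (a b : F) :
    fibreDeriv (κ.cliffRep B (κ.covRep (pr p) α)) (κ.total p) a b +
        christoffel (κ.metric B.metric) (κ.total p) a
          (κ.cliffRep B (κ.covRep (pr p) α) (κ.total p) b) =
      κ.cliffRep B (κ.covRep (pr p) α) (κ.total p)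
        (christoffel (κ.metric B.metric) (κ.total p) a b) := by
  set ℓ := κ.covRep (pr p) α with hℓ
  have hm := isMetricAt (g := B.metric) hp
  have hy := κ.pr_mem p hp
  have dG : DifferentiableAt ℝ (κ.metric B.metric) (κ.total p) :=
    hm.smooth.differentiableAt (by simp)
  have dJ : DifferentiableAt ℝ (κ.cliffRep B ℓ) (κ.total p) :=
    (smooth_cliffRep hp ℓ).differentiableAt (by simp)
  have dJa : ∀ a, DifferentiableAt ℝ (fun x ↦ κ.cliffRep B ℓ x a) (κ.total p) := fun a ↦
    dJ.clm_apply (differentiableAt_const a)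
  have hJ : ∀ (q : Fib pr (pr p)), q.1 ∈ κ.total.source → ∀ a,
      κ.cliffRep B ℓ (κ.total q.1) a = κ.fib q.1 (toModel (B.cliff (pr p) α q (κ.vlift q.1 a))) := by
    intro q hq a
    rw [fib_cliff q hq, κ.fib_vlift hq]
  have sq : ∀ (q : Fib pr (pr p)), q.1 ∈ κ.total.source → ∀ a,
      κ.cliffRep B ℓ (κ.total q.1) (κ.cliffRep B ℓ (κ.total q.1) a) = -a := by
    intro q hq a
    rw [hJ q hq a, ← fib_cliff q hq, hα.sq, toModel_neg, map_neg, κ.fib_vlift hq]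
  have orth : ∀ (q : Fib pr (pr p)), q.1 ∈ κ.total.source → ∀ a b,
      κ.metric B.metric (κ.total q.1) (κ.cliffRep B ℓ (κ.total q.1) a)
        (κ.cliffRep B ℓ (κ.total q.1) b) = κ.metric B.metric (κ.total q.1) a b := by
    intro q hq a b
    rw [hJ q hq a, hJ q hq b, ← inner_eq hq, hα.orthogonal, inner_eq hq, κ.fib_vlift hq,
      κ.fib_vlift hq]
  -- The Nijenhuis and closedness identities are evaluated on fields with constant components. Their
  -- mutual brackets vanish, and only fibre derivatives of `J` and of the metric survive.
  let X : F → Π q : N, VerticalSpace (E := E) pr q := fun a ↦ κ.field fun _ ↦ a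
  let X' : F → Π q : N, VerticalSpace (E := E) pr q := fun a ↦ κ.cliffField B ℓ (X a)
  have sX : ∀ a, VSmoothAt (X a) p := fun a ↦ κ.vsmoothAt_field hp contDiffAt_const
  have sX' : ∀ a, VSmoothAt (X' a) p := fun a ↦ vsmoothAt_cliffField hp ℓ (sX a)
  have im : ∀ a, IsImageOnFib (B.cliff (pr p) α) (X a) (X' a) := fun a ↦ by
    have := isImageOnFib_cliffField (B := B) hy ℓ (X a)
    rwa [hℓ, cov_covRep hy] at this
  have rX : ∀ a, κ.rep (X a) =ᶠ[𝓝 (κ.total p)] fun _ ↦ a := fun a ↦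
    κ.rep_field_eventuallyEq hp _
  have rX' : ∀ a, κ.rep (X' a) =ᶠ[𝓝 (κ.total p)] fun x ↦ κ.cliffRep B ℓ x a := by
    intro a
    filter_upwards [κ.total.open_target.mem_nhds (κ.total.map_source hp)] with x hx
    rw [rep_cliffField hx, κ.rep_field hx]
  have dX : ∀ a c, fibreDeriv (κ.rep (X a)) (κ.total p) c = 0 := fun a c ↦ by
    rw [(rX a).fibreDeriv_eq, fibreDeriv_const]
  have dX' : ∀ a c, fibreDeriv (κ.rep (X' a)) (κ.total p) c =
      fibreDeriv (κ.cliffRep B ℓ) (κ.total p) c a := fun a c ↦ by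
    rw [(rX' a).fibreDeriv_eq, fibreDeriv_clm_apply dJ (differentiableAt_const a),
      fibreDeriv_const, map_zero, add_zero]
  have fX : ∀ a, κ.fib p (toModel (X a p)) = a := fun a ↦ by
    rw [← κ.rep_total hp, (rX a).self_of_nhds]
  have br : ∀ a b, κ.fib p (toModel (vBracket (X a) (X b) p)) = 0 := fun a b ↦ by
    rw [κ.fib_vBracket hp (sX a) (sX b), dX, dX, sub_zero]
  have fc : ∀ u : VerticalSpace (E := E) pr p, κ.fib p (toModel (B.cliff (pr p) α ⟨p, rfl⟩ u)) =
      κ.cliffRep B ℓ (κ.total p) (κ.fib p (toModel u)) := fun u ↦ fib_cliff ⟨p, rfl⟩ hp α u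
  have dω : ∀ u b c, vDeriv (X u p) (fun q ↦ B.metric.inner q (X' b q) (X c q)) =
      fibreDeriv (κ.metric B.metric) (κ.total p) u (κ.cliffRep B ℓ (κ.total p) b) c +
        κ.metric B.metric (κ.total p) (fibreDeriv (κ.cliffRep B ℓ) (κ.total p) u b) c := by
    intro u b c
    have e : (fun x ↦ κ.metric B.metric x (κ.rep (X' b) x) (κ.rep (X c) x)) =ᶠ[𝓝 (κ.total p)]
        fun x ↦ κ.metric B.metric x (κ.cliffRep B ℓ x b) c := by
      filter_upwards [rX' b, rX c] with x h1 h2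
      rw [h1, h2]
    rw [vDeriv_inner hp _ (sX' b) (sX c), e.fibreDeriv_eq, fX,
      fibreDeriv_clm_apply (dG.clm_apply (dJa b)) (differentiableAt_const c),
      fibreDeriv_clm_apply dG (dJa b), fibreDeriv_clm_apply dJ (differentiableAt_const b)]
    simp [fibreDeriv_const]
  refine hm.christoffel_comp_kahler (J := κ.cliffRep B ℓ) (sq ⟨p, rfl⟩ hp) (fun c a ↦ ?_)
    (orth ⟨p, rfl⟩ hp) (fun c a b ↦ ?_) (fun a b ↦ ?_) (fun a b c ↦ ?_) a b
  · have h1 := fibreDeriv_congr (f := fun x ↦ κ.cliffRep B ℓ x (κ.cliffRep B ℓ x a))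
      (f' := fun _ ↦ -a) (dJ.clm_apply (dJa a)) (differentiableAt_const _)
      (by filter_upwards [eventually_pr_eq hp] with x hx h1
          obtain ⟨q, hq, rfl⟩ := hx h1
          exact sq q hq a) c
    rw [fibreDeriv_const, fibreDeriv_clm_apply dJ (dJa a),
      fibreDeriv_clm_apply dJ (differentiableAt_const a), fibreDeriv_const, map_zero,
      add_zero] at h1
    exact h1
  · have h1 := fibreDeriv_congr
      (f := fun x ↦ κ.metric B.metric x (κ.cliffRep B ℓ x a) (κ.cliffRep B ℓ x b))
      (f' := fun x ↦ κ.metric B.metric x a b) ((dG.clm_apply (dJa a)).clm_apply (dJa b))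
      ((dG.clm_apply (differentiableAt_const _)).clm_apply (differentiableAt_const _))
      (by filter_upwards [eventually_pr_eq hp] with x hx h1
          obtain ⟨q, hq, rfl⟩ := hx h1
          exact orth q hq a b) c
    rw [fibreDeriv_clm_apply (dG.clm_apply (dJa a)) (dJa b), fibreDeriv_clm_apply dG (dJa a),
      fibreDeriv_clm_apply dJ (differentiableAt_const a),
      fibreDeriv_clm_apply dJ (differentiableAt_const b),
      fibreDeriv_clm_apply (dG.clm_apply (differentiableAt_const a)) (differentiableAt_const b),
      fibreDeriv_clm_apply dG (differentiableAt_const a)] at h1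
    simpa [fibreDeriv_const] using h1
  · have h1 := congrArg (fun u ↦ κ.fib p (toModel u)) (hα.integrable ⟨p, rfl⟩ _ _ _ _ (sX a)
      (sX' a) (sX b) (sX' b) (im a) (im b))
    simp only [toModel_sub, toModel_zero, map_sub, map_zero, fc, br,
      κ.fib_vBracket hp (sX' a) (sX' b), κ.fib_vBracket hp (sX' a) (sX b),
      κ.fib_vBracket hp (sX a) (sX' b), dX, dX', (rX a).self_of_nhds, (rX b).self_of_nhds,
      (rX' a).self_of_nhds, (rX' b).self_of_nhds] at h1
    simpa using h1
  · have h1 := hα.closed ⟨p, rfl⟩ _ _ _ _ _ (sX a) (sX' a) (sX b) (sX' b) (sX c) (im a) (im b)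
    simp only [dω, inner_eq hp, fc, br, map_zero, zero_apply] at h1
    linarith

/-- The Clifford action is parallel along the fibres. -/
theorem cliffRep_parallel (hp : p ∈ κ.total.source) (ℓ : EuclideanSpace ℝ (Fin 3) →L[ℝ] ℝ)
    (a b : F) :
    fibreDeriv (κ.cliffRep B ℓ) (κ.total p) a b +
        christoffel (κ.metric B.metric) (κ.total p) a (κ.cliffRep B ℓ (κ.total p) b) =
      κ.cliffRep B ℓ (κ.total p) (christoffel (κ.metric B.metric) (κ.total p) a b) := by
  obtain ⟨e, he⟩ := B.hyperkahler (pr p)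
  have h0 := cliffRep_parallel_of_kahler hp _ he.kahler_I a b
  have h1 := cliffRep_parallel_of_kahler hp _ he.kahler_J a b
  have h2 := cliffRep_parallel_of_kahler hp _ he.kahler_K a b
  -- The coefficients are those of `ℓ` in the hyperkähler coframe at `pr p`, extended with constant
  -- components. The resulting identity between the operators holds throughout the chart, and the
  -- equation to prove is linear in the operator.
  obtain ⟨r, hr⟩ : ∃ r : Fin 3 → ℝ, ℓ = r 0 • κ.covRep (pr p) (innerSL ℝ (e 0)) +
      r 1 • κ.covRep (pr p) (innerSL ℝ (e 1)) + r 2 • κ.covRep (pr p) (innerSL ℝ (e 2)) := by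
    have h := covector_eq_sum_innerSL e (κ.cov ℓ (pr p))
    refine ⟨fun i ↦ κ.cov ℓ (pr p) (e i), ContinuousLinearMap.ext fun v ↦ ?_⟩
    have h3 := congrArg (fun T : TangentSpace (𝓡 3) (pr p) →L[ℝ] ℝ ↦ T
      (coordDerivSymm (EuclideanSpace ℝ (Fin 3)) κ.base (κ.base (pr p)) v)) h
    refine Eq.trans ?_ h3
    exact (congrArg ℓ (κ.base_smooth.deriv_symm_deriv (κ.pr_mem p hp) v)).symm
  have hJ : κ.cliffRep B ℓ = fun x ↦
      r 0 • κ.cliffRep B (κ.covRep (pr p) (innerSL ℝ (e 0))) x +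
      r 1 • κ.cliffRep B (κ.covRep (pr p) (innerSL ℝ (e 1))) x +
      r 2 • κ.cliffRep B (κ.covRep (pr p) (innerSL ℝ (e 2))) x := by
    funext x
    rw [hr, cliffRep_add, cliffRep_add, cliffRep_smul, cliffRep_smul, cliffRep_smul]
  have dJ : ∀ ℓ, DifferentiableAt ℝ (κ.cliffRep B ℓ) (κ.total p) := fun ℓ ↦
    (smooth_cliffRep hp ℓ).differentiableAt (by simp)
  have hd := (((dJ (κ.covRep (pr p) (innerSL ℝ (e 0)))).hasFDerivAt.fun_const_smul (r 0)).fun_add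
    ((dJ (κ.covRep (pr p) (innerSL ℝ (e 1)))).hasFDerivAt.fun_const_smul (r 1))).fun_add
      ((dJ (κ.covRep (pr p) (innerSL ℝ (e 2)))).hasFDerivAt.fun_const_smul (r 2))
  rw [hJ, fibreDeriv_apply, hd.fderiv]
  rw [fibreDeriv_apply] at h0 h1 h2
  simp only [add_apply, smul_apply, map_add, map_smul, ← h0, ← h1, ← h2]
  module

end AdaptedChart

end CliffordCoordinates

/-! ### Differentiating a family of derivatives -/

section Calculus

variable {H W V : Type*} [NormedAddCommGroup H] [NormedSpace ℝ H]
  [NormedAddCommGroup W] [NormedSpace ℝ W] [NormedAddCommGroup V] [NormedSpace ℝ V]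

/-- The derivative at `t = 0` of `T(f_t(x)) (Df_t(x) h)`, for a smooth family of maps `f_t`. -/
theorem hasDerivAt_apply_fderiv_of_family {f : ℝ × H → W} {T : W → W →L[ℝ] V} {x : H} {S w : H → W}
    (hf : ContDiffAt ℝ ∞ f (0, x)) (hS : ∀ h, f (0, h) = S h)
    (hw : ∀ᶠ h in 𝓝 x, deriv (fun t ↦ f (t, h)) 0 = w h) (hT : DifferentiableAt ℝ T (S x)) (h : H) :
    HasDerivAt (fun t ↦ T (f (t, x)) (fderiv ℝ (fun z ↦ f (t, z)) x h))
      (fderiv ℝ T (S x) (w x) (fderiv ℝ S x h) + T (S x) (fderiv ℝ w x h)) 0 := by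
  have hev : ∀ᶠ z in 𝓝 ((0 : ℝ), x), DifferentiableAt ℝ f z := by
    have := (hf.of_le (m := 1) ENat.LEInfty.out).eventually (by simp)
    filter_upwards [this] with z hz using hz.differentiableAt (by simp)
  have hd2 : DifferentiableAt ℝ (fderiv ℝ f) (0, x) :=
    (hf.fderiv_right (m := ∞) (by simp)).differentiableAt (by simp)
  have c1 : HasDerivAt (fun t : ℝ ↦ (t, x)) (1, 0) 0 :=
    (hasDerivAt_id (0 : ℝ)).prodMk (hasDerivAt_const _ _)
  have c2 : ∀ (t : ℝ) (z : H), HasFDerivAt (fun z : H ↦ (t, z)) (ContinuousLinearMap.inr ℝ ℝ H) z :=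
    fun t z ↦ hasFDerivAt_prodMk_right t z
  have e1 : ∀ᶠ t in 𝓝 (0 : ℝ), fderiv ℝ (fun z ↦ f (t, z)) x h = fderiv ℝ f (t, x) (0, h) := by
    filter_upwards [c1.continuousAt.eventually hev] with t ht
    exact congrArg (fun L : H →L[ℝ] W ↦ L h) (ht.hasFDerivAt.comp x (c2 t x)).fderiv
  have e2 : ∀ᶠ z in 𝓝 x, fderiv ℝ f (0, z) (1, 0) = w z := by
    filter_upwards [(c2 0 x).continuousAt.eventually hev, hw] with z hz hz'
    rw [← hz']
    have : HasDerivAt (fun t : ℝ ↦ (t, z)) (1, 0) 0 :=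
      (hasDerivAt_id (0 : ℝ)).prodMk (hasDerivAt_const _ _)
    exact (hz.hasFDerivAt.comp_hasDerivAt (0 : ℝ) this).deriv.symm
  have d0 : DifferentiableAt ℝ f (0, x) := hf.differentiableAt (by simp)
  have dT : HasDerivAt (fun t ↦ T (f (t, x))) (fderiv ℝ T (S x) (w x)) 0 := by
    have h1 := d0.hasFDerivAt.comp_hasDerivAt (0 : ℝ) c1
    rw [e2.self_of_nhds] at h1
    rw [← hS] at hT ⊢
    exact hT.hasFDerivAt.comp_hasDerivAt (0 : ℝ) h1
  -- Here the velocity must be known near `x` and not only at `x`, since it is differentiated in the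
  -- space direction.
  have dw : fderiv ℝ w x h = fderiv ℝ (fderiv ℝ f) (0, x) (0, h) (1, 0) := by
    have h1 : HasFDerivAt (fun z : H ↦ fderiv ℝ f (0, z))
        (fderiv ℝ (fderiv ℝ f) (0, x) ∘L ContinuousLinearMap.inr ℝ ℝ H) x :=
      hd2.hasFDerivAt.comp x (c2 0 x)
    have h2 : (fun z ↦ fderiv ℝ f (0, z) (1, 0)) =ᶠ[𝓝 x] w := e2
    rw [← h2.fderiv_eq, fderiv_clm_apply h1.differentiableAt (differentiableAt_const _), h1.fderiv]
    simp
  have dS : fderiv ℝ S x h = fderiv ℝ f (0, x) (0, h) := by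
    rw [← e1.self_of_nhds, funext hS]
  have dd : HasDerivAt (fun t ↦ fderiv ℝ (fun z ↦ f (t, z)) x h) (fderiv ℝ w x h) 0 := by
    have h0 : HasDerivAt (fun t : ℝ ↦ fderiv ℝ f (t, x)) (fderiv ℝ (fderiv ℝ f) (0, x) (1, 0)) 0 :=
      hd2.hasFDerivAt.comp_hasDerivAt (0 : ℝ) c1
    have h1 := h0.clm_apply (hasDerivAt_const (0 : ℝ) ((0 : ℝ), h))
    refine (h1.congr_deriv ?_).congr_of_eventuallyEq e1
    -- Symmetry of the second derivative exchanges `d/dt` with the derivative in `x`.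
    rw [dw, (hf.isSymmSndFDerivAt (by simpa using ENat.LEInfty.out)).eq, map_zero, add_zero]
  refine (dT.clm_apply dd).congr_deriv ?_
  simp only [hS]

end Calculus

/-! ### Ehresmann connections and sections in coordinates -/

section ConnectionCoordinates

variable {Y : Type*} [TopologicalSpace Y] [ChartedSpace (EuclideanSpace ℝ (Fin 3)) Y]
  [IsManifold (𝓡 3) ∞ Y]
  {E : Type*} [NormedAddCommGroup E] [NormedSpace ℝ E] [FiniteDimensional ℝ E]
  {N : Type*} [TopologicalSpace N] [ChartedSpace E N] [IsManifold 𝓘(ℝ, E) ∞ N]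
  {F : Type*} [NormedAddCommGroup F] [NormedSpace ℝ F] [FiniteDimensional ℝ F]
  {pr : N → Y}

namespace AdaptedChart

variable (κ : AdaptedChart F E pr) (A : EhresmannConnection E pr)

/-- The vertical projection in coordinates. -/
def projRep (x : EuclideanSpace ℝ (Fin 3) × F) : EuclideanSpace ℝ (Fin 3) × F →L[ℝ] F :=
  LinearMap.toContinuousLinearMap
    { toFun := fun w ↦ κ.fib (κ.total.symm x) (toModel
        (A.proj (κ.total.symm x) (coordDerivSymm E κ.total x w)))
      map_add' := fun a b ↦
        (congrArg (fun e : E ↦ κ.fib (κ.total.symm x) (toModel (A.proj (κ.total.symm x) e)))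
          (map_add (coordDerivSymm E κ.total x) a b)).trans
        ((congrArg (fun e ↦ κ.fib (κ.total.symm x) (toModel e))
          (map_add (A.proj (κ.total.symm x)) _ _)).trans (map_add (κ.fib _) _ _))
      map_smul' := fun r a ↦
        (congrArg (fun e : E ↦ κ.fib (κ.total.symm x) (toModel (A.proj (κ.total.symm x) e)))
          (map_smul (coordDerivSymm E κ.total x) r a)).trans
        ((congrArg (fun e ↦ κ.fib (κ.total.symm x) (toModel e))
          (map_smul (A.proj (κ.total.symm x)) _ _)).trans (map_smul (κ.fib _) _ _)) }

theorem projRep_apply (x w : EuclideanSpace ℝ (Fin 3) × F) :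
    κ.projRep A x w = κ.fib (κ.total.symm x) (toModel
      (A.proj (κ.total.symm x) (coordDerivSymm E κ.total x w))) := rfl

variable {κ A} {p : N} {y : Y}

theorem fib_proj (hp : p ∈ κ.total.source) (e : E) :
    κ.fib p (toModel (A.proj p e)) = κ.projRep A (κ.total p) (coordDeriv E κ.total p e) := by
  rw [projRep_apply, κ.total_smooth.symm_deriv_deriv hp, κ.total.left_inv hp]

theorem projRep_vertical (hp : p ∈ κ.total.source) (a : F) :
    κ.projRep A (κ.total p) (0, a) = a := by
  have h1 := fib_proj (A := A) hp (toModel (κ.vlift p a))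
  rw [κ.coordDeriv_toModel hp, κ.fib_vlift hp] at h1
  rw [← h1]
  exact (congrArg (fun u ↦ κ.fib p (toModel u)) (A.proj_vertical p _)).trans (κ.fib_vlift hp a)

/-- The smoothness condition on the connection is applied to tangent fields with constant coordinate
components. -/
theorem smooth_projRep (hp : p ∈ κ.total.source) : ContDiffAt ℝ ∞ (κ.projRep A) (κ.total p) := by
  refine contDiffAt_clm_of_apply fun w ↦ ?_
  let X : Π q : N, TangentSpace 𝓘(ℝ, E) q := fun q ↦ coordDerivSymm E κ.total (κ.total q) w
  have hX : ContMDiffAt 𝓘(ℝ, E) 𝓘(ℝ, E).tangent ∞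
      (fun q ↦ (⟨q, X q⟩ : TangentBundle 𝓘(ℝ, E) N)) p := by
    refine (κ.total_smooth.contMDiffAt_tangent_iff (f := id)
      (w := fun q ↦ coordDerivSymm E κ.total (κ.total q) w) hp).2 ⟨contMDiffAt_id, ?_⟩
    refine (contMDiffAt_const (c := w)).congr_of_eventuallyEq ?_
    filter_upwards [κ.total.open_source.mem_nhds hp] with q hq
      using κ.total_smooth.deriv_symm_deriv hq w
  refine ((κ.vsmoothAt_iff hp).1 (A.smooth p X hX)).congr_of_eventuallyEq ?_
  filter_upwards [κ.total.open_target.mem_nhds (κ.total.map_source hp)] with x hx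
  rw [projRep_apply, rep]
  simp only [X, κ.total.right_inv hx]

theorem fderiv_coord_section {s : Y → N} (hs : MDifferentiableAt (𝓡 3) 𝓘(ℝ, E) s y)
    (hy : y ∈ κ.base.source) (hsy : s y ∈ κ.total.source) (v : EuclideanSpace ℝ (Fin 3)) :
    fderiv ℝ (fun x ↦ κ.total (s (κ.base.symm x))) (κ.base y)
        (coordDeriv (EuclideanSpace ℝ (Fin 3)) κ.base y v) =
      coordDeriv E κ.total (s y) (mfderiv (𝓡 3) 𝓘(ℝ, E) s y v) := by
  have hb := κ.base.left_inv hy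
  have d1 : MDifferentiableAt (𝓡 3) 𝓘(ℝ, EuclideanSpace ℝ (Fin 3) × F) (κ.total ∘ s) y :=
    (κ.total_smooth.mdifferentiableAt hsy).comp y hs
  have d2 : MDifferentiableAt 𝓘(ℝ, EuclideanSpace ℝ (Fin 3))
      𝓘(ℝ, EuclideanSpace ℝ (Fin 3) × F) ((κ.total ∘ s) ∘ κ.base.symm) (κ.base y) :=
    MDifferentiableAt.comp (g := κ.total ∘ s) (f := κ.base.symm) (κ.base y) (by rwa [hb])
      (κ.base_smooth.mdifferentiableAt_symm (κ.base.map_source hy))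
  have e : κ.total ∘ s =ᶠ[𝓝 y] ((κ.total ∘ s) ∘ κ.base.symm) ∘ κ.base := by
    filter_upwards [κ.base.open_source.mem_nhds hy] with z hz
    simp [κ.base.left_inv hz]
  have h1 := mfderiv_comp y d2 (κ.base_smooth.mdifferentiableAt hy)
  rw [← e.mfderiv_eq, mfderiv_comp y (κ.total_smooth.mdifferentiableAt hsy) hs,
    mfderiv_eq_fderiv] at h1
  exact (congrArg (fun L : EuclideanSpace ℝ (Fin 3) →L[ℝ] EuclideanSpace ℝ (Fin 3) × F ↦ L v)
    h1).symm

theorem fib_covDeriv {s : Y → N} (hs : MDifferentiableAt (𝓡 3) 𝓘(ℝ, E) s y)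
    (hy : y ∈ κ.base.source) (hsy : s y ∈ κ.total.source) (v : TangentSpace (𝓡 3) y) :
    κ.fib (s y) (toModel (A.covDeriv s y v)) = κ.projRep A (κ.total (s y))
      (fderiv ℝ (fun x ↦ κ.total (s (κ.base.symm x))) (κ.base y)
        (coordDeriv (EuclideanSpace ℝ (Fin 3)) κ.base y v)) :=
  (fib_proj hsy _).trans (congrArg _ (fderiv_coord_section hs hy hsy v).symm)

variable (κ) in
/-- A section of the total space in coordinates. -/
def sec (φ : FibSection E pr) (x : EuclideanSpace ℝ (Fin 3)) : EuclideanSpace ℝ (Fin 3) × F :=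
  κ.total (φ.toFun (κ.base.symm x))

variable (κ) in
/-- A section of the pulled back vertical bundle in coordinates. -/
def alongRep (φ : FibSection E pr) (ψ : φ.Along) (x : EuclideanSpace ℝ (Fin 3)) : F :=
  κ.fib (φ.toFun (κ.base.symm x)) (toModel (ψ (κ.base.symm x)))

section

variable {φ : FibSection E pr} {ψ : φ.Along}

theorem mem_base (hy : φ.toFun y ∈ κ.total.source) : y ∈ κ.base.source := by
  have := κ.pr_mem _ hy
  rwa [φ.isSection] at this

theorem sec_base (hy : y ∈ κ.base.source) : κ.sec φ (κ.base y) = κ.total (φ.toFun y) := by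
  rw [sec, κ.base.left_inv hy]

theorem alongRep_base (hy : y ∈ κ.base.source) :
    κ.alongRep φ ψ (κ.base y) = κ.fib (φ.toFun y) (toModel (ψ y)) := by
  rw [alongRep, κ.base.left_inv hy]

theorem smooth_sec (hy : φ.toFun y ∈ κ.total.source) :
    ContDiffAt ℝ ∞ (κ.sec φ) (κ.base y) :=
  (κ.base_smooth.contMDiffAt_iff_contDiffAt (mem_base hy)
    (f := fun y ↦ κ.total (φ.toFun y))).1
    ((κ.total_smooth.contMDiffAt hy).comp y (φ.smooth y))

theorem smoothAlong_iff_at (hy : φ.toFun y ∈ κ.total.source) :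
    ContMDiffAt (𝓡 3) 𝓘(ℝ, E).tangent ∞ (fun y ↦ (⟨φ.toFun y,
      (ψ y : TangentSpace 𝓘(ℝ, E) (φ.toFun y))⟩ : TangentBundle 𝓘(ℝ, E) N)) y ↔
    ContDiffAt ℝ ∞ (κ.alongRep φ ψ) (κ.base y) :=
  (κ.contMDiffAt_vertical_iff (φ.smooth y) hy).trans
    (κ.base_smooth.contMDiffAt_iff_contDiffAt (mem_base hy))

end

end AdaptedChart

end ConnectionCoordinates

/-! ### The linearized connection in coordinates -/

section Linearization

variable {Y : Type*} [TopologicalSpace Y] [ChartedSpace (EuclideanSpace ℝ (Fin 3)) Y]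
  [IsManifold (𝓡 3) ∞ Y]
  {E : Type*} [NormedAddCommGroup E] [NormedSpace ℝ E] [FiniteDimensional ℝ E]
  {N : Type*} [TopologicalSpace N] [ChartedSpace E N] [IsManifold 𝓘(ℝ, E) ∞ N]
  {F : Type*} [NormedAddCommGroup F] [NormedSpace ℝ F] [FiniteDimensional ℝ F]
  {pr : N → Y} (κ : AdaptedChart F E pr) (g : VerticalMetric E pr) (A : EhresmannConnection E pr)
  (φ : FibSection E pr) (ψ : φ.Along)

namespace AdaptedChart

/-- The connection `L_φ ∇` in coordinates. -/
def linRep (x : EuclideanSpace ℝ (Fin 3)) : EuclideanSpace ℝ (Fin 3) →L[ℝ] F :=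
  -- The first term comes from varying the derivative of the section, the second from varying the
  -- point at which the projection is taken, and the Christoffel term from parallel transport.
  fderiv ℝ (κ.alongRep φ ψ) x +
    (fibreDeriv (κ.projRep A) (κ.sec φ x) (κ.alongRep φ ψ x) +
      christoffel (κ.metric g) (κ.sec φ x) (κ.alongRep φ ψ x) ∘L κ.projRep A (κ.sec φ x)) ∘L
    fderiv ℝ (κ.sec φ) x

/-- The connection `L_φ ∇` computed in an adapted chart. -/
def linNabla (y : Y) : TangentSpace (𝓡 3) y →ₗ[ℝ] VerticalSpace (E := E) pr (φ.toFun y) :=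
  κ.vlift (φ.toFun y) ∘ₗ (κ.linRep g A φ ψ (κ.base y) ∘L
    coordDeriv (EuclideanSpace ℝ (Fin 3)) κ.base y : EuclideanSpace ℝ (Fin 3) →L[ℝ] F).toLinearMap

variable {κ g A φ ψ} {y : Y}

theorem fib_linNabla (hy : φ.toFun y ∈ κ.total.source) (v : TangentSpace (𝓡 3) y) :
    κ.fib (φ.toFun y) (toModel (κ.linNabla g A φ ψ y v)) =
      κ.linRep g A φ ψ (κ.base y) (coordDeriv (EuclideanSpace ℝ (Fin 3)) κ.base y v) :=
  κ.fib_vlift hy _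

theorem smooth_linRep (hy : φ.toFun y ∈ κ.total.source)
    (hψ : ContDiffAt ℝ ∞ (κ.alongRep φ ψ) (κ.base y)) :
    ContDiffAt ℝ ∞ (κ.linRep g A φ ψ) (κ.base y) := by
  have h1 := smooth_sec hy
  have h2 := smooth_projRep (A := A) hy
  have h3 := (isMetricAt (g := g) hy).smooth_christoffel
  rw [← sec_base (mem_base hy)] at h2 h3
  have d1 := hψ.fderiv_right (m := ∞) (by simp)
  have d2 := h1.fderiv_right (m := ∞) (by simp)
  have c1 := (h2.fibreDeriv.comp _ h1).clm_apply hψ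
  have c2 := (h3.comp _ h1).clm_apply hψ
  exact d1.add ((c1.add (c2.clm_comp (h2.comp _ h1))).clm_comp d2)

variable {Φ : Variation φ}

theorem _root_.Variation.contMDiffAt (Φ : Variation φ) {t : ℝ} (ht : t ∈ Set.Ioo (-Φ.ε) Φ.ε) (y : Y) :
    ContMDiffAt (𝓘(ℝ, ℝ).prod (𝓡 3)) 𝓘(ℝ, E) ∞ (fun z : ℝ × Y ↦ Φ.curve z.1 z.2) (t, y) :=
  (Φ.smooth (t, y) ⟨ht, trivial⟩).contMDiffAt
    ((isOpen_Ioo.prod isOpen_univ).mem_nhds ⟨ht, trivial⟩)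

theorem _root_.Variation.zero_mem (Φ : Variation φ) : (0 : ℝ) ∈ Set.Ioo (-Φ.ε) Φ.ε :=
  ⟨neg_lt_zero.2 Φ.ε_pos, Φ.ε_pos⟩

theorem _root_.Variation.contMDiffAt_curve (Φ : Variation φ) (y : Y) :
    ContMDiffAt 𝓘(ℝ, ℝ) 𝓘(ℝ, E) ∞ (fun t ↦ Φ.curve t y) 0 :=
  ContMDiffAt.comp (g := fun z : ℝ × Y ↦ Φ.curve z.1 z.2) (f := fun t : ℝ ↦ (t, y)) (0 : ℝ)
    (Φ.contMDiffAt Φ.zero_mem y) (contMDiffAt_id.prodMk contMDiffAt_const)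

theorem _root_.Variation.contMDiffAt_section (Φ : Variation φ) {t : ℝ}
    (ht : t ∈ Set.Ioo (-Φ.ε) Φ.ε) (y : Y) : ContMDiffAt (𝓡 3) 𝓘(ℝ, E) ∞ (Φ.curve t) y :=
  ContMDiffAt.comp (g := fun z : ℝ × Y ↦ Φ.curve z.1 z.2) (f := fun y ↦ (t, y)) y
    (Φ.contMDiffAt ht y) (contMDiffAt_const.prodMk contMDiffAt_id)

theorem eventually_curve_mem (Φ : Variation φ) (hy : φ.toFun y ∈ κ.total.source) :
    ∀ᶠ t in 𝓝 (0 : ℝ), t ∈ Set.Ioo (-Φ.ε) Φ.ε ∧ Φ.curve t y ∈ κ.total.source := by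
  have h0 : Φ.curve 0 y = φ.toFun y := by rw [Φ.curve_zero]
  have h1 : ∀ᶠ t in 𝓝 (0 : ℝ), Φ.curve t y ∈ κ.total.source :=
    (Φ.contMDiffAt_curve y).continuousAt.preimage_mem_nhds
      (κ.total.open_source.mem_nhds (by rwa [h0]))
  filter_upwards [Ioo_mem_nhds Φ.zero_mem.1 Φ.zero_mem.2, h1] with t h2 h3 using ⟨h2, h3⟩

theorem smooth_coord_variation (Φ : Variation φ) (hy : φ.toFun y ∈ κ.total.source) :
    ContDiffAt ℝ ∞ (fun z : ℝ × EuclideanSpace ℝ (Fin 3) ↦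
      κ.total (Φ.curve z.1 (κ.base.symm z.2))) (0, κ.base y) := by
  have hb := κ.base.left_inv (mem_base hy)
  have h0 : Φ.curve 0 y = φ.toFun y := by rw [Φ.curve_zero]
  have c1 : ContMDiffAt 𝓘(ℝ, ℝ × EuclideanSpace ℝ (Fin 3)) (𝓘(ℝ, ℝ).prod (𝓡 3)) ∞
      (fun z : ℝ × EuclideanSpace ℝ (Fin 3) ↦ (z.1, κ.base.symm z.2)) (0, κ.base y) :=
    contDiffAt_fst.contMDiffAt.prodMk (ContMDiffAt.comp (g := κ.base.symm) (f := Prod.snd) _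
      (κ.base_smooth.contMDiffAt_symm (κ.base.map_source (mem_base hy)))
      contDiffAt_snd.contMDiffAt)
  have c2 := ContMDiffAt.comp (g := fun z : ℝ × Y ↦ Φ.curve z.1 z.2) _
    (by rw [hb]; exact Φ.contMDiffAt Φ.zero_mem y) c1
  exact (ContMDiffAt.comp (g := κ.total) _
    (κ.total_smooth.contMDiffAt (by simpa [hb, h0] using hy)) c2).contDiffAt

/-- The prescribed velocity is vertical, so its base component in the chart is zero. It is computed
on a whole neighbourhood because `hasDerivAt_apply_fderiv_of_family` differentiates it in `x`. -/
theorem deriv_coord_variation (hΦ : Φ.HasVelocityNear ψ y) (hy : φ.toFun y ∈ κ.total.source) :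
    ∀ᶠ x in 𝓝 (κ.base y), deriv (fun t ↦ κ.total (Φ.curve t (κ.base.symm x))) 0 =
      (0, κ.alongRep φ ψ x) := by
  have hb := κ.base.map_source (mem_base hy)
  have c : ContinuousAt κ.base.symm (κ.base y) := κ.base.continuousAt_symm hb
  have e1 : ∀ᶠ z in 𝓝 y, φ.toFun z ∈ κ.total.source :=
    (φ.smooth y).continuousAt.preimage_mem_nhds (κ.total.open_source.mem_nhds hy)
  have e2 := e1.and hΦ
  rw [← κ.base.left_inv (mem_base hy)] at e2
  filter_upwards [c.eventually e2] with x hx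
  have h0 : Φ.curve 0 (κ.base.symm x) = φ.toFun (κ.base.symm x) := by rw [Φ.curve_zero]
  have h1 := κ.total_smooth.hasDerivAt_comp_curve (c := fun t ↦ Φ.curve t (κ.base.symm x))
    (by rw [h0]; exact hx.1)
    ((Φ.contMDiffAt_curve _).mdifferentiableAt (by simp))
  refine h1.deriv.trans ?_
  refine (congrArg (coordDeriv E κ.total _) hx.2).trans ?_
  rw [h0, κ.coordDeriv_toModel hx.1]
  rfl

/-- This is the derivative of `P(f_t) Df_t` for the coordinate family `f_t`. Its velocity is `(0,
ψ)`, and `P` is the identity on vertical vectors, so `P(0, ∂ψ)` is just `∂ψ`. -/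
theorem hasDerivAt_fib_covDeriv (hΦ : Φ.HasVelocityNear ψ y) (hy : φ.toFun y ∈ κ.total.source)
    (hψ : ContDiffAt ℝ ∞ (κ.alongRep φ ψ) (κ.base y)) (v : TangentSpace (𝓡 3) y) :
    HasDerivAt (fun t ↦ κ.fib (Φ.curve t y) (toModel (A.covDeriv (Φ.curve t) y v)))
      (fibreDeriv (κ.projRep A) (κ.sec φ (κ.base y)) (κ.alongRep φ ψ (κ.base y))
        (fderiv ℝ (κ.sec φ) (κ.base y) (coordDeriv (EuclideanSpace ℝ (Fin 3)) κ.base y v)) +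
       fderiv ℝ (κ.alongRep φ ψ) (κ.base y)
        (coordDeriv (EuclideanSpace ℝ (Fin 3)) κ.base y v)) 0 := by
  have hb := mem_base hy
  have hT := (smooth_projRep (A := A) hy).differentiableAt (by simp)
  have hv := projRep_vertical (A := A) hy
  rw [← sec_base hb] at hT hv
  have h1 := hasDerivAt_apply_fderiv_of_family (S := κ.sec φ)
    (w := fun x ↦ (0, κ.alongRep φ ψ x)) (smooth_coord_variation Φ hy)
    (fun h ↦ by simp only [Φ.curve_zero]; rfl) (deriv_coord_variation hΦ hy) hT
    (coordDeriv (EuclideanSpace ℝ (Fin 3)) κ.base y v)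
  have h2 : fderiv ℝ (fun x ↦ ((0 : EuclideanSpace ℝ (Fin 3)), κ.alongRep φ ψ x)) (κ.base y)
      (coordDeriv (EuclideanSpace ℝ (Fin 3)) κ.base y v) =
      (0, fderiv ℝ (κ.alongRep φ ψ) (κ.base y)
        (coordDeriv (EuclideanSpace ℝ (Fin 3)) κ.base y v)) := by
    have hd := (hψ.differentiableAt (by simp)).hasFDerivAt
    exact congrArg (fun L : EuclideanSpace ℝ (Fin 3) →L[ℝ] EuclideanSpace ℝ (Fin 3) × F ↦
      L (coordDeriv (EuclideanSpace ℝ (Fin 3)) κ.base y v))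
      ((hasFDerivAt_const (0 : EuclideanSpace ℝ (Fin 3)) _).prodMk hd).fderiv
  refine (h1.congr_deriv ?_).congr_of_eventuallyEq ?_
  · refine congrArg₂ (· + ·) rfl ?_
    exact (congrArg _ h2).trans (hv _)
  · filter_upwards [eventually_curve_mem Φ hy] with t ht
    rw [fib_covDeriv ((Φ.contMDiffAt_section ht.1 y).mdifferentiableAt (by simp)) hb ht.2,
      κ.base.left_inv hb]

end AdaptedChart

end Linearization

/-! ### Differentiating transported covariant derivatives -/

section LinearizedOperators

variable {Y : Type*} [TopologicalSpace Y] [ChartedSpace (EuclideanSpace ℝ (Fin 3)) Y]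
  [IsManifold (𝓡 3) ∞ Y]
  {E : Type*} [NormedAddCommGroup E] [NormedSpace ℝ E] [FiniteDimensional ℝ E]
  {N : Type*} [TopologicalSpace N] [ChartedSpace E N] [IsManifold 𝓘(ℝ, E) ∞ N]
  {F : Type*} [NormedAddCommGroup F] [NormedSpace ℝ F] [FiniteDimensional ℝ F]
  {pr : N → Y} {κ : AdaptedChart F E pr} {g : VerticalMetric E pr} {A : EhresmannConnection E pr}
  {φ : FibSection E pr} {ψ : φ.Along} {y : Y} {Φ : Variation φ}

namespace AdaptedChart

theorem hasDerivAt_coord_variation (hΦ : Φ.HasVelocityNear ψ y)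
    (hy : φ.toFun y ∈ κ.total.source) :
    HasDerivAt (fun t ↦ κ.total (Φ.curve t y)) (0, κ.alongRep φ ψ (κ.base y)) 0 := by
  have h1 := (deriv_coord_variation hΦ hy).self_of_nhds
  rw [κ.base.left_inv (mem_base hy)] at h1
  rw [← h1]
  have h0 : Φ.curve 0 y = φ.toFun y := by rw [Φ.curve_zero]
  exact (κ.total_smooth.hasDerivAt_comp_curve (c := fun t ↦ Φ.curve t y) (by rwa [h0])
    ((Φ.contMDiffAt_curve _).mdifferentiableAt (by simp))).differentiableAt.hasDerivAt

/-- This separates the effect of parallel transport from the operator being linearized, so that it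
serves for the connection and for the Fueter operator alike. -/
theorem hasDerivAt_transport_variation (hΦ : Φ.HasVelocityNear ψ y)
    (hy : φ.toFun y ∈ κ.total.source) {O : Π t : ℝ, VerticalSpace (E := E) pr (Φ.curve t y)}
    {o' : F} (hO : HasDerivAt (fun t ↦ κ.fib (Φ.curve t y) (toModel (O t))) o' 0) :
    HasDerivAt (fun t ↦ toModel (parallelTransport g (fun s ↦ Φ.curve s y) t (O t)))
      (toModel (κ.vlift (φ.toFun y) (o' + christoffel (κ.metric g) (κ.sec φ (κ.base y))
        (κ.alongRep φ ψ (κ.base y)) (κ.fib (Φ.curve 0 y) (toModel (O 0)))))) 0 := by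
  have h0 : Φ.curve 0 y = φ.toFun y := by rw [Φ.curve_zero]
  have h1 := hasDerivAt_parallelTransport (g := g) (c := fun s ↦ Φ.curve s y)
    (fun r ↦ Φ.isSection r y) (Φ.contMDiffAt_curve y) (by rwa [h0]) hO
  have h2 : deriv (fun r ↦ (κ.total (Φ.curve r y)).2) 0 = κ.alongRep φ ψ (κ.base y) :=
    (hasDerivAt_coord_variation hΦ hy).hasFDerivAt.snd.hasDerivAt.deriv.trans (by simp)
  refine h1.congr_deriv ?_
  have h3 : κ.sec φ (κ.base y) = κ.total (Φ.curve 0 y) := by rw [sec_base (mem_base hy), h0]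
  rw [h2, h3]
  exact congrArg (fun p ↦ toModel (κ.vlift p (o' + christoffel (κ.metric g)
    (κ.total (Φ.curve 0 y)) (κ.alongRep φ ψ (κ.base y))
      (κ.fib (Φ.curve 0 y) (toModel (O 0)))))) h0

theorem fib_covDeriv_zero (hy : φ.toFun y ∈ κ.total.source) (v : TangentSpace (𝓡 3) y) :
    κ.fib (Φ.curve 0 y) (toModel (A.covDeriv (Φ.curve 0) y v)) =
      κ.projRep A (κ.sec φ (κ.base y)) (fderiv ℝ (κ.sec φ) (κ.base y)
        (coordDeriv (EuclideanSpace ℝ (Fin 3)) κ.base y v)) := by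
  have h1 := fib_covDeriv (A := A) ((φ.smooth y).mdifferentiableAt (by simp)) (mem_base hy) hy v
  rw [← sec_base (mem_base hy)] at h1
  rw [Φ.curve_zero]
  exact h1

/-- The covariant derivatives of a curve of sections are linearized by `linNabla`. -/
theorem hasDerivAt_transport_covDeriv (hΦ : Φ.HasVelocityNear ψ y)
    (hy : φ.toFun y ∈ κ.total.source) (hψ : ContDiffAt ℝ ∞ (κ.alongRep φ ψ) (κ.base y))
    (v : TangentSpace (𝓡 3) y) :
    HasDerivAt (fun t ↦ toModel (parallelTransport g (fun s ↦ Φ.curve s y) t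
      (A.covDeriv (Φ.curve t) y v))) (toModel (κ.linNabla g A φ ψ y v)) 0 := by
  refine (hasDerivAt_transport_variation hΦ hy (hasDerivAt_fib_covDeriv hΦ hy hψ v)).congr_deriv ?_
  rw [fib_covDeriv_zero hy]
  have key : ∀ w : EuclideanSpace ℝ (Fin 3),
      fibreDeriv (κ.projRep A) (κ.sec φ (κ.base y)) (κ.alongRep φ ψ (κ.base y))
        (fderiv ℝ (κ.sec φ) (κ.base y) w) + fderiv ℝ (κ.alongRep φ ψ) (κ.base y) w +
      christoffel (κ.metric g) (κ.sec φ (κ.base y)) (κ.alongRep φ ψ (κ.base y))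
        (κ.projRep A (κ.sec φ (κ.base y)) (fderiv ℝ (κ.sec φ) (κ.base y) w)) =
      κ.linRep g A φ ψ (κ.base y) w := by
    intro w
    simp only [linRep, add_apply, ContinuousLinearMap.comp_apply]
    abel
  exact congrArg (fun a ↦ toModel (κ.vlift (φ.toFun y) a)) (key _)

end AdaptedChart

end LinearizedOperators

/-! ### The linearized Fueter operator -/

section LinearizedFueter

variable {Y : Type*} [TopologicalSpace Y] [ChartedSpace (EuclideanSpace ℝ (Fin 3)) Y]
  [IsManifold (𝓡 3) ∞ Y] [RiemannianBundle (fun y : Y ↦ TangentSpace (𝓡 3) y)]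
  {E : Type*} [NormedAddCommGroup E] [NormedSpace ℝ E] [FiniteDimensional ℝ E]
  {N : Type*} [TopologicalSpace N] [ChartedSpace E N] [IsManifold 𝓘(ℝ, E) ∞ N]
  {F : Type*} [NormedAddCommGroup F] [NormedSpace ℝ F] [FiniteDimensional ℝ F]
  {M : Type*} [TopologicalSpace M] [ChartedSpace F M]
  {pr : N → Y} {κ : AdaptedChart F E pr} {B : HyperkahlerBundle F M E pr}
  {A : EhresmannConnection E pr}
  {φ : FibSection E pr} {ψ : φ.Along} {y : Y} {Φ : Variation φ}

namespace AdaptedChart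

variable (κ) in
/-- The components in the coordinate basis of `κ` of the coframe used in `contract`. -/
def coframe (y : Y) (i : Fin 3) : EuclideanSpace ℝ (Fin 3) →L[ℝ] ℝ :=
  κ.covRep y (EuclideanSpace.proj i : EuclideanSpace ℝ (Fin 3) →L[ℝ] ℝ)

theorem fib_contract (q : Fib pr y) (hq : q.1 ∈ κ.total.source)
    (a : TangentSpace (𝓡 3) y →ₗ[ℝ] VerticalSpace (E := E) pr q.1) :
    κ.fib q.1 (toModel (B.contract y q a)) = ∑ i : Fin 3, κ.cliffRep B (κ.coframe y i)
      (κ.total q.1) (κ.fib q.1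
        (toModel (a (EuclideanSpace.single i 1 : EuclideanSpace ℝ (Fin 3))))) := by
  rw [HyperkahlerBundle.contract, Fin.sum_univ_three, Fin.sum_univ_three, toModel_add, toModel_add,
    map_add, map_add]
  exact congrArg₂ (· + ·) (congrArg₂ (· + ·) (fib_cliff q hq _ _) (fib_cliff q hq _ _))
    (fib_cliff q hq _ _)

/-- The Fueter operator is linearized by the Dirac operator. -/
theorem hasDerivAt_transport_fueter (hΦ : Φ.HasVelocityNear ψ y)
    (hy : φ.toFun y ∈ κ.total.source) (hψ : ContDiffAt ℝ ∞ (κ.alongRep φ ψ) (κ.base y)) :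
    HasDerivAt (fun t ↦ toModel (parallelTransport B.metric (fun s ↦ Φ.curve s y) t
        (fueter B A (Φ.curve t) (Φ.isSection t) y)))
      (toModel (B.contract y ⟨φ.toFun y, φ.isSection y⟩ (κ.linNabla B.metric A φ ψ y))) 0 := by
  have h0 : Φ.curve 0 y = φ.toFun y := by rw [Φ.curve_zero]
  have hb := mem_base hy
  let e : Fin 3 → TangentSpace (𝓡 3) y := fun i ↦
    (EuclideanSpace.single i 1 : EuclideanSpace ℝ (Fin 3))
  have hev : (fun t ↦ κ.fib (Φ.curve t y)
      (toModel (fueter B A (Φ.curve t) (Φ.isSection t) y))) =ᶠ[𝓝 0] fun t ↦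
      ∑ i : Fin 3, κ.cliffRep B (κ.coframe y i) (κ.total (Φ.curve t y))
        (κ.fib (Φ.curve t y) (toModel (A.covDeriv (Φ.curve t) y (e i)))) := by
    filter_upwards [eventually_curve_mem Φ hy] with t ht
      using fib_contract ⟨Φ.curve t y, Φ.isSection t y⟩ ht.2 _
  have hs : κ.total (Φ.curve 0 y) = κ.sec φ (κ.base y) := by rw [sec_base hb, h0]
  have dC : ∀ i, HasDerivAt (fun t ↦ κ.cliffRep B (κ.coframe y i) (κ.total (Φ.curve t y)))
      (fibreDeriv (κ.cliffRep B (κ.coframe y i)) (κ.sec φ (κ.base y))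
        (κ.alongRep φ ψ (κ.base y))) 0 := fun i ↦ by
    have hd := (smooth_cliffRep (B := B) hy (κ.coframe y i)).differentiableAt (by simp)
    rw [← h0] at hd
    rw [← hs]
    exact hasDerivAt_comp_of_fibreDeriv (x := fun t ↦ κ.total (Φ.curve t y)) hd
      (hasDerivAt_coord_variation hΦ hy)
  let w : Fin 3 → EuclideanSpace ℝ (Fin 3) := fun i ↦
    coordDeriv (EuclideanSpace ℝ (Fin 3)) κ.base y (e i)
  have dO : ∀ i, HasDerivAt
      (fun t ↦ κ.fib (Φ.curve t y) (toModel (A.covDeriv (Φ.curve t) y (e i))))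
      (fibreDeriv (κ.projRep A) (κ.sec φ (κ.base y)) (κ.alongRep φ ψ (κ.base y))
        (fderiv ℝ (κ.sec φ) (κ.base y) (w i)) + fderiv ℝ (κ.alongRep φ ψ) (κ.base y) (w i)) 0 :=
    fun i ↦ hasDerivAt_fib_covDeriv hΦ hy hψ (e i)
  have hz : ∀ i, κ.fib (Φ.curve 0 y) (toModel (A.covDeriv (Φ.curve 0) y (e i))) =
      κ.projRep A (κ.sec φ (κ.base y)) (fderiv ℝ (κ.sec φ) (κ.base y) (w i)) :=
    fun i ↦ fib_covDeriv_zero hy (e i)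
  have hn : ∀ i, κ.fib (φ.toFun y) (toModel (κ.linNabla B.metric A φ ψ y (e i))) =
      κ.linRep B.metric A φ ψ (κ.base y) (w i) := fun i ↦ fib_linNabla hy (e i)
  have h1 := HasDerivAt.fun_sum (u := Finset.univ) fun i _ ↦ (dC i).clm_apply (dO i)
  refine (hasDerivAt_transport_variation hΦ hy (h1.congr_of_eventuallyEq hev)).congr_deriv ?_
  refine congrArg toModel (κ.ext_fib hy ?_)
  have hev0 : κ.fib (Φ.curve 0 y) (toModel (fueter B A (Φ.curve 0) (Φ.isSection 0) y)) = _ :=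
    hev.self_of_nhds
  have hc : κ.fib (φ.toFun y) (toModel
      (B.contract y ⟨φ.toFun y, φ.isSection y⟩ (κ.linNabla B.metric A φ ψ y))) =
      ∑ i : Fin 3, κ.cliffRep B (κ.coframe y i) (κ.total (φ.toFun y))
        (κ.fib (φ.toFun y) (toModel (κ.linNabla B.metric A φ ψ y (e i)))) :=
    fib_contract ⟨_, φ.isSection y⟩ hy _
  simp only [hn] at hc
  simp only [hz] at hev0
  rw [κ.fib_vlift hy, hev0, hc, map_sum, ← Finset.sum_add_distrib]
  refine Finset.sum_congr rfl fun i _ ↦ ?_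
  -- Parallelism replaces `D_ψ J + Γ(ψ, ·) ∘ J`, applied to the covariant derivative of `φ`, by `J ∘
  -- Γ(ψ, ·)`. The terms then regroup, summand by summand, into `J` applied to `linRep`.
  have hp := cliffRep_parallel (B := B) hy (κ.coframe y i) (κ.alongRep φ ψ (κ.base y))
  rw [← sec_base hb] at hp ⊢
  rw [hz, hs]
  simp only [linRep, add_apply, ContinuousLinearMap.comp_apply, map_add, ← hp]
  abel

end AdaptedChart

end LinearizedFueter

/-! ### Curves of sections with given velocity -/

section Existence

variable {Y : Type*} [TopologicalSpace Y] [T2Space Y] [ChartedSpace (EuclideanSpace ℝ (Fin 3)) Y]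
  [IsManifold (𝓡 3) ∞ Y]
  {E : Type*} [NormedAddCommGroup E] [NormedSpace ℝ E] [FiniteDimensional ℝ E]
  {N : Type*} [TopologicalSpace N] [ChartedSpace E N] [IsManifold 𝓘(ℝ, E) ∞ N]
  {F : Type*} [NormedAddCommGroup F] [NormedSpace ℝ F] [FiniteDimensional ℝ F]
  {pr : N → Y} {κ : AdaptedChart F E pr} {φ : FibSection E pr} {ψ : φ.Along} {y : Y}

namespace AdaptedChart

variable (κ) in
/-- The point with coordinates `κ (φ x) + (0, t ψ(x))`. -/
def shift (φ : FibSection E pr) (ψ : φ.Along) (t : ℝ) (x : Y) : EuclideanSpace ℝ (Fin 3) × F :=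
  κ.total (φ.toFun x) + (0, t • κ.fib (φ.toFun x) (toModel (ψ x)))

theorem shift_zero (x : Y) : κ.shift φ ψ 0 x = κ.total (φ.toFun x) := by
  rw [shift, zero_smul]
  exact add_zero _

theorem smooth_shift (hψ : φ.SmoothAlong ψ) (hy : φ.toFun y ∈ κ.total.source) (t : ℝ) :
    ContMDiffAt (𝓘(ℝ, ℝ).prod (𝓡 3)) 𝓘(ℝ, EuclideanSpace ℝ (Fin 3) × F) ∞
      (fun z : ℝ × Y ↦ κ.shift φ ψ z.1 z.2) (t, y) := by
  have h1 : ContMDiffAt (𝓡 3) 𝓘(ℝ, EuclideanSpace ℝ (Fin 3) × F) ∞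
      (fun x ↦ κ.total (φ.toFun x)) y := (κ.total_smooth.contMDiffAt hy).comp y (φ.smooth y)
  have h2 := (κ.contMDiffAt_vertical_iff (φ.smooth y) hy).1 (hψ y)
  have h3 : ContMDiffAt (𝓘(ℝ, ℝ).prod (𝓡 3)) 𝓘(ℝ, F) ∞
      (fun z : ℝ × Y ↦ z.1 • κ.fib (φ.toFun z.2) (toModel (ψ z.2))) (t, y) :=
    contMDiffAt_fst.smul (h2.comp (t, y) contMDiffAt_snd)
  exact (h1.comp (t, y) contMDiffAt_snd).add (contMDiffAt_const.prodMk_space h3)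

theorem pr_symm_shift {t : ℝ} {x : Y} (hx : φ.toFun x ∈ κ.total.source)
    (ht : κ.shift φ ψ t x ∈ κ.total.target) : pr (κ.total.symm (κ.shift φ ψ t x)) = x := by
  have hm := κ.total.map_target ht
  apply κ.base.injOn (κ.pr_mem _ hm) (mem_base hx)
  rw [← κ.fst_total _ hm, κ.total.right_inv ht, shift, Prod.fst_add, add_zero, κ.fst_total _ hx,
    φ.isSection]

/-- In the chart, `φ` is moved by `t χ ψ` in the fibre direction, with a bump function `χ` around
`y`. The curve is constant off the support of `χ`, which makes it global, and has velocity `ψ` where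
`χ = 1`. -/
theorem exists_variation (hψ : φ.SmoothAlong ψ) (hy : φ.toFun y ∈ κ.total.source) :
    ∃ Φ : Variation φ, Φ.HasVelocityNear ψ y := by
  classical
  have hsrc : ∀ᶠ x in 𝓝 y, φ.toFun x ∈ κ.total.source :=
    (φ.smooth y).continuousAt.preimage_mem_nhds (κ.total.open_source.mem_nhds hy)
  have htgt : ∀ᶠ z : ℝ × Y in 𝓝 (0, y), κ.shift φ ψ z.1 z.2 ∈ κ.total.target :=
    (smooth_shift hψ hy 0).continuousAt.preimage_mem_nhds (κ.total.open_target.mem_nhds (by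
      change κ.shift φ ψ 0 y ∈ _
      rw [shift_zero]
      exact κ.total.map_source hy))
  rw [nhds_prod_eq] at htgt
  obtain ⟨P, hP, Q, hQ, hPQ⟩ := Filter.eventually_prod_iff.1 htgt
  obtain ⟨δ, hδ, hball⟩ := Metric.eventually_nhds_iff.1 hP
  obtain ⟨O, hO, hOo, hyO⟩ := eventually_nhds_iff.1 (hsrc.and hQ)
  have good : ∀ t x, |t| < δ → x ∈ O → κ.shift φ ψ t x ∈ κ.total.target := fun t x ht hx ↦
    hPQ (hball (by simpa [Real.dist_eq] using ht)) (hO x hx).2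
  -- The closed support lies in the good open set `O`, so every point outside `O` has a
  -- neighbourhood where the curve is constantly `φ`. Values of `χ` in `[0, 1]` keep the displaced
  -- points in the chart.
  obtain ⟨χ, -, hχ⟩ := (SmoothBumpFunction.nhds_basis_tsupport (I := 𝓡 3) y).mem_iff.1
    (hOo.mem_nhds hyO)
  have habs : ∀ t x, |t| < δ → |t * χ x| < δ := fun t x ht ↦ by
    rw [abs_mul, abs_of_nonneg χ.nonneg]
    exact (mul_le_of_le_one_right (abs_nonneg t) χ.le_one).trans_lt ht
  -- For `|t| ≥ δ` the curve is reset to `φ`: a section is required at all times, smoothness only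
  -- for `|t| < δ`.
  let curve : ℝ → Y → N := fun t x ↦
    if |t| < δ ∧ x ∈ O then κ.total.symm (κ.shift φ ψ (t * χ x) x) else φ.toFun x
  have hpos : ∀ t x, |t| < δ → x ∈ O →
      curve t x = κ.total.symm (κ.shift φ ψ (t * χ x) x) := fun t x ht hx ↦ if_pos ⟨ht, hx⟩
  have hzero : ∀ t x, t * χ x = 0 → curve t x = φ.toFun x := by
    intro t x h0
    by_cases h : |t| < δ ∧ x ∈ O
    · rw [hpos t x h.1 h.2, h0, shift_zero, κ.total.left_inv (hO x h.2).1]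
    · exact if_neg h
  have hcsmooth : ContMDiffOn (𝓘(ℝ, ℝ).prod (𝓡 3)) 𝓘(ℝ, E) ∞ (fun z : ℝ × Y ↦ curve z.1 z.2)
      (Set.Ioo (-δ) δ ×ˢ Set.univ) := by
    rintro ⟨t, x⟩ ⟨ht, -⟩
    refine ContMDiffAt.contMDiffWithinAt ?_
    by_cases hx : x ∈ O
    · have ht' : |t| < δ := abs_lt.2 ht
      have s1 : ContMDiffAt (𝓘(ℝ, ℝ).prod (𝓡 3)) (𝓘(ℝ, ℝ).prod (𝓡 3)) ∞
          (fun z : ℝ × Y ↦ (z.1 * χ z.2, z.2)) (t, x) :=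
        (contMDiffAt_fst.smul
          ((χ.contMDiff.contMDiffAt (x := x)).comp (t, x) contMDiffAt_snd)).prodMk contMDiffAt_snd
      have s2 := ContMDiffAt.comp (g := fun z : ℝ × Y ↦ κ.shift φ ψ z.1 z.2) (t, x)
        (smooth_shift hψ (hO x hx).1 (t * χ x)) s1
      have s3 := ContMDiffAt.comp (g := κ.total.symm) (t, x)
        (κ.total_smooth.contMDiffAt_symm (good _ x (habs t x ht') hx)) s2
      refine s3.congr_of_eventuallyEq ?_
      filter_upwards [(isOpen_Ioo.prod hOo).mem_nhds ⟨ht, hx⟩] with z hz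
        using hpos z.1 z.2 (abs_lt.2 hz.1) hz.2
    · have hx' : x ∉ tsupport χ := fun h ↦ hx (hχ h)
      refine ((φ.smooth x).comp (t, x) contMDiffAt_snd).congr_of_eventuallyEq ?_
      filter_upwards [(isOpen_univ.prod (isClosed_tsupport χ).isOpen_compl).mem_nhds
        ⟨Set.mem_univ t, hx'⟩] with z hz
      exact hzero z.1 z.2 (by rw [image_eq_zero_of_notMem_tsupport hz.2, mul_zero])
  let Φ : Variation φ :=
    { curve := curve
      isSection := fun t x ↦ by
        by_cases h : |t| < δ ∧ x ∈ O
        · rw [hpos t x h.1 h.2]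
          exact pr_symm_shift (hO x h.2).1 (good _ x (habs t x h.1) h.2)
        · rw [show curve t x = φ.toFun x from if_neg h, φ.isSection]
      curve_zero := funext fun x ↦ hzero 0 x (zero_mul _)
      ε := δ
      ε_pos := hδ
      smooth := hcsmooth }
  refine ⟨Φ, ?_⟩
  filter_upwards [χ.eventuallyEq_one, hOo.mem_nhds hyO] with x h1 hx
  have h0 : Φ.curve 0 x = φ.toFun x := by rw [Φ.curve_zero]
  have hs := (hO x hx).1
  have d1 := κ.total_smooth.hasDerivAt_comp_curve (c := fun t ↦ Φ.curve t x) (by rwa [h0])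
    ((Φ.contMDiffAt_curve x).mdifferentiableAt (by simp))
  have d2 : HasDerivAt (fun t : ℝ ↦ κ.shift φ ψ t x)
      (0, κ.fib (φ.toFun x) (toModel (ψ x))) 0 := by
    have := ((hasDerivAt_const (0 : ℝ) (0 : EuclideanSpace ℝ (Fin 3))).prodMk
      ((hasDerivAt_id (0 : ℝ)).smul_const (κ.fib (φ.toFun x) (toModel (ψ x))))).const_add
      (κ.total (φ.toFun x))
    exact this.congr_deriv (by simp)
  have ev : κ.total ∘ (fun t ↦ Φ.curve t x) =ᶠ[𝓝 0] fun t : ℝ ↦ κ.shift φ ψ t x := by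
    filter_upwards [Ioo_mem_nhds (neg_lt_zero.2 hδ) hδ] with t ht
    have h2 : Φ.curve t x = κ.total.symm (κ.shift φ ψ t x) := by
      have := hpos t x (abs_lt.2 ht) hx
      rwa [h1, Pi.one_apply, mul_one] at this
    rw [Function.comp, h2, κ.total.right_inv (good t x (abs_lt.2 ht) hx)]
  have h3 := d1.unique (d2.congr_of_eventuallyEq ev)
  rw [← κ.coordDeriv_toModel hs] at h3
  have h4 := congrArg (coordDerivSymm E κ.total (κ.total (φ.toFun x))) h3
  rw [κ.total_smooth.symm_deriv_deriv hs] at h4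
  rw [← h4, ← h0]
  have hs0 : Φ.curve 0 x ∈ κ.total.source := by rwa [h0]
  exact (κ.total_smooth.symm_deriv_deriv hs0 _).symm

end AdaptedChart

end Existence

/-! ### Leibniz rule, smoothness and uniqueness -/

section ConnectionProperties

variable {Y : Type*} [TopologicalSpace Y] [ChartedSpace (EuclideanSpace ℝ (Fin 3)) Y]
  [IsManifold (𝓡 3) ∞ Y]
  {E : Type*} [NormedAddCommGroup E] [NormedSpace ℝ E] [FiniteDimensional ℝ E]
  {N : Type*} [TopologicalSpace N] [ChartedSpace E N] [IsManifold 𝓘(ℝ, E) ∞ N]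
  {F : Type*} [NormedAddCommGroup F] [NormedSpace ℝ F] [FiniteDimensional ℝ F]
  {pr : N → Y} {κ : AdaptedChart F E pr} {g : VerticalMetric E pr} {A : EhresmannConnection E pr}
  {φ : FibSection E pr} {ψ ψ' : φ.Along} {y : Y}

namespace AdaptedChart

theorem alongRep_add : κ.alongRep φ (ψ + ψ') = κ.alongRep φ ψ + κ.alongRep φ ψ' :=
  funext fun _ ↦ map_add (κ.fib _) _ _

theorem alongRep_smul (f : Y → ℝ) : κ.alongRep φ (fun x ↦ f x • ψ x) =
    fun x ↦ f (κ.base.symm x) • κ.alongRep φ ψ x :=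
  funext fun _ ↦ map_smul (κ.fib _) _ _

theorem linNabla_add
    (hψ : DifferentiableAt ℝ (κ.alongRep φ ψ) (κ.base y))
    (hψ' : DifferentiableAt ℝ (κ.alongRep φ ψ') (κ.base y)) :
    κ.linNabla g A φ (ψ + ψ') y = κ.linNabla g A φ ψ y + κ.linNabla g A φ ψ' y := by
  have h1 : κ.linRep g A φ (ψ + ψ') (κ.base y) =
      κ.linRep g A φ ψ (κ.base y) + κ.linRep g A φ ψ' (κ.base y) := by
    rw [linRep, alongRep_add, fderiv_add hψ hψ', linRep, linRep, Pi.add_apply, map_add, map_add]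
    simp only [ContinuousLinearMap.add_comp]
    abel
  refine LinearMap.ext fun v ↦ ?_
  refine (congrArg (fun T : EuclideanSpace ℝ (Fin 3) →L[ℝ] F ↦ κ.vlift (φ.toFun y)
    (T (coordDeriv (EuclideanSpace ℝ (Fin 3)) κ.base y v))) h1).trans ?_
  exact map_add (κ.vlift (φ.toFun y)) _ _

theorem linNabla_leibniz (hy : φ.toFun y ∈ κ.total.source)
    (hψ : DifferentiableAt ℝ (κ.alongRep φ ψ) (κ.base y)) {f : Y → ℝ}
    (hf : ContMDiffAt (𝓡 3) 𝓘(ℝ, ℝ) ∞ f y) (v : TangentSpace (𝓡 3) y) :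
    κ.linNabla g A φ (fun x ↦ f x • ψ x) y v =
      f y • κ.linNabla g A φ ψ y v + mvfderiv (𝓡 3) f y v • ψ y := by
  have hb := mem_base hy
  have hfd : DifferentiableAt ℝ (f ∘ κ.base.symm) (κ.base y) :=
    ((κ.base_smooth.contMDiffAt_iff_contDiffAt hb).1 hf).differentiableAt (by simp)
  have h1 : ∀ w, κ.linRep g A φ (fun x ↦ f x • ψ x) (κ.base y) w =
      f y • κ.linRep g A φ ψ (κ.base y) w +
        fderiv ℝ (f ∘ κ.base.symm) (κ.base y) w • κ.alongRep φ ψ (κ.base y) := by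
    intro w
    have hd := (hfd.hasFDerivAt.smul hψ.hasFDerivAt).fderiv
    rw [linRep, alongRep_smul]
    erw [hd]
    simp only [linRep, Function.comp, κ.base.left_inv hb, add_apply, smul_apply, map_smul,
      ContinuousLinearMap.comp_apply, ContinuousLinearMap.smulRight_apply]
    module
  apply κ.ext_fib hy
  refine (fib_linNabla hy v).trans ((h1 _).trans ?_)
  rw [toModel_add, toModel_smul, toModel_smul, map_add, map_smul, map_smul, fib_linNabla hy v,
    alongRep_base hb]
  exact congrArg₂ (· + ·) rfl (congrArg (· • κ.fib (φ.toFun y) (toModel (ψ y)))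
    (κ.base_smooth.mvfderiv_eq hb hfd v).symm)

theorem smooth_linNabla (hy : φ.toFun y ∈ κ.total.source)
    (hψ : ContDiffAt ℝ ∞ (κ.alongRep φ ψ) (κ.base y)) {v : Π y : Y, TangentSpace (𝓡 3) y}
    (hv : ContMDiffAt (𝓡 3) (𝓡 3).tangent ∞ (fun y ↦ (⟨y, v y⟩ : TangentBundle (𝓡 3) Y)) y) :
    ContMDiffAt (𝓡 3) 𝓘(ℝ, E).tangent ∞ (fun y ↦ (⟨φ.toFun y,
      (κ.linNabla g A φ ψ y (v y) : TangentSpace 𝓘(ℝ, E) (φ.toFun y))⟩ : TangentBundle 𝓘(ℝ, E) N))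
      y := by
  rw [κ.contMDiffAt_vertical_iff (φ.smooth y) hy]
  have h1 := ((κ.base_smooth.contMDiffAt_tangent_iff (f := id) (w := v) (mem_base hy)).1 hv).2
  have h2 : ContMDiffAt (𝓡 3) 𝓘(ℝ, EuclideanSpace ℝ (Fin 3) →L[ℝ] F) ∞
      (fun z ↦ κ.linRep g A φ ψ (κ.base z)) y :=
    ContMDiffAt.comp (g := κ.linRep g A φ ψ) y (smooth_linRep hy hψ).contMDiffAt
      (κ.base_smooth.contMDiffAt (mem_base hy))
  refine (h2.clm_apply h1).congr_of_eventuallyEq ?_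
  filter_upwards [(φ.smooth y).continuousAt.preimage_mem_nhds (κ.total.open_source.mem_nhds hy)]
    with z hz using fib_linNabla hz _

end AdaptedChart

/-- The existence clause supplies a curve of sections, and the derivative along this one curve
determines the value. -/
theorem HasLinearizationAt.unique
    {𝒪 : Π s : Y → N, (∀ x, pr (s x) = x) → Π y : Y, VerticalSpace (E := E) pr (s y)}
    {w w' : VerticalSpace (E := E) pr (φ.toFun y)} (h : HasLinearizationAt g φ 𝒪 ψ y w)
    (h' : HasLinearizationAt g φ 𝒪 ψ y w') : w = w' := by
  obtain ⟨Φ, hΦ⟩ := h.1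
  exact toModel_injective ((h.2 Φ hΦ).unique (h'.2 Φ hΦ))

end ConnectionProperties

/-! ### Independence of the contraction from the basis -/

section Contraction

theorem clm_eq_sum_proj (ℓ : EuclideanSpace ℝ (Fin 3) →L[ℝ] ℝ) :
    ℓ = ∑ j : Fin 3, ℓ (EuclideanSpace.single j 1) • EuclideanSpace.proj j := by
  ext v
  have := congrArg ℓ ((EuclideanSpace.basisFun (Fin 3) ℝ).sum_repr v)
  simpa [mul_comm] using this.symm

/-- The contraction of a bilinear map with dual bases is a trace, and it is unchanged when one basis
is moved by `D` and the other by its inverse. -/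
theorem sum_proj_comp_apply {V : Type*} [AddCommGroup V] [Module ℝ V]
    (L : (EuclideanSpace ℝ (Fin 3) →L[ℝ] ℝ) →ₗ[ℝ] EuclideanSpace ℝ (Fin 3) →ₗ[ℝ] V)
    {S D : EuclideanSpace ℝ (Fin 3) →L[ℝ] EuclideanSpace ℝ (Fin 3)} (h : ∀ v, D (S v) = v) :
    ∑ i : Fin 3, L (EuclideanSpace.proj i ∘L S) (D (EuclideanSpace.single i 1)) =
      ∑ i : Fin 3, L (EuclideanSpace.proj i) (EuclideanSpace.single i 1) := by
  have h2 : ∀ v : EuclideanSpace ℝ (Fin 3), v = ∑ j : Fin 3, v j • EuclideanSpace.single j 1 := by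
    intro v
    simpa using ((EuclideanSpace.basisFun (Fin 3) ℝ).sum_repr v).symm
  calc _ = ∑ i : Fin 3, ∑ j : Fin 3, S (EuclideanSpace.single j 1) i •
        L (EuclideanSpace.proj j) (D (EuclideanSpace.single i 1)) := by
        refine Finset.sum_congr rfl fun i _ ↦ ?_
        rw [clm_eq_sum_proj (EuclideanSpace.proj i ∘L S)]
        simp
    _ = ∑ j : Fin 3, L (EuclideanSpace.proj j) (D (S (EuclideanSpace.single j 1))) := by
        rw [Finset.sum_comm]
        refine Finset.sum_congr rfl fun j _ ↦ ?_
        conv_rhs => rw [h2 (S (EuclideanSpace.single j 1))]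
        simp only [map_sum, map_smul]
    _ = _ := by simp only [h]

variable {Y : Type*} [TopologicalSpace Y] [ChartedSpace (EuclideanSpace ℝ (Fin 3)) Y]
  [IsManifold (𝓡 3) ∞ Y] [RiemannianBundle (fun y : Y ↦ TangentSpace (𝓡 3) y)]
  {E : Type*} [NormedAddCommGroup E] [NormedSpace ℝ E] [FiniteDimensional ℝ E]
  {N : Type*} [TopologicalSpace N] [ChartedSpace E N] [IsManifold 𝓘(ℝ, E) ∞ N]
  {F : Type*} [NormedAddCommGroup F] [NormedSpace ℝ F] [FiniteDimensional ℝ F]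
  {M : Type*} [TopologicalSpace M] [ChartedSpace F M]
  {pr : N → Y} {κ : AdaptedChart F E pr} {B : HyperkahlerBundle F M E pr}
  {A : EhresmannConnection E pr} {φ : FibSection E pr} {ψ : φ.Along} {y : Y}

namespace AdaptedChart

/-- The basis in `contract` comes from the preferred chart at `y` and may jump with `y`. Passing to
the coordinate basis of one fixed adapted chart makes smooth dependence on `y` visible. -/
theorem fib_contract_linNabla (hy : φ.toFun y ∈ κ.total.source) :
    κ.fib (φ.toFun y) (toModel
      (B.contract y ⟨φ.toFun y, φ.isSection y⟩ (κ.linNabla B.metric A φ ψ y))) =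
    ∑ i : Fin 3, κ.cliffRep B (EuclideanSpace.proj i) (κ.total (φ.toFun y))
      (κ.linRep B.metric A φ ψ (κ.base y) (EuclideanSpace.single i 1)) := by
  let L := LinearMap.mk₂ ℝ (fun (ℓ : EuclideanSpace ℝ (Fin 3) →L[ℝ] ℝ) v ↦
    κ.cliffRep B ℓ (κ.total (φ.toFun y)) (κ.linRep B.metric A φ ψ (κ.base y) v))
    (fun ℓ ℓ' v ↦ by rw [cliffRep_add, add_apply]) (fun r ℓ v ↦ by rw [cliffRep_smul, smul_apply])
    (fun ℓ v v' ↦ by rw [map_add, map_add]) (fun r ℓ v ↦ by rw [map_smul, map_smul])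
  refine Eq.trans ?_ (sum_proj_comp_apply L
    (κ.base_smooth.deriv_symm_deriv (mem_base hy)))
  refine (fib_contract ⟨φ.toFun y, φ.isSection y⟩ hy _).trans (Finset.sum_congr rfl fun i _ ↦ ?_)
  exact congrArg _ (fib_linNabla hy _)

theorem smooth_contract_linNabla (hy : φ.toFun y ∈ κ.total.source)
    (hψ : ContDiffAt ℝ ∞ (κ.alongRep φ ψ) (κ.base y)) :
    ContMDiffAt (𝓡 3) 𝓘(ℝ, E).tangent ∞ (fun y ↦ (⟨φ.toFun y,
      (B.contract y ⟨φ.toFun y, φ.isSection y⟩ (κ.linNabla B.metric A φ ψ y) :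
        TangentSpace 𝓘(ℝ, E) (φ.toFun y))⟩ : TangentBundle 𝓘(ℝ, E) N)) y := by
  rw [κ.contMDiffAt_vertical_iff (φ.smooth y) hy]
  have h1 := κ.total_smooth.contMDiffAt hy |>.comp y (φ.smooth y)
  have h2 : ContMDiffAt (𝓡 3) 𝓘(ℝ, EuclideanSpace ℝ (Fin 3) →L[ℝ] F) ∞
      (fun z ↦ κ.linRep B.metric A φ ψ (κ.base z)) y :=
    ContMDiffAt.comp (g := κ.linRep B.metric A φ ψ) y (smooth_linRep hy hψ).contMDiffAt
      (κ.base_smooth.contMDiffAt (mem_base hy))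
  have h3 : ∀ i : Fin 3, ContMDiffAt (𝓡 3) 𝓘(ℝ, F) ∞ (fun z ↦
      κ.cliffRep B (EuclideanSpace.proj i) (κ.total (φ.toFun z))
        (κ.linRep B.metric A φ ψ (κ.base z) (EuclideanSpace.single i 1))) y := fun i ↦
    (ContMDiffAt.comp (g := κ.cliffRep B (EuclideanSpace.proj i)) y
      (smooth_cliffRep hy _).contMDiffAt h1).clm_apply (h2.clm_apply contMDiffAt_const)
  have h4 := ((h3 0).add (h3 1)).add (h3 2)
  refine h4.congr_of_eventuallyEq ?_
  filter_upwards [(φ.smooth y).continuousAt.preimage_mem_nhds (κ.total.open_source.mem_nhds hy)]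
    with z hz
  refine (fib_contract_linNabla hz).trans ?_
  rw [Fin.sum_univ_three]
  rfl

end AdaptedChart

namespace HyperkahlerBundle

variable (B)

theorem contract_add (q : Fib pr y)
    (a b : TangentSpace (𝓡 3) y →ₗ[ℝ] VerticalSpace (E := E) pr q.1) :
    B.contract y q (a + b) = B.contract y q a + B.contract y q b := by
  rw [contract, contract, contract, ← Finset.sum_add_distrib]
  exact Finset.sum_congr rfl fun i _ ↦ map_add _ _ _

theorem contract_smul (q : Fib pr y) (r : ℝ)
    (a : TangentSpace (𝓡 3) y →ₗ[ℝ] VerticalSpace (E := E) pr q.1) :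
    B.contract y q (r • a) = r • B.contract y q a := by
  rw [contract, contract, Finset.smul_sum]
  exact Finset.sum_congr rfl fun i _ ↦ LinearMap.map_smul _ r _

/-- Expanding `α` in the coordinate coframe gives the Clifford action of `α`; this is how the
derivative term of the Leibniz rule becomes the principal symbol. -/
theorem contract_smulRight (q : Fib pr y) (α : TangentSpace (𝓡 3) y →L[ℝ] ℝ)
    (u : VerticalSpace (E := E) pr q.1) :
    B.contract y q (α.toLinearMap.smulRight u) = B.cliff y α q u := by
  let Λ : (EuclideanSpace ℝ (Fin 3) →L[ℝ] ℝ) →ₗ[ℝ] VerticalSpace (E := E) pr q.1 :=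
    { toFun := fun β ↦ B.cliff y β q u
      map_add' := fun β β' ↦ congrArg (fun T ↦ T q u) (map_add (B.cliff y) β β')
      map_smul' := fun r β ↦ congrArg (fun T ↦ T q u) (map_smul (B.cliff y) r β) }
  have h2 := congrArg Λ (clm_eq_sum_proj α)
  refine Eq.trans ?_ h2.symm
  rw [map_sum]
  refine Finset.sum_congr rfl fun i _ ↦ ?_
  exact (LinearMap.map_smul (B.cliff y _ q) _ u).trans (map_smul Λ _ _).symm

end HyperkahlerBundle

end Contraction

/-! ### Global operators and ellipticity -/

section MainTheorem

variable {Y : Type*} [TopologicalSpace Y] [T2Space Y] [ChartedSpace (EuclideanSpace ℝ (Fin 3)) Y]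
  [IsManifold (𝓡 3) ∞ Y] [RiemannianBundle (fun y : Y ↦ TangentSpace (𝓡 3) y)]
  {E : Type*} [NormedAddCommGroup E] [NormedSpace ℝ E] [FiniteDimensional ℝ E]
  {N : Type*} [TopologicalSpace N] [ChartedSpace E N] [IsManifold 𝓘(ℝ, E) ∞ N]
  {F : Type*} [NormedAddCommGroup F] [NormedSpace ℝ F] [FiniteDimensional ℝ F]
  {M : Type*} [TopologicalSpace M] [ChartedSpace F M] [IsManifold 𝓘(ℝ, F) ∞ M]
  {pr : N → Y}

namespace FibSection

variable {φ : FibSection E pr} {ψ : φ.Along} {y : Y}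

theorem SmoothAlong.smooth_alongRep (hψ : φ.SmoothAlong ψ) {κ : AdaptedChart F E pr}
    (hy : φ.toFun y ∈ κ.total.source) : ContDiffAt ℝ ∞ (κ.alongRep φ ψ) (κ.base y) :=
  (AdaptedChart.smoothAlong_iff_at hy).1 (hψ y)

theorem SmoothAlong.smul (B : HyperkahlerBundle F M E pr) (hψ : φ.SmoothAlong ψ) {f : Y → ℝ}
    (hf : ContMDiff (𝓡 3) 𝓘(ℝ, ℝ) ∞ f) : φ.SmoothAlong fun x ↦ f x • ψ x := by
  intro y
  obtain ⟨κ, hy⟩ := B.isFiberBundle.exists_adaptedChart (φ.toFun y)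
  refine (AdaptedChart.smoothAlong_iff_at hy).2 ?_
  rw [AdaptedChart.alongRep_smul]
  exact ((κ.base_smooth.contMDiffAt_iff_contDiffAt (AdaptedChart.mem_base hy)).1 (hf y)).smul
    (hψ.smooth_alongRep hy)

end FibSection

namespace HyperkahlerBundle

variable (B : HyperkahlerBundle F M E pr) (A : EhresmannConnection E pr) (φ : FibSection E pr)

/-- The connection `L_φ ∇` on the pulled back vertical bundle. -/
def linearizedConnection (ψ : φ.Along) (y : Y) :
    TangentSpace (𝓡 3) y →ₗ[ℝ] VerticalSpace (E := E) pr (φ.toFun y) :=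
  (B.isFiberBundle.exists_adaptedChart (φ.toFun y)).choose.linNabla B.metric A φ ψ y

variable {B A φ} {ψ : φ.Along} {y : Y}

theorem hasLinearizationAt_covDeriv {κ : AdaptedChart F E pr} (hψ : φ.SmoothAlong ψ)
    (hy : φ.toFun y ∈ κ.total.source) (v : Π y : Y, TangentSpace (𝓡 3) y) :
    HasLinearizationAt B.metric φ (fun s _ x ↦ A.covDeriv s x (v x)) ψ y
      (κ.linNabla B.metric A φ ψ y (v y)) :=
  ⟨AdaptedChart.exists_variation hψ hy, fun _ hΦ ↦
    AdaptedChart.hasDerivAt_transport_covDeriv hΦ hy (hψ.smooth_alongRep hy) (v y)⟩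

/-- Both sides are linearizations of the same operator, hence equal by uniqueness. Thus the chart
chosen separately at each point in the definition may be replaced by one chart for a whole
neighbourhood. -/
theorem linearizedConnection_eq {κ : AdaptedChart F E pr} (hψ : φ.SmoothAlong ψ)
    (hy : φ.toFun y ∈ κ.total.source) :
    B.linearizedConnection A φ ψ y = κ.linNabla B.metric A φ ψ y := by
  refine LinearMap.ext fun w ↦ ?_
  have h := (B.isFiberBundle.exists_adaptedChart (φ.toFun y)).choose_spec
  let v : Π x : Y, TangentSpace (𝓡 3) x := fun x ↦ (w : EuclideanSpace ℝ (Fin 3))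
  exact (hasLinearizationAt_covDeriv (A := A) (B := B) hψ h v).unique
    (hasLinearizationAt_covDeriv hψ hy v)

theorem isLinearizationOfConnection_linearizedConnection :
    IsLinearizationOfConnection B.metric A φ (B.linearizedConnection A φ) := by
  intro ψ hψ v y
  obtain ⟨κ, hy⟩ := B.isFiberBundle.exists_adaptedChart (φ.toFun y)
  rw [linearizedConnection_eq hψ hy]
  exact hasLinearizationAt_covDeriv hψ hy v

theorem isLinearConnection_linearizedConnection :
    IsLinearConnection φ (B.linearizedConnection A φ) where
  add ψ ψ' hψ hψ' := by
    funext y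
    have h := (B.isFiberBundle.exists_adaptedChart (φ.toFun y)).choose_spec
    exact AdaptedChart.linNabla_add ((hψ.smooth_alongRep h).differentiableAt (by simp))
      ((hψ'.smooth_alongRep h).differentiableAt (by simp))
  leibniz f ψ hf hψ y v := by
    have h := (B.isFiberBundle.exists_adaptedChart (φ.toFun y)).choose_spec
    exact AdaptedChart.linNabla_leibniz h ((hψ.smooth_alongRep h).differentiableAt (by simp))
      (hf y) v
  -- Additivity and the Leibniz rule are pointwise and could use the chosen chart at `y`; smoothness
  -- needs a single chart around `y`.
  smooth ψ v hψ hv := by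
    intro y
    obtain ⟨κ, hy⟩ := B.isFiberBundle.exists_adaptedChart (φ.toFun y)
    refine (AdaptedChart.smooth_linNabla (g := B.metric) (A := A) hy (hψ.smooth_alongRep hy)
      (hv y)).congr_of_eventuallyEq ?_
    filter_upwards [(φ.smooth y).continuousAt.preimage_mem_nhds
      (κ.total.open_source.mem_nhds hy)] with z hz
    rw [linearizedConnection_eq hψ hz]

theorem hasLinearizationAt_fueter (hψ : φ.SmoothAlong ψ) (y : Y) :
    HasLinearizationAt B.metric φ (fueter B A) ψ y
      (dirac B φ (B.linearizedConnection A φ) ψ y) := by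
  obtain ⟨κ, hy⟩ := B.isFiberBundle.exists_adaptedChart (φ.toFun y)
  rw [dirac, linearizedConnection_eq hψ hy]
  exact ⟨AdaptedChart.exists_variation hψ hy, fun _ hΦ ↦
    AdaptedChart.hasDerivAt_transport_fueter hΦ hy (hψ.smooth_alongRep hy)⟩

theorem isLinearizationOfFueter_iff {L : φ.Along → φ.Along} :
    IsLinearizationOfFueter B A φ L ↔
      ∀ ψ, φ.SmoothAlong ψ → L ψ = dirac B φ (B.linearizedConnection A φ) ψ := by
  refine ⟨fun h ψ hψ ↦ funext fun y ↦ (h ψ hψ y).unique (hasLinearizationAt_fueter hψ y),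
    fun h ψ hψ y ↦ ?_⟩
  rw [h ψ hψ]
  exact hasLinearizationAt_fueter hψ y

theorem smoothAlong_dirac (hψ : φ.SmoothAlong ψ) :
    φ.SmoothAlong (dirac B φ (B.linearizedConnection A φ) ψ) := by
  intro y
  obtain ⟨κ, hy⟩ := B.isFiberBundle.exists_adaptedChart (φ.toFun y)
  refine (AdaptedChart.smooth_contract_linNabla (B := B) (A := A) hy
    (hψ.smooth_alongRep hy)).congr_of_eventuallyEq ?_
  filter_upwards [(φ.smooth y).continuousAt.preimage_mem_nhds
    (κ.total.open_source.mem_nhds hy)] with z hz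
  rw [dirac, linearizedConnection_eq hψ hz]

/-- The principal symbol of a Dirac operator is the Clifford action. -/
theorem dirac_smul {D : φ.Along → Π y : Y, TangentSpace (𝓡 3) y →ₗ[ℝ]
    VerticalSpace (E := E) pr (φ.toFun y)} (hD : IsLinearConnection φ D) {f : Y → ℝ}
    (hf : ContMDiff (𝓡 3) 𝓘(ℝ, ℝ) ∞ f) (hψ : φ.SmoothAlong ψ) (y : Y) :
    dirac B φ D (fun x ↦ f x • ψ x) y = f y • dirac B φ D ψ y +
      B.cliff y (mvfderiv (𝓡 3) f y) ⟨φ.toFun y, φ.isSection y⟩ (ψ y) := by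
  have h : D (fun x ↦ f x • ψ x) y =
      f y • D ψ y + (mvfderiv (𝓡 3) f y).toLinearMap.smulRight (ψ y) :=
    LinearMap.ext fun v ↦ hD.leibniz f ψ hf hψ y v
  rw [dirac, h, B.contract_add ⟨φ.toFun y, φ.isSection y⟩,
    B.contract_smul ⟨φ.toFun y, φ.isSection y⟩,
    B.contract_smulRight ⟨φ.toFun y, φ.isSection y⟩, dirac]

/-- The square of the action is the nonzero scalar `-|α|²`. -/
theorem bijective_cliff {α : TangentSpace (𝓡 3) y →L[ℝ] ℝ} (hα : α ≠ 0) (q : Fib pr y) :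
    Function.Bijective (B.cliff y α q) := by
  have hn : -(‖α‖ ^ 2) ≠ 0 := neg_ne_zero.2 (pow_ne_zero 2 (norm_ne_zero_iff.2 hα))
  refine ⟨fun u w huw ↦ ?_, fun w ↦ ⟨(-(‖α‖ ^ 2))⁻¹ • B.cliff y α q w, ?_⟩⟩
  · have h := congrArg (B.cliff y α q) huw
    rw [B.cliff_sq, B.cliff_sq] at h
    exact smul_right_injective _ hn h
  · rw [map_smul, B.cliff_sq, smul_smul, inv_mul_cancel₀ hn, one_smul]

/-- The commutator of `L` with `f` is `γ(df)`, which is linear over functions, so a second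
commutator vanishes and the symbol at `α` is `γ(α)`. Since `L` is known only on smooth sections,
sums and multiples must first be seen to be smooth. -/
theorem isEllipticFirstOrder_of_eq_dirac {L : φ.Along → φ.Along}
    (h : ∀ ψ, φ.SmoothAlong ψ → L ψ = dirac B φ (B.linearizedConnection A φ) ψ) :
    IsEllipticFirstOrder φ L := by
  have hD := isLinearConnection_linearizedConnection (B := B) (A := A) (φ := φ)
  have hL : ∀ (f : Y → ℝ) (ψ : φ.Along), ContMDiff (𝓡 3) 𝓘(ℝ, ℝ) ∞ f → φ.SmoothAlong ψ → ∀ y,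
      L (fun x ↦ f x • ψ x) y = f y • L ψ y +
        B.cliff y (mvfderiv (𝓡 3) f y) ⟨φ.toFun y, φ.isSection y⟩ (ψ y) := by
    intro f ψ hf hψ y
    rw [h _ (hψ.smul B hf), h ψ hψ]
    exact dirac_smul hD hf hψ y
  refine ⟨fun ψ hψ ↦ ?_, fun ψ ψ' hψ hψ' ↦ ?_, fun a ψ hψ ↦ ?_, fun f k ψ hf hk hψ y ↦ ?_,
    fun y α ↦ ⟨B.cliff y α ⟨φ.toFun y, φ.isSection y⟩, fun f ψ hf hα hψ ↦ ?_,
      fun hα ↦ bijective_cliff hα _⟩⟩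
  · rw [h ψ hψ]
    exact smoothAlong_dirac hψ
  · have hs : φ.SmoothAlong (ψ + ψ') := by
      intro y
      obtain ⟨κ, hy⟩ := B.isFiberBundle.exists_adaptedChart (φ.toFun y)
      refine (AdaptedChart.smoothAlong_iff_at hy).2 ?_
      rw [AdaptedChart.alongRep_add]
      exact (hψ.smooth_alongRep hy).add (hψ'.smooth_alongRep hy)
    rw [h _ hs, h ψ hψ, h ψ' hψ']
    funext y
    rw [dirac, hD.add ψ ψ' hψ hψ']
    exact B.contract_add ⟨φ.toFun y, φ.isSection y⟩ _ _
  · funext y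
    refine (hL (fun _ ↦ a) ψ contMDiff_const hψ y).trans ?_
    have h0 : mvfderiv (𝓡 3) (fun _ : Y ↦ a) y = 0 := by
      refine ContinuousLinearMap.ext fun v ↦ ?_
      simp [mvfderiv]
    rw [h0, map_zero]
    exact add_zero _
  · rw [hL f _ hf (hψ.smul B hk), hL k ψ hk hψ, hL f ψ hf hψ, map_smul]
    module
  · rw [hL f ψ hf hψ, hα, add_sub_cancel_left]

end HyperkahlerBundle

end MainTheorem
end
theorem propositionp
    {Y : Type*} [TopologicalSpace Y] [T2Space Y] [ChartedSpace (EuclideanSpace ℝ (Fin 3)) Y]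
    [IsManifold (𝓡 3) ∞ Y] [RiemannianBundle (fun y : Y ↦ TangentSpace (𝓡 3) y)]
    [IsContMDiffRiemannianBundle (𝓡 3) ∞ (EuclideanSpace ℝ (Fin 3))
      (fun y : Y ↦ TangentSpace (𝓡 3) y)]
    {F : Type*} [NormedAddCommGroup F] [NormedSpace ℝ F] [FiniteDimensional ℝ F]
    {M : Type*} [TopologicalSpace M] [T2Space M] [ChartedSpace F M] [IsManifold 𝓘(ℝ, F) ∞ M]
    {E : Type*} [NormedAddCommGroup E] [NormedSpace ℝ E] [FiniteDimensional ℝ E]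
    {N : Type*} [TopologicalSpace N] [T2Space N] [ChartedSpace E N] [IsManifold 𝓘(ℝ, E) ∞ N]
    (pr : N → Y) (B : HyperkahlerBundle F M E pr) (A : EhresmannConnection E pr)
    (φ : FibSection E pr) :
    IsCliffordModule B φ ∧
    ∃ nabla : φ.Along →
        Π y : Y, TangentSpace (𝓡 3) y →ₗ[ℝ] VerticalSpace (E := E) pr (φ.toFun y),
      IsLinearConnection φ nabla ∧
      IsLinearizationOfConnection B.metric A φ nabla ∧
      (∀ L : φ.Along → φ.Along, IsLinearizationOfFueter B A φ L ↔
        ∀ ψ, φ.SmoothAlong ψ → L ψ = dirac B φ nabla ψ) ∧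
      (∀ L : φ.Along → φ.Along, IsLinearizationOfFueter B A φ L → IsEllipticFirstOrder φ L) := by
  exact ⟨isCliffordModule B φ, B.linearizedConnection A φ,
    HyperkahlerBundle.isLinearConnection_linearizedConnection,
    HyperkahlerBundle.isLinearizationOfConnection_linearizedConnection,
    fun _ ↦ HyperkahlerBundle.isLinearizationOfFueter_iff,
    fun _ hL ↦ HyperkahlerBundle.isEllipticFirstOrder_of_eq_dirac
      (HyperkahlerBundle.isLinearizationOfFueter_iff.1 hL)⟩
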